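/- **Theorem 1.** Let $(\Omega,\mathcal F,P)$ be a probability space carrying a real Brownian motion $W=\{W_s\}_{s\ge 0}$, and let $\{\mathcal F_s\}_{s\ge 0}$ be the filtration generated by $W$, augmented by the $P$-null events. Let $0\le t\le T$, $x\in\mathbb R$, $L\in\mathbb R$ and $m\in\mathbb N$. Let $b,\sigma:\mathbb R\times\mathbb R\times\mathbb R^m\to\mathbb R$ be continuous, and let $\beta,\rho:[t,T]\to\mathbb R$ be deterministic piecewise continuous functions (finitely many discontinuities, finite one-sided limits). Assume: 1. For $f\in\{b,\sigma\}$ there is a constant $K$ such that for all $r\in\{\beta_s: t\le s\le T\}$, $y,y'\in\mathbb R$ and $u,u'\in\mathbb R^m$, $$|f(r,y,u)|\le K(1+|y|+|u|),\qquad |f(r,y,u)-f(r,y',u')|\le L(|y-y'|+|u-u'|).$$ 2. The feedback law $u^*:\mathbb R\times[t,T]\times\mathbb R\to\mathbb R^m$ is Borel measurable, with $|u^*(\rho_s,s,y)-u^*(\rho_s,s,z)|\le L|y-z|$ for all $s\in[t,T]$ and $y,z\in\mathbb R$, and $\int_t^T|u^*(\rho_s,s,0)|^2\,\mathrm ds<\infty$.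 Then the stochastic differential equation obtained by plugging the feedback control into the state equation, $$\mathrm dX_s=b\big(\beta_s,X_s,u^*(\rho_s,s,X_s)\big)\,\mathrm ds+\sigma\big(\beta_s,X_s,u^*(\rho_s,s,X_s)\big)\,\mathrm dW_s,\qquad t\le s\le T,\quad X_t=x,$$ admits a unique strong solution. That is, there is a continuous process $X$ on $[t,T]$, adapted to $\{\mathcal F_s\}$, such that almost surely $\int_t^T\big(|b|+|\sigma|^2\big)(\beta_s,X_s,u^*(\rho_s,s,X_s))\,\mathrm ds<\infty$ and $$X_s=x+\int_t^s b(\beta_r,X_r,u^*(\rho_r,r,X_r))\,\mathrm dr+\int_t^s\sigma(\beta_r,X_r,u^*(\rho_r,r,X_r))\,\mathrm dW_r\quad\text{for all } s\in[t,T];$$ and any two such processes $X,X'$ satisfy $P(X_s=X'_s\text{ for all }s\in[t,T])=1$. -/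

import Mathlib

open MeasureTheory ProbabilityTheory Filter Topology
open scoped NNReal ENNReal

/-- Lebesgue measure on the time axis `[0, ∞)`. -/
noncomputable def timeMeasure : Measure ℝ≥0 :=
  Measure.comap (fun s : ℝ≥0 => (s : ℝ)) volume

/-- `f` is piecewise continuous on `[t, T]`: it is continuous there except at finitely many points,
and it has finite one-sided limits everywhere in the interval. -/
def PiecewiseContinuousOn (f : ℝ≥0 → ℝ) (t T : ℝ≥0) : Prop :=
  (∃ S : Finset ℝ≥0, ∀ s ∈ Set.Icc t T, s ∉ S → ContinuousWithinAt f (Set.Icc t T) s) ∧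
  (∀ s ∈ Set.Ico t T, ∃ l : ℝ, Tendsto f (𝓝[>] s) (𝓝 l)) ∧
  (∀ s ∈ Set.Ioc t T, ∃ l : ℝ, Tendsto f (𝓝[<] s) (𝓝 l))

section Filtration

variable {Ω : Type*} {mΩ : MeasurableSpace Ω}

/-- The filtration generated by the process `W`, augmented by the `P`-null events. -/
def brownianFiltration (P : Measure Ω) (W : ℝ≥0 → Ω → ℝ) (hW : ∀ s, Measurable (W s)) :
    Filtration ℝ≥0 mΩ where
  seq s := (⨆ r ≤ s, MeasurableSpace.comap (W r) inferInstance) ⊔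
    MeasurableSpace.generateFrom {N | MeasurableSet N ∧ P N = 0}
  mono' _ _ hst := sup_le_sup_right (biSup_mono fun _ hr => hr.trans hst) _
  le' _ := sup_le (iSup₂_le fun r _ => (hW r).comap_le)
    (MeasurableSpace.generateFrom_le fun _ hN => hN.1)

/-- A bounded simple process on `[t, ∞)`: the process `∑_{i < n} ξ_i 1_{(t_i, t_{i+1}]}` with
`t ≤ t_0 ≤ t_1 ≤ ⋯` and `ξ_i` bounded and measurable with respect to the past of `t_i`. -/
structure SimpleProcess (F : Filtration ℝ≥0 mΩ) (t : ℝ≥0) where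
  n : ℕ
  time : ℕ → ℝ≥0
  coeff : ℕ → Ω → ℝ
  start_le : ∀ i, t ≤ time i
  mono : Monotone time
  measurable : ∀ i, Measurable[F (time i)] (coeff i)
  bounded : ∃ C : ℝ, ∀ i ω, |coeff i ω| ≤ C

namespace SimpleProcess

variable {F : Filtration ℝ≥0 mΩ} {t : ℝ≥0}

/-- The value of the simple process at time `s`. -/
noncomputable def val (G : SimpleProcess F t) (s : ℝ≥0) (ω : Ω) : ℝ :=
  ∑ i ∈ Finset.range G.n,
    (Set.Ioc (G.time i) (G.time (i + 1))).indicator (fun _ => G.coeff i ω) s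

/-- The elementary stochastic integral `∫_t^s G dW`. -/
noncomputable def integral (G : SimpleProcess F t) (W : ℝ≥0 → Ω → ℝ) (s : ℝ≥0) (ω : Ω) : ℝ :=
  ∑ i ∈ Finset.range G.n,
    G.coeff i ω * (W (min (G.time (i + 1)) s) ω - W (min (G.time i) s) ω)

end SimpleProcess

/-- `Y` is (a continuous adapted version of) the Itô integral process `s ↦ ∫_t^s H dW`, `t ≤ s ≤ T`,
of the progressively measurable process `H` with `∫_t^T H² ds < ∞` almost surely: there are simple
processes `G k` with `∫_t^T |G k - H|² ds → 0` in probability and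
`sup_{t ≤ s ≤ T} |∫_t^s G k dW - Y s| → 0` in probability. -/
structure IsItoIntegral (F : Filtration ℝ≥0 mΩ) (P : Measure Ω) (W : ℝ≥0 → Ω → ℝ) (t T : ℝ≥0)
    (H Y : ℝ≥0 → Ω → ℝ) : Prop where
  progressive : IsProgressive F (fun s ω => (Set.Icc t T).indicator (fun r => H r ω) s)
  sq_integrable : ∀ᵐ ω ∂P, ∫⁻ s in Set.Icc t T, ENNReal.ofReal (H s ω ^ 2) ∂timeMeasure < ∞
  adapted : ∀ s ∈ Set.Icc t T, Measurable[F s] (Y s)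
  continuous : ∀ ω, ContinuousOn (fun s => Y s ω) (Set.Icc t T)
  approx : ∃ G : ℕ → SimpleProcess F t,
    (∀ ε : ℝ≥0∞, 0 < ε → Tendsto (fun k => P {ω | ε ≤
      ∫⁻ s in Set.Icc t T, ENNReal.ofReal (((G k).val s ω - H s ω) ^ 2) ∂timeMeasure})
      atTop (𝓝 0)) ∧
    (∀ ε : ℝ, 0 < ε → Tendsto (fun k => P {ω | ∃ s ∈ Set.Icc t T,
      ε ≤ |(G k).integral W s ω - Y s ω|}) atTop (𝓝 0))

/-- `X` is a strong solution on `[t, T]` of `dX_s = B(s, X_s) ds + S(s, X_s) dW_s`, `X_t = x`, with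
respect to the filtration `F`: a continuous `F`-adapted process such that almost surely
`∫_t^T |B(s, X_s)| + |S(s, X_s)|² ds < ∞` and
`X_s = x + ∫_t^s B(r, X_r) dr + ∫_t^s S(r, X_r) dW_r` for all `s ∈ [t, T]`. -/
structure IsStrongSolution (F : Filtration ℝ≥0 mΩ) (P : Measure Ω) (W : ℝ≥0 → Ω → ℝ) (t T : ℝ≥0)
    (x : ℝ) (B S : ℝ≥0 → ℝ → ℝ) (X : ℝ≥0 → Ω → ℝ) : Prop where
  adapted : ∀ s ∈ Set.Icc t T, Measurable[F s] (X s)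
  continuous : ∀ ω, ContinuousOn (fun s => X s ω) (Set.Icc t T)
  initial : ∀ᵐ ω ∂P, X t ω = x
  drift_integrable : ∀ᵐ ω ∂P, IntegrableOn (fun s => B s (X s ω)) (Set.Icc t T) timeMeasure
  equation : ∃ Y : ℝ≥0 → Ω → ℝ, IsItoIntegral F P W t T (fun s ω => S s (X s ω)) Y ∧
    ∀ᵐ ω ∂P, ∀ s ∈ Set.Icc t T,
      X s ω = x + ∫ r in Set.Icc t s, B r (X r ω) ∂timeMeasure + Y s ω

end Filtration

/-- A coefficient `f(r, x, u)` has linear growth and is Lipschitz with constant `L` in `(x, u)`,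
uniformly for the parameter `r` in the set `R`. -/
structure LinearGrowthLipschitz {E : Type*} [NormedAddCommGroup E] (f : ℝ → ℝ → E → ℝ)
    (R : Set ℝ) (L : ℝ) : Prop where
  growth : ∃ K : ℝ, ∀ r ∈ R, ∀ x u, |f r x u| ≤ K * (1 + |x| + ‖u‖)
  lipschitz : ∀ r ∈ R, ∀ x x' u u', |f r x u - f r x' u'| ≤ L * (|x - x'| + ‖u - u'‖)

/-- The coefficient `f` with the feedback control `u* (ρ_s, s, x)` plugged in:
`(s, x) ↦ f (β_s, x, u* (ρ_s, s, x))`. -/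
def feedbackCoeff {E : Type*} (f : ℝ → ℝ → E → ℝ) (ustar : ℝ → ℝ≥0 → ℝ → E)
    (β ρ : ℝ≥0 → ℝ) (s : ℝ≥0) (x : ℝ) : ℝ :=
  f (β s) x (ustar (ρ s) s x)

/-! Plugging the feedback in leaves coefficients `B(s,y)` and `S(s,y)` that are jointly measurable
and Lipschitz in `y` on `[t,T]` with constant `|L|(1+|L|)`. Linear growth and the square
integrability of `u*(ρ_s,s,0)` make `B(·,0)` and `S(·,0)` square integrable in time
(`isLipschitzCoeff_feedbackCoeff`). The theorem is therefore Itô's theorem for Lipschitz equations,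
with a bound at `y = 0` that is only `L²` in time.

The Itô integral is given as a limit in probability of elementary integrals, so every estimate is
proved for step processes and passed to the limit. For these, independence of increments yields the
isometry conditionally on the past (`StepFamily.setLIntegral_integral_sq`), Doob's maximal
inequality (`StepFamily.measure_exists_mem_Icc_le`), and an isometry inequality localised to a
decreasing adapted family of events (`StepFamily.setLIntegral_integral_sq_le`). The last one does
the work of stopping times.

Uniqueness (`IsStrongSolution.ae_eq`): the difference `Z` of two solutions need not have a second
moment, so `Z_s²` is integrated only over the event that `∫_t^s Z²` is at most `n`. The localised
isometry passes to Itô integrals (`IsItoIntegral.setLIntegral_sub_sq_le`), and the truncated second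
moment satisfies a Grönwall inequality and is bounded, hence zero. As `n` grows the events exhaust
the space, because continuous paths have finite energy.

Existence (`exists_isStrongSolution`): in Picard's iteration the integrand `S(·,X_n)` is replaced by
a simple process `G_n` within `16^{-n}` of it in mean energy. Such processes exist by Lebesgue
differentiation along each path (`exists_simpleProcess_lintegral_le`). The mean energies of the
increments are of order `8^{-n}`, so by Chebyshev and Doob the supremum of the `n`-th increment
exceeds `2^{-n}` with probability of order `2^{-n}`. Borel–Cantelli gives uniform convergence almost
surely, and the same `G_n` witness that the martingale part of the limit is the required Itô
integral. -/

section TimeMeasure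

/-! ### Lebesgue measure on the half-line -/

theorem measurableEmbedding_nnreal_coe : MeasurableEmbedding (fun s : ℝ≥0 => (s : ℝ)) :=
  MeasurableEmbedding.subtype_coe measurableSet_Ici

theorem nnreal_coe_image_Icc (a b : ℝ≥0) :
    (fun s : ℝ≥0 => (s : ℝ)) '' Set.Icc a b = Set.Icc (a : ℝ) b := by
  ext r
  constructor
  · rintro ⟨s, hs, rfl⟩
    exact ⟨NNReal.coe_le_coe.2 hs.1, NNReal.coe_le_coe.2 hs.2⟩
  · intro hr
    exact ⟨⟨r, a.2.trans hr.1⟩, ⟨hr.1, hr.2⟩, rfl⟩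

theorem timeMeasure_Icc (a b : ℝ≥0) :
    timeMeasure (Set.Icc a b) = ENNReal.ofReal ((b : ℝ) - a) := by
  rw [timeMeasure, measurableEmbedding_nnreal_coe.comap_apply, nnreal_coe_image_Icc,
    Real.volume_Icc]

instance : NullSingletonClass timeMeasure := ⟨fun s => by simpa using timeMeasure_Icc s s⟩

instance : SigmaFinite timeMeasure := by
  refine ⟨⟨⟨fun n => Set.Icc 0 (n : ℝ≥0), fun _ => trivial, fun n => ?_, ?_⟩⟩⟩
  · rw [timeMeasure_Icc]; exact ENNReal.ofReal_lt_top
  · refine Set.eq_univ_of_forall fun s => ?_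
    obtain ⟨n, hn⟩ := exists_nat_ge s
    exact Set.mem_iUnion.2 ⟨n, zero_le, hn⟩

instance (a b : ℝ≥0) : IsFiniteMeasure (timeMeasure.restrict (Set.Icc a b)) :=
  ⟨by rw [Measure.restrict_apply_univ, timeMeasure_Icc]; exact ENNReal.ofReal_lt_top⟩

theorem timeMeasure_Ioc (a b : ℝ≥0) :
    timeMeasure (Set.Ioc a b) = ENNReal.ofReal ((b : ℝ) - a) := by
  rw [measure_congr Ioc_ae_eq_Icc, timeMeasure_Icc]

theorem map_coe_timeMeasure :
    timeMeasure.map (fun s : ℝ≥0 => (s : ℝ)) = volume.restrict (Set.Ici 0) := by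
  rw [timeMeasure, measurableEmbedding_nnreal_coe.map_comap]
  congr 1
  ext r
  simp only [Set.mem_range, Set.mem_Ici]
  exact ⟨by rintro ⟨y, rfl⟩; exact y.2, fun h => ⟨⟨r, h⟩, rfl⟩⟩

/-- Carries the Lebesgue differentiation theorem from the real line to the time axis. -/
theorem ae_timeMeasure_of_ae {p : ℝ → Prop} (h : ∀ᵐ y, p y) : ∀ᵐ r : ℝ≥0 ∂timeMeasure, p r := by
  have h1 : ∀ᵐ y ∂(timeMeasure.map (fun s : ℝ≥0 => (s : ℝ))), p y := by
    rw [map_coe_timeMeasure]; exact ae_restrict_of_ae h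
  exact ae_of_ae_map measurableEmbedding_nnreal_coe.measurable.aemeasurable h1

theorem setLIntegral_timeMeasure_Icc (a b : ℝ≥0) (f : ℝ → ℝ≥0∞) :
    ∫⁻ r in Set.Icc a b, f r ∂timeMeasure = ∫⁻ r in Set.Icc (a : ℝ) b, f r := by
  have h2 : (fun s : ℝ≥0 => (s : ℝ)) ⁻¹' Set.Icc (a : ℝ) b = Set.Icc a b := by
    ext r; simp
  have h3 : (volume.restrict (Set.Ici (0 : ℝ))).restrict (Set.Icc (a : ℝ) b)
      = volume.restrict (Set.Icc (a : ℝ) b) := by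
    rw [Measure.restrict_restrict measurableSet_Icc]
    congr 1
    exact Set.inter_eq_left.2 fun r hr => a.2.trans hr.1
  rw [← h3, ← map_coe_timeMeasure, measurableEmbedding_nnreal_coe.restrict_map, h2,
    measurableEmbedding_nnreal_coe.lintegral_map]

/-- Integrating an exponential weight gains a factor `1/a`. With `a` large, this turns both
Grönwall-type recursions below into contractions. -/
theorem setLIntegral_exp_le (t s : ℝ≥0) {a : ℝ} (ha : 0 < a) :
    ∫⁻ r in Set.Icc t s, ENNReal.ofReal (Real.exp (a * r)) ∂timeMeasure ≤
      ENNReal.ofReal (a⁻¹ * Real.exp (a * s)) := by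
  rw [setLIntegral_timeMeasure_Icc t s (fun r => ENNReal.ofReal (Real.exp (a * r)))]
  rcases le_total s t with h | h
  · rw [setLIntegral_measure_zero]
    · exact zero_le
    · rw [Real.volume_Icc, ENNReal.ofReal_eq_zero]
      exact sub_nonpos.2 h
  have hc : Continuous fun r : ℝ => Real.exp (a * r) := by fun_prop
  rw [← ofReal_integral_eq_lintegral_ofReal hc.continuousOn.integrableOn_Icc
    (ae_of_all _ fun r => (Real.exp_pos _).le), integral_Icc_eq_integral_Ioc,
    ← intervalIntegral.integral_of_le (by exact_mod_cast h)]
  have h4 : ∫ r in (t : ℝ)..s, Real.exp (a * r) = a⁻¹ * (Real.exp (a * s) - Real.exp (a * t)) := by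
    rw [intervalIntegral.integral_comp_mul_left _ ha.ne', integral_exp, smul_eq_mul]
  rw [h4]
  refine ENNReal.ofReal_le_ofReal (mul_le_mul_of_nonneg_left ?_ (inv_pos.2 ha).le)
  linarith [Real.exp_pos (a * t)]

/-- Cauchy–Schwarz for the integral over a set of finite measure. -/
theorem sq_setIntegral_le {α : Type*} [MeasurableSpace α] {μ : Measure α} [IsFiniteMeasure μ]
    (f : α → ℝ) (hf : AEMeasurable f μ) :
    ENNReal.ofReal ((∫ r, f r ∂μ) ^ 2) ≤ μ Set.univ * ∫⁻ r, ENNReal.ofReal (f r ^ 2) ∂μ := by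
  have h1 : ENNReal.ofReal ((∫ r, f r ∂μ) ^ 2) ≤ (∫⁻ r, ‖f r‖ₑ ∂μ) ^ 2 := by
    have := enorm_integral_le_lintegral_enorm (μ := μ) f
    calc ENNReal.ofReal ((∫ r, f r ∂μ) ^ 2) = ‖∫ r, f r ∂μ‖ₑ ^ 2 := by
          rw [← enorm_pow, Real.enorm_of_nonneg (sq_nonneg _)]
      _ ≤ _ := by gcongr
  refine h1.trans ?_
  have h2 := ENNReal.lintegral_mul_le_Lp_mul_Lq μ Real.HolderConjugate.two_two
    (aemeasurable_const (b := (1 : ℝ≥0∞))) hf.enorm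
  simp only [Pi.mul_apply, one_mul, ENNReal.one_rpow, lintegral_const] at h2
  have h3 : ∀ z : ℝ≥0∞, (z ^ (1 / 2 : ℝ)) ^ 2 = z := fun z => by
    rw [← ENNReal.rpow_natCast, ← ENNReal.rpow_mul]; norm_num
  have h4 : ∀ r, ENNReal.ofReal (f r ^ 2) = ‖f r‖ₑ ^ (2 : ℝ) := fun r => by
    rw [← Real.enorm_of_nonneg (sq_nonneg _), enorm_pow, ← ENNReal.rpow_natCast]; norm_num
  simp only [h4]
  calc (∫⁻ r, ‖f r‖ₑ ∂μ) ^ 2 ≤ (μ Set.univ ^ (1 / 2 : ℝ) *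
        (∫⁻ r, ‖f r‖ₑ ^ (2 : ℝ) ∂μ) ^ (1 / 2 : ℝ)) ^ 2 := by gcongr
    _ = _ := by rw [mul_pow, h3, h3]

end TimeMeasure

/-! ### Brownian motion relative to the augmented filtration -/

/-- `W` is a centred square-integrable process, adapted to `F`, with `F`-independent increments of
variance `b - a`. -/
structure IsBrownianFor {Ω : Type*} {mΩ : MeasurableSpace Ω} (F : Filtration ℝ≥0 mΩ)
    (P : Measure Ω) (W : ℝ≥0 → Ω → ℝ) : Prop where
  adapted : ∀ s, Measurable[F s] (W s)
  indep : ∀ a b, a ≤ b → Indep (F a) (MeasurableSpace.comap (W b - W a) inferInstance) P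
  memLp : ∀ s, MemLp (W s) 2 P
  mean : ∀ a b, ∫ ω, (W b ω - W a ω) ∂P = 0
  var : ∀ a b, a ≤ b → ∫ ω, (W b ω - W a ω) ^ 2 ∂P = (b : ℝ) - a
  cont : ∀ᵐ ω ∂P, Continuous (W · ω)
  null : ∀ N : Set Ω, MeasurableSet N → P N = 0 → ∀ s, MeasurableSet[F s] N

/-- The sets almost surely equal to an event of `m` form a σ-algebra, and a null event is almost
surely empty. Augmentation thus alters events only by null sets. -/
theorem MeasureTheory.Measure.sup_null_le_eventuallyMeasurableSpace {Ω : Type*}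
    {mΩ : MeasurableSpace Ω} (P : Measure Ω) (m : MeasurableSpace Ω) :
    m ⊔ MeasurableSpace.generateFrom {N | MeasurableSet[mΩ] N ∧ P N = 0} ≤
      eventuallyMeasurableSpace m (ae P) := by
  refine sup_le le_eventuallyMeasurableSpace (MeasurableSpace.generateFrom_le fun N hN => ?_)
  exact ⟨∅, MeasurableSet.empty, ae_eq_empty.2 hN.2⟩

/-- Reduces Brownian motion to what the rest of the proof uses: second-order moments, independence
from the past and continuity. Gaussianity plays no further part. -/
theorem ProbabilityTheory.IsBrownianReal.isBrownianFor {Ω : Type*} {mΩ : MeasurableSpace Ω}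
    {P : Measure Ω} [IsProbabilityMeasure P] {W : ℝ≥0 → Ω → ℝ} (hW : IsBrownianReal W P)
    (hWm : ∀ s, Measurable (W s)) : IsBrownianFor (brownianFiltration P W hWm) P W where
  adapted s := by
    have h : MeasurableSpace.comap (W s) inferInstance ≤ brownianFiltration P W hWm s :=
      le_sup_of_le_left (le_iSup₂_of_le s le_rfl le_rfl)
    exact Measurable.mono (comap_measurable _) h le_rfl
  indep a b hab := by
    have h := hW.indepFun_shift a
    have h1 : Indep (⨆ r ≤ a, MeasurableSpace.comap (W r) inferInstance)
        (MeasurableSpace.comap (W b - W a) inferInstance) P := by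
      rw [IndepFun_iff_Indep] at h
      refine indep_of_indep_of_le_left (indep_of_indep_of_le_right h.symm ?_) ?_
      · have : (W b - W a) = (fun f : ℝ≥0 → ℝ => f (b - a)) ∘
            (fun ω t => W (a + t) ω - W a ω) := by
          ext ω; simp [add_tsub_cancel_of_le hab]
        rw [this, ← MeasurableSpace.comap_comp]
        exact MeasurableSpace.comap_mono (measurable_pi_apply _).comap_le
      · refine iSup₂_le fun r hr => ?_
        have : W r = (fun f : Set.Iic a → ℝ => f ⟨r, hr⟩) ∘
            (fun ω (t : Set.Iic a) => W t ω) := by ext ω; simp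
        conv_lhs => rw [this]
        rw [← MeasurableSpace.comap_comp]
        exact MeasurableSpace.comap_mono (measurable_pi_apply _).comap_le
    -- Independence from the raw past survives augmentation: an augmented event is exchanged for an
    -- almost surely equal raw one, and no probability changes.
    rw [Indep_iff] at h1 ⊢
    intro A B hA hB
    obtain ⟨A', hA', hAA'⟩ := Measure.sup_null_le_eventuallyMeasurableSpace P
      (⨆ r ≤ a, MeasurableSpace.comap (W r) inferInstance) A hA
    rw [measure_congr hAA', ← h1 A' B hA' hB]
    exact measure_congr (hAA'.inter (ae_eq_refl B))
  memLp s := (hW.isGaussianProcess.hasGaussianLaw_eval s).memLp_two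
  mean a b := by
    rw [integral_sub (hW.integrable_eval b) (hW.integrable_eval a), hW.integral_eval,
      hW.integral_eval, sub_zero]
  var a b hab := by
    have h := hW.hasLaw_sub b a
    have h2 := h.variance_eq
    rw [variance_id_gaussianReal, variance_eq_integral h.aemeasurable] at h2
    have h3 : ∫ ω, (W b - W a) ω ∂P = 0 := by
      rw [h.integral_eq, integral_id_gaussianReal]
    rw [h3] at h2
    simp only [Pi.sub_apply, sub_zero] at h2
    rw [h2, coe_nndist, NNReal.val_eq_coe, NNReal.val_eq_coe, Real.dist_eq, abs_of_nonneg]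
    exact sub_nonneg.2 hab
  cont := hW.cont
  null N hN h0 s := by
    have h : MeasurableSpace.generateFrom {N | MeasurableSet N ∧ P N = 0} ≤
        brownianFiltration P W hWm s := le_sup_right
    exact h _ (MeasurableSpace.measurableSet_generateFrom ⟨hN, h0⟩)

/-! ### Second moments of weighted Brownian increments -/

section Increments

variable {Ω : Type*} {mΩ : MeasurableSpace Ω} {F : Filtration ℝ≥0 mΩ} {P : Measure Ω}
  {W : ℝ≥0 → Ω → ℝ}

theorem IsBrownianFor.measurable (hW : IsBrownianFor F P W) (s : ℝ≥0) : Measurable (W s) :=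
  (hW.adapted s).mono (F.le s) le_rfl

theorem IsBrownianFor.integral_mul_comp_increment (hW : IsBrownianFor F P W) {a b : ℝ≥0}
    (hab : a ≤ b) {η : Ω → ℝ} (hη : Measurable[F a] η) {g : ℝ → ℝ} (hg : Measurable g) :
    ∫ ω, η ω * g (W b ω - W a ω) ∂P = (∫ ω, η ω ∂P) * ∫ ω, g (W b ω - W a ω) ∂P := by
  have h : IndepFun η (fun ω => g (W b ω - W a ω)) P := by
    rw [IndepFun_iff_Indep]
    refine indep_of_indep_of_le_left (indep_of_indep_of_le_right (hW.indep a b hab) ?_)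
      hη.comap_le
    have : (fun ω => g (W b ω - W a ω)) = g ∘ (W b - W a) := rfl
    rw [this, ← MeasurableSpace.comap_comp]
    exact MeasurableSpace.comap_mono hg.comap_le
  refine h.integral_fun_mul_eq_mul_integral (hη.mono (F.le a) le_rfl).aestronglyMeasurable ?_
  exact (hg.comp ((hW.measurable b).sub (hW.measurable a))).aestronglyMeasurable

theorem IsBrownianFor.integral_mul_increment (hW : IsBrownianFor F P W) {a b : ℝ≥0}
    (hab : a ≤ b) {η : Ω → ℝ} (hη : Measurable[F a] η) :
    ∫ ω, η ω * (W b ω - W a ω) ∂P = 0 := by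
  have := hW.integral_mul_comp_increment hab hη measurable_id
  simpa [hW.mean a b] using this

theorem IsBrownianFor.integral_mul_increment_sq (hW : IsBrownianFor F P W) {a b : ℝ≥0}
    (hab : a ≤ b) {η : Ω → ℝ} (hη : Measurable[F a] η) :
    ∫ ω, η ω * (W b ω - W a ω) ^ 2 ∂P = (∫ ω, η ω ∂P) * (b - a) := by
  rw [hW.integral_mul_comp_increment hab hη (g := fun z => z ^ 2) (by fun_prop), hW.var a b hab]

theorem IsBrownianFor.memLp_mul_increment (hW : IsBrownianFor F P W) (a b : ℝ≥0) {ξ : Ω → ℝ}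
    (hξ : Measurable ξ) {C : ℝ} (hC : ∀ ω, |ξ ω| ≤ C) :
    MemLp (fun ω => ξ ω * (W b ω - W a ω)) 2 P := by
  have h1 : MemLp (W b - W a) 2 P := (hW.memLp b).sub (hW.memLp a)
  refine (h1.const_mul C).mono (by
    have := hW.measurable a; have := hW.measurable b; fun_prop) (ae_of_all _ fun ω => ?_)
  have h0 : 0 ≤ C := (abs_nonneg _).trans (hC ω)
  simp only [norm_mul, Real.norm_eq_abs, Pi.sub_apply, abs_of_nonneg h0]
  gcongr
  exact hC ω

/-- The longer increment is split at the end of the shorter one. The later piece is centred and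
independent of everything else, so only the square of the shorter increment remains. -/
theorem IsBrownianFor.integral_mul_increment_mul_increment_same (hW : IsBrownianFor F P W)
    {b c d : ℝ≥0} (hcb : c ≤ b) (hcd : c ≤ d) {ζ : Ω → ℝ} (hζ : Measurable[F c] ζ) {C : ℝ}
    (hC : ∀ ω, |ζ ω| ≤ C) :
    ∫ ω, ζ ω * (W b ω - W c ω) * (W d ω - W c ω) ∂P = (∫ ω, ζ ω ∂P) * (min b d - c : ℝ) := by
  wlog hbd : b ≤ d generalizing b d
  · rw [min_comm, ← this hcd hcb (le_of_not_ge hbd)]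
    refine integral_congr_ae (ae_of_all _ fun ω => ?_)
    simp only; ring
  have hm := hζ.mono (F.le c) le_rfl
  have h0 : ∫ ω, ζ ω * (W b ω - W c ω) * (W d ω - W b ω) ∂P = 0 := by
    refine hW.integral_mul_increment hbd ?_
    have h1 := hζ.mono (F.mono hcb) le_rfl
    have h2 := hW.adapted b
    have h3 := (hW.adapted c).mono (F.mono hcb) le_rfl
    exact h1.mul (h2.sub h3)
  have i1 : Integrable (fun ω => ζ ω * (W b ω - W c ω) * (W d ω - W b ω)) P :=
    (hW.memLp_mul_increment c b hm hC).integrable_mul ((hW.memLp d).sub (hW.memLp b))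
  have i2 : Integrable (fun ω => ζ ω * (W b ω - W c ω) * (W b ω - W c ω)) P :=
    (hW.memLp_mul_increment c b hm hC).integrable_mul ((hW.memLp b).sub (hW.memLp c))
  have h4 : ∀ ω, ζ ω * (W b ω - W c ω) * (W d ω - W c ω) =
    ζ ω * (W b ω - W c ω) * (W d ω - W b ω) + ζ ω * (W b ω - W c ω) * (W b ω - W c ω) :=
    fun ω => by ring
  simp_rw [h4]
  rw [integral_add i1 i2, h0, zero_add, min_eq_left (by exact_mod_cast hbd),
    ← hW.integral_mul_increment_sq hcb hζ]
  refine integral_congr_ae (ae_of_all _ fun ω => ?_)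
  simp only; ring

/-- The covariance of two weighted Brownian increments. -/
theorem IsBrownianFor.integral_increment_mul_increment (hW : IsBrownianFor F P W)
    {a b c d : ℝ≥0} (hab : a ≤ b) (hcd : c ≤ d) {ξ η : Ω → ℝ} (hξm : Measurable ξ)
    (hηm : Measurable η) (hξ : a < b → Measurable[F a] ξ) (hη : c < d → Measurable[F c] η)
    {C : ℝ} (hξC : ∀ ω, |ξ ω| ≤ C) (hηC : ∀ ω, |η ω| ≤ C) :
    ∫ ω, (ξ ω * (W b ω - W a ω)) * (η ω * (W d ω - W c ω)) ∂P =
      (∫ ω, ξ ω * η ω ∂P) * timeMeasure.real (Set.Ioc a b ∩ Set.Ioc c d) := by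
  wlog hac : a ≤ c generalizing a b c d ξ η
  · rw [Set.inter_comm]
    simp_rw [mul_comm (ξ _) (η _)]
    rw [← this hcd hab hηm hξm hη hξ hηC hξC (le_of_not_ge hac)]
    refine integral_congr_ae (ae_of_all _ fun ω => ?_)
    simp only; ring
  -- Degenerate intervals give zero on both sides. Weights are only assumed measurable at the left
  -- end of non-degenerate intervals, because clamping an interval to a time window may collapse it
  -- to a point at which its weight is not yet known.
  rcases hab.eq_or_lt with rfl | hab'
  · simp
  rcases hcd.eq_or_lt with rfl | hcd'
  · simp
  replace hξ := (hξ hab').mono (F.mono hac) le_rfl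
  replace hη := hη hcd'
  have hlam : timeMeasure.real (Set.Ioc a b ∩ Set.Ioc c d) = max (min b d - c : ℝ) 0 := by
    rw [Set.Ioc_inter_Ioc, measureReal_def, timeMeasure_Ioc, ENNReal.toReal_ofReal']
    simp [hac]
  rw [hlam]
  have hWa : Measurable[F c] (W a) := (hW.adapted a).mono (F.mono hac) le_rfl
  rcases le_total b c with hbc | hcb
  · have hWb : Measurable[F c] (W b) := (hW.adapted b).mono (F.mono hbc) le_rfl
    rw [max_eq_right, mul_zero]
    · rw [← hW.integral_mul_increment hcd ((hξ.mul (hWb.sub hWa)).mul hη)]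
      refine integral_congr_ae (ae_of_all _ fun ω => ?_)
      simp only [Pi.mul_apply, Pi.sub_apply]; ring
    · rw [sub_nonpos]
      exact (min_le_left _ _).trans (by exact_mod_cast hbc)
  have i0 := hW.memLp_mul_increment c d hηm hηC
  have i1 : Integrable (fun ω => (ξ ω * (W c ω - W a ω)) * (η ω * (W d ω - W c ω))) P :=
    (hW.memLp_mul_increment a c hξm hξC).integrable_mul i0
  have i2 : Integrable (fun ω => (ξ ω * (W b ω - W c ω)) * (η ω * (W d ω - W c ω))) P :=
    (hW.memLp_mul_increment c b hξm hξC).integrable_mul i0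
  -- The first increment is split at `c`. Its part before `c` is known at time `c` and is orthogonal
  -- to the later increment; the rest starts at `c`, like the second increment.
  have h4 : ∀ ω, (ξ ω * (W b ω - W a ω)) * (η ω * (W d ω - W c ω)) =
    (ξ ω * (W c ω - W a ω)) * (η ω * (W d ω - W c ω)) +
      (ξ ω * (W b ω - W c ω)) * (η ω * (W d ω - W c ω)) := fun ω => by ring
  simp_rw [h4]
  rw [integral_add i1 i2]
  have h5 : ∫ ω, (ξ ω * (W c ω - W a ω)) * (η ω * (W d ω - W c ω)) ∂P = 0 := by
    rw [← hW.integral_mul_increment hcd ((hξ.mul ((hW.adapted c).sub hWa)).mul hη)]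
    refine integral_congr_ae (ae_of_all _ fun ω => ?_)
    simp only [Pi.mul_apply, Pi.sub_apply]; ring
  rw [h5, zero_add, max_eq_left]
  · have h6 := hW.integral_mul_increment_mul_increment_same hcb hcd (hξ.mul hη) (C := C * C) ?_
    · simp only [Pi.mul_apply] at h6
      rw [← h6]
      refine integral_congr_ae (ae_of_all _ fun ω => ?_)
      simp only; ring
    · intro ω
      simp only [Pi.mul_apply]
      rw [abs_mul]
      exact mul_le_mul (hξC ω) (hηC ω) (abs_nonneg _) ((abs_nonneg _).trans (hξC ω))
  · rw [sub_nonneg]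
    exact le_min (by exact_mod_cast hcb) (by exact_mod_cast hcd)

/-- The Itô isometry for a finite family of weighted increments. -/
theorem IsBrownianFor.lintegral_sum_increments_sq [IsProbabilityMeasure P]
    (hW : IsBrownianFor F P W) {ι : Type*} [Fintype ι] {u v : ι → ℝ≥0} {ξ : ι → Ω → ℝ}
    (huv : ∀ i, u i ≤ v i) (hm : ∀ i, Measurable (ξ i))
    (hξ : ∀ i, u i < v i → Measurable[F (u i)] (ξ i)) {C : ℝ} (hC : ∀ i ω, |ξ i ω| ≤ C) :
    ∫⁻ ω, ENNReal.ofReal ((∑ i, ξ i ω * (W (v i) ω - W (u i) ω)) ^ 2) ∂P =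
      ∫⁻ ω, ∫⁻ r, ENNReal.ofReal
        ((∑ i, (Set.Ioc (u i) (v i)).indicator (fun _ => ξ i ω) r) ^ 2) ∂timeMeasure ∂P := by
  have hI : ∀ i j, Integrable (fun r : ℝ≥0 =>
      (Set.Ioc (u i) (v i) ∩ Set.Ioc (u j) (v j)).indicator (1 : ℝ≥0 → ℝ) r) timeMeasure := by
    intro i j
    rw [integrable_indicator_iff (measurableSet_Ioc.inter measurableSet_Ioc)]
    refine integrableOn_const (ne_of_lt ?_) |>.congr_fun (fun _ _ => rfl)
      (measurableSet_Ioc.inter measurableSet_Ioc)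
    exact (measure_mono Set.inter_subset_left).trans_lt
      (by rw [timeMeasure_Ioc]; exact ENNReal.ofReal_lt_top)
  have hsq : ∀ ω r, (∑ i, (Set.Ioc (u i) (v i)).indicator (fun _ => ξ i ω) r) ^ 2 =
      ∑ i, ∑ j, (ξ i ω * ξ j ω) *
        (Set.Ioc (u i) (v i) ∩ Set.Ioc (u j) (v j)).indicator (1 : ℝ≥0 → ℝ) r := by
    intro ω r
    rw [sq, Finset.sum_mul_sum]
    refine Finset.sum_congr rfl fun i _ => Finset.sum_congr rfl fun j _ => ?_
    by_cases h1 : r ∈ Set.Ioc (u i) (v i) <;> by_cases h2 : r ∈ Set.Ioc (u j) (v j) <;>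
      simp [h1, h2, Set.indicator, Set.mem_inter_iff, -Set.mem_Ioc]
  have hsum : ∀ ω, ∫ r, (∑ i, (Set.Ioc (u i) (v i)).indicator (fun _ => ξ i ω) r) ^ 2
        ∂timeMeasure = ∑ i, ∑ j, (ξ i ω * ξ j ω) *
        timeMeasure.real (Set.Ioc (u i) (v i) ∩ Set.Ioc (u j) (v j)) := by
    intro ω
    simp_rw [hsq]
    rw [integral_finsetSum _ fun i _ => integrable_finsetSum _ fun j _ =>
      (hI i j).const_mul _]
    refine Finset.sum_congr rfl fun i _ => ?_
    rw [integral_finsetSum _ fun j _ => (hI i j).const_mul _]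
    refine Finset.sum_congr rfl fun j _ => ?_
    rw [integral_const_mul, integral_indicator_one (measurableSet_Ioc.inter measurableSet_Ioc)]
  have hinner : ∀ ω, ∫⁻ r, ENNReal.ofReal
        ((∑ i, (Set.Ioc (u i) (v i)).indicator (fun _ => ξ i ω) r) ^ 2) ∂timeMeasure =
      ENNReal.ofReal (∑ i, ∑ j, (ξ i ω * ξ j ω) *
        timeMeasure.real (Set.Ioc (u i) (v i) ∩ Set.Ioc (u j) (v j))) := by
    intro ω
    rw [← ofReal_integral_eq_lintegral_ofReal _ (ae_of_all _ fun r => sq_nonneg _), hsum]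
    simp_rw [hsq]
    exact integrable_finsetSum _ fun i _ => integrable_finsetSum _ fun j _ =>
      (hI i j).const_mul _
  simp_rw [hinner]
  have hL : ∀ i, MemLp (fun ω => ξ i ω * (W (v i) ω - W (u i) ω)) 2 P := fun i =>
    hW.memLp_mul_increment _ _ (hm i) (hC i)
  have hLL : ∀ i j, Integrable (fun ω => (ξ i ω * (W (v i) ω - W (u i) ω)) *
      (ξ j ω * (W (v j) ω - W (u j) ω))) P := fun i j => (hL i).integrable_mul (hL j)
  have hX : ∀ i j, Integrable (fun ω => ξ i ω * ξ j ω) P := fun i j => by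
    have h1 : MemLp (ξ i) 2 P := MemLp.of_bound (hm i).aestronglyMeasurable C
      (ae_of_all _ (hC i))
    have h2 : MemLp (ξ j) 2 P := MemLp.of_bound (hm j).aestronglyMeasurable C
      (ae_of_all _ (hC j))
    exact h1.integrable_mul h2
  rw [← ofReal_integral_eq_lintegral_ofReal _ (ae_of_all _ fun ω => sq_nonneg _),
    ← ofReal_integral_eq_lintegral_ofReal]
  -- Both sides are now double sums over pairs of intervals, and the covariance formula matches them
  -- term by term.
  · congr 1
    simp_rw [sq, Finset.sum_mul_sum]
    rw [integral_finsetSum _ fun i _ => integrable_finsetSum _ fun j _ => hLL i j,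
      integral_finsetSum _ fun i _ => integrable_finsetSum _ fun j _ =>
        (hX i j).mul_const _]
    refine Finset.sum_congr rfl fun i _ => ?_
    rw [integral_finsetSum _ fun j _ => hLL i j,
      integral_finsetSum _ fun j _ => (hX i j).mul_const _]
    refine Finset.sum_congr rfl fun j _ => ?_
    rw [integral_mul_const]
    exact hW.integral_increment_mul_increment (huv i) (huv j) (hm i) (hm j) (hξ i) (hξ j)
      (hC i) (hC j)
  · exact integrable_finsetSum _ fun i _ => integrable_finsetSum _ fun j _ =>
        (hX i j).mul_const _
  · refine ae_of_all _ fun ω => ?_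
    simp only [Pi.zero_apply, ← hsum]
    exact integral_nonneg fun r => sq_nonneg _
  · exact (memLp_finsetSum _ fun i _ => hL i).integrable_sq

end Increments

/-! ### Step processes and the conditional Itô isometry -/

section StepFamily

variable {Ω : Type*} {mΩ : MeasurableSpace Ω}

/-- `H` is progressively measurable on `[t, T]`. -/
def IsProgressiveOn {E : Type*} [MeasurableSpace E] [Zero E] (F : Filtration ℝ≥0 mΩ) (t T : ℝ≥0)
    (H : ℝ≥0 → Ω → E) : Prop :=
  ∀ s ∈ Set.Icc t T, Measurable[(inferInstance : MeasurableSpace ℝ≥0).prod (F s)]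
    fun p : ℝ≥0 × Ω => (Set.Icc t s).indicator (fun r => H r p.2) p.1

/-- A finite family of bounded weights `coeff i`, each attached to an interval
`(left i, right i]` and measurable with respect to the past of `left i`. Unlike for
`SimpleProcess`, the intervals may overlap. -/
structure StepFamily (F : Filtration ℝ≥0 mΩ) (t : ℝ≥0) where
  ι : Type
  [fintype : Fintype ι]
  left : ι → ℝ≥0
  right : ι → ℝ≥0
  coeff : ι → Ω → ℝ
  start_le : ∀ i, t ≤ left i
  left_le_right : ∀ i, left i ≤ right i
  measurable : ∀ i, Measurable[F (left i)] (coeff i)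
  bounded : ∃ C : ℝ, ∀ i ω, |coeff i ω| ≤ C

attribute [instance] StepFamily.fintype

namespace StepFamily

variable {F : Filtration ℝ≥0 mΩ} {t : ℝ≥0}

/-- The value of the associated step process. -/
noncomputable def val (G : StepFamily F t) (s : ℝ≥0) (ω : Ω) : ℝ :=
  ∑ i, (Set.Ioc (G.left i) (G.right i)).indicator (fun _ => G.coeff i ω) s

/-- The stochastic integral of the associated step process. -/
noncomputable def integral (G : StepFamily F t) (W : ℝ≥0 → Ω → ℝ) (s : ℝ≥0) (ω : Ω) : ℝ :=
  ∑ i, G.coeff i ω * (W (min (G.right i) s) ω - W (min (G.left i) s) ω)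

theorem exists_abs_val_le (G : StepFamily F t) : ∃ C : ℝ, 0 ≤ C ∧ ∀ s ω, |G.val s ω| ≤ C := by
  obtain ⟨C, hC⟩ := G.bounded
  refine ⟨∑ _i : G.ι, |C|, Finset.sum_nonneg fun _ _ => abs_nonneg _, fun s ω => ?_⟩
  refine (Finset.abs_sum_le_sum_abs _ _).trans (Finset.sum_le_sum fun i _ => ?_)
  by_cases h : s ∈ Set.Ioc (G.left i) (G.right i)
  · rw [Set.indicator_of_mem h]; exact (hC i ω).trans (le_abs_self C)
  · rw [Set.indicator_of_notMem h]; simp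

theorem coeff_measurable (G : StepFamily F t) (i : G.ι) : Measurable (G.coeff i) :=
  (G.measurable i).mono (F.le _) le_rfl

theorem measurable_uncurry_val (G : StepFamily F t) :
    Measurable fun p : ℝ≥0 × Ω => G.val p.1 p.2 := by
  refine Finset.measurable_sum _ fun i _ => ?_
  have h : (fun p : ℝ≥0 × Ω =>
      (Set.Ioc (G.left i) (G.right i)).indicator (fun _ => G.coeff i p.2) p.1) =
      (Prod.fst ⁻¹' Set.Ioc (G.left i) (G.right i)).indicator fun p => G.coeff i p.2 := rfl
  rw [h]
  exact ((G.coeff_measurable i).comp measurable_snd).indicator (measurable_fst measurableSet_Ioc)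

theorem isProgressiveOn_val (G : StepFamily F t) (T : ℝ≥0) : IsProgressiveOn F t T G.val := by
  intro s _
  have h : (fun p : ℝ≥0 × Ω => (Set.Icc t s).indicator (fun r => G.val r p.2) p.1) =
      fun p => ∑ i, (Prod.fst ⁻¹' (Set.Icc t s ∩ Set.Ioc (G.left i) (G.right i))).indicator
        (fun p : ℝ≥0 × Ω => G.coeff i p.2) p := by
    ext p
    by_cases hp : p.1 ∈ Set.Icc t s
    · rw [Set.indicator_of_mem hp]
      refine Finset.sum_congr rfl fun i _ => ?_
      by_cases h2 : p.1 ∈ Set.Ioc (G.left i) (G.right i)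
      · rw [Set.indicator_of_mem h2, Set.indicator_of_mem (by exact ⟨hp, h2⟩)]
      · rw [Set.indicator_of_notMem h2, Set.indicator_of_notMem (fun h => h2 h.2)]
    · rw [Set.indicator_of_notMem hp]
      exact (Finset.sum_eq_zero fun i _ =>
        Set.indicator_of_notMem (fun h => hp h.1) _).symm
  rw [h]
  refine Finset.measurable_sum _ fun i _ => ?_
  -- An interval starting after `s` is invisible on `[t, s]`, so its weight need not be known at
  -- time `s`.
  by_cases hi : G.left i ≤ s
  · refine Measurable.indicator ?_ ?_
    · exact ((G.measurable i).mono (F.mono hi) le_rfl).comp measurable_snd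
    · exact measurable_fst (measurableSet_Icc.inter measurableSet_Ioc)
  · have : Set.Icc t s ∩ Set.Ioc (G.left i) (G.right i) = ∅ := by
      ext r
      simp only [Set.mem_inter_iff, Set.mem_Icc, Set.mem_Ioc, Set.mem_empty_iff_false, iff_false]
      rintro ⟨h1, h2⟩
      exact hi (h2.1.le.trans h1.2)
    rw [this]
    simp only [Set.preimage_empty, Set.indicator_empty]
    exact measurable_const

theorem integral_start (G : StepFamily F t) (W : ℝ≥0 → Ω → ℝ) (ω : Ω) : G.integral W t ω = 0 :=
  Finset.sum_eq_zero fun i _ => by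
    rw [min_eq_right (G.start_le i), min_eq_right ((G.start_le i).trans (G.left_le_right i)),
      sub_self, mul_zero]

/-- Clamping all intervals to `[q, s]` gives the increment of the integral the same shape as the
integral itself, so the estimates for finite families of increments apply to it. -/
theorem integral_sub_integral (G : StepFamily F t) (W : ℝ≥0 → Ω → ℝ) {q s : ℝ≥0} (hqs : q ≤ s)
    (ω : Ω) : G.integral W s ω - G.integral W q ω =
      ∑ i, G.coeff i ω *
        (W (max q (min (G.right i) s)) ω - W (max q (min (G.left i) s)) ω) := by
  have key : ∀ x : ℝ≥0, W (max q (min x s)) ω = W q ω + W (min x s) ω - W (min x q) ω := by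
    intro x
    rcases le_total x q with h | h
    · rw [min_eq_left (h.trans hqs), max_eq_left h, min_eq_left h]; ring
    · rw [max_eq_right (le_min h hqs), min_eq_right h]; ring
  rw [integral, integral, ← Finset.sum_sub_distrib]
  refine Finset.sum_congr rfl fun i _ => ?_
  rw [key, key]; ring

/-- A clamped interval that does not collapse comes from one with left end at most `s`. Its clamped
left end is then no earlier than the original one, and the weight is known there. -/
theorem measurable_coeff_of_lt (G : StepFamily F t) {q s : ℝ≥0} (i : G.ι)
    (h : max q (min (G.left i) s) < max q (min (G.right i) s)) :
    Measurable[F (max q (min (G.left i) s))] (G.coeff i) := by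
  have h1 : G.left i ≤ s := by
    by_contra hc
    rw [not_le] at hc
    rw [min_eq_right hc.le, min_eq_right (hc.le.trans (G.left_le_right i))] at h
    exact lt_irrefl _ h
  refine (G.measurable i).mono (F.mono ?_) le_rfl
  rw [min_eq_left h1]
  exact le_max_right _ _

theorem Ioc_clamp (q s a b : ℝ≥0) :
    Set.Ioc (max q (min a s)) (max q (min b s)) = Set.Ioc q s ∩ Set.Ioc a b := by
  ext r
  simp only [Set.mem_Ioc, Set.mem_inter_iff, max_lt_iff, min_lt_iff, le_max_iff, le_min_iff]
  constructor
  · rintro ⟨⟨h1, h2⟩, h3⟩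
    rcases h3 with h3 | h3
    · exact absurd h1 (not_lt.2 h3)
    · rcases h2 with h2 | h2
      · exact ⟨⟨h1, h3.2⟩, h2, h3.1⟩
      · exact absurd h2 (not_lt.2 h3.2)
  · rintro ⟨⟨h1, h2⟩, h3, h4⟩
    exact ⟨⟨h1, Or.inl h3⟩, Or.inr ⟨h4, h2⟩⟩

variable {P : Measure Ω} {W : ℝ≥0 → Ω → ℝ}

theorem measurable_integral (G : StepFamily F t) (hW : ∀ s, Measurable[F s] (W s)) (s : ℝ≥0) :
    Measurable[F s] (G.integral W s) := by
  refine Finset.measurable_sum _ fun i _ => ?_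
  by_cases hi : G.left i ≤ s
  · have h1 := (hW (min (G.right i) s)).mono (F.mono (min_le_right _ _)) le_rfl
    have h2 := (hW (min (G.left i) s)).mono (F.mono (min_le_right _ _)) le_rfl
    exact ((G.measurable i).mono (F.mono hi) le_rfl).mul (h1.sub h2)
  · have hi := (not_le.1 hi).le
    have : (fun ω => G.coeff i ω * (W (min (G.right i) s) ω - W (min (G.left i) s) ω)) =
        fun _ => 0 := by
      ext ω
      rw [min_eq_right hi, min_eq_right (hi.trans (G.left_le_right i)), sub_self, mul_zero]
    rw [this]
    exact measurable_const

theorem memLp_integral (G : StepFamily F t) (hW : IsBrownianFor F P W) (s : ℝ≥0) :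
    MemLp (G.integral W s) 2 P := by
  obtain ⟨C, hC⟩ := G.bounded
  exact memLp_finsetSum _ fun i _ => hW.memLp_mul_increment _ _ (G.coeff_measurable i) (hC i)

/-- The martingale property in weak form. After clamping, every increment starts at `q` or later,
where both `η` and the weight are known. -/
theorem integral_mul_integral_sub (G : StepFamily F t) (hW : IsBrownianFor F P W) {q s : ℝ≥0}
    (hqs : q ≤ s) {η : Ω → ℝ} (hη : Measurable[F q] η) (hη2 : MemLp η 2 P) :
    ∫ ω, η ω * (G.integral W s ω - G.integral W q ω) ∂P = 0 := by
  simp_rw [G.integral_sub_integral W hqs, Finset.mul_sum]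
  obtain ⟨C, hC⟩ := G.bounded
  rw [integral_finsetSum]
  · refine Finset.sum_eq_zero fun i _ => ?_
    have hle : max q (min (G.left i) s) ≤ max q (min (G.right i) s) :=
      max_le_max le_rfl (min_le_min (G.left_le_right i) le_rfl)
    rcases hle.eq_or_lt with h | h
    · simp [h]
    · have := hW.integral_mul_increment hle
        ((hη.mono (F.mono (le_max_left _ _)) le_rfl).mul (G.measurable_coeff_of_lt i h))
      simpa only [Pi.mul_apply, mul_assoc] using this
  · intro i _
    exact hη2.integrable_mul (hW.memLp_mul_increment _ _ (G.coeff_measurable i) (hC i))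

variable [IsProbabilityMeasure P]

/-- The indicator of `B` is absorbed into the weights: `B` is known at `q`, hence at every clamped
left end, so the unconditional isometry for finite families applies. -/
theorem setLIntegral_integral_sub_sq (G : StepFamily F t) (hW : IsBrownianFor F P W) {q s : ℝ≥0}
    (hqs : q ≤ s) {B : Set Ω} (hB : MeasurableSet[F q] B) :
    ∫⁻ ω in B, ENNReal.ofReal ((G.integral W s ω - G.integral W q ω) ^ 2) ∂P =
      ∫⁻ ω in B, ∫⁻ r in Set.Ioc q s, ENNReal.ofReal (G.val r ω ^ 2) ∂timeMeasure ∂P := by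
  obtain ⟨C, hC⟩ := G.bounded
  have hBm : MeasurableSet B := F.le q B hB
  have h := hW.lintegral_sum_increments_sq (ι := G.ι)
    (u := fun i => max q (min (G.left i) s)) (v := fun i => max q (min (G.right i) s))
    (ξ := fun i => B.indicator (G.coeff i)) (C := C)
    (fun i => max_le_max le_rfl (min_le_min (G.left_le_right i) le_rfl))
    (fun i => (G.coeff_measurable i).indicator hBm)
    (fun i hi => (G.measurable_coeff_of_lt i hi).indicator (F.mono (le_max_left _ _) _ hB))
    (fun i ω => ?_)
  · rw [← lintegral_indicator hBm, ← lintegral_indicator hBm]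
    convert h using 3 with ω ω
    · by_cases hω : ω ∈ B
      · simp only [Set.indicator_of_mem hω]
        rw [G.integral_sub_integral W hqs]
      · simp [Set.indicator_of_notMem hω]
    · by_cases hω : ω ∈ B
      · simp only [Set.indicator_of_mem hω]
        rw [← lintegral_indicator measurableSet_Ioc]
        refine lintegral_congr fun r => ?_
        simp only [Ioc_clamp]
        by_cases hr : r ∈ Set.Ioc q s
        · rw [Set.indicator_of_mem hr, val]
          congr 2
          refine Finset.sum_congr rfl fun i _ => ?_
          by_cases h2 : r ∈ Set.Ioc (G.left i) (G.right i)
          · rw [Set.indicator_of_mem h2, Set.indicator_of_mem (Set.mem_inter hr h2)]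
          · rw [Set.indicator_of_notMem h2, Set.indicator_of_notMem (fun h => h2 h.2)]
        · rw [Set.indicator_of_notMem hr, Finset.sum_eq_zero]
          · simp
          · exact fun i _ => Set.indicator_of_notMem (fun h => hr h.1) _
      · simp [Set.indicator_of_notMem hω]
  · by_cases hω : ω ∈ B
    · simp only [Set.indicator_of_mem hω]; exact hC i ω
    · simp only [Set.indicator_of_notMem hω, abs_zero]; exact (abs_nonneg _).trans (hC i ω)

/-- The conditional Itô isometry for step processes. -/
theorem setLIntegral_integral_sq (G : StepFamily F t) (hW : IsBrownianFor F P W) {q s : ℝ≥0}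
    (hqs : q ≤ s) {B : Set Ω} (hB : MeasurableSet[F q] B) :
    ∫⁻ ω in B, ENNReal.ofReal (G.integral W s ω ^ 2) ∂P =
      ∫⁻ ω in B, ENNReal.ofReal (G.integral W q ω ^ 2) ∂P +
      ∫⁻ ω in B, ∫⁻ r in Set.Ioc q s, ENNReal.ofReal (G.val r ω ^ 2) ∂timeMeasure ∂P := by
  rw [← G.setLIntegral_integral_sub_sq hW hqs hB]
  have hBm : MeasurableSet B := F.le q B hB
  have hs := G.memLp_integral hW s
  have hq := G.memLp_integral hW q
  have hd : MemLp (fun ω => G.integral W s ω - G.integral W q ω) 2 P := hs.sub hq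
  rw [← ofReal_integral_eq_lintegral_ofReal hs.integrable_sq.integrableOn
      (ae_of_all _ fun _ => sq_nonneg _),
    ← ofReal_integral_eq_lintegral_ofReal hq.integrable_sq.integrableOn
      (ae_of_all _ fun _ => sq_nonneg _),
    ← ofReal_integral_eq_lintegral_ofReal hd.integrable_sq.integrableOn
      (ae_of_all _ fun _ => sq_nonneg _),
    ← ENNReal.ofReal_add (integral_nonneg fun _ => sq_nonneg _)
      (integral_nonneg fun _ => sq_nonneg _)]
  congr 1
  -- The cross term vanishes by the martingale property, tested against the integral at `q`
  -- restricted to `B`.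
  have h0 : ∫ ω in B, G.integral W q ω * (G.integral W s ω - G.integral W q ω) ∂P = 0 := by
    rw [← integral_indicator hBm, ← G.integral_mul_integral_sub hW hqs
      ((G.measurable_integral hW.adapted q).indicator hB) (hq.indicator hBm)]
    refine integral_congr_ae (ae_of_all _ fun ω => ?_)
    by_cases hω : ω ∈ B <;> simp [hω]
  have h1 : ∀ ω, G.integral W s ω ^ 2 = (G.integral W q ω ^ 2 +
      (G.integral W s ω - G.integral W q ω) ^ 2) +
      2 * (G.integral W q ω * (G.integral W s ω - G.integral W q ω)) := fun ω => by ring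
  simp_rw [h1]
  have hc : Integrable (fun ω => G.integral W q ω * (G.integral W s ω - G.integral W q ω)) P :=
    hq.integrable_mul hd
  have i1 : Integrable (fun ω => G.integral W q ω ^ 2 +
      (G.integral W s ω - G.integral W q ω) ^ 2) (P.restrict B) :=
    hq.integrable_sq.integrableOn.add hd.integrable_sq.integrableOn
  rw [integral_add i1 (hc.integrableOn.const_mul 2),
    integral_add hq.integrable_sq.integrableOn hd.integrable_sq.integrableOn, integral_const_mul,
    h0, mul_zero, add_zero]

/-- The Itô isometry for step processes. -/
theorem lintegral_integral_sq (G : StepFamily F t) (hW : IsBrownianFor F P W) {s : ℝ≥0}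
    (hts : t ≤ s) :
    ∫⁻ ω, ENNReal.ofReal (G.integral W s ω ^ 2) ∂P =
      ∫⁻ ω, ∫⁻ r in Set.Icc t s, ENNReal.ofReal (G.val r ω ^ 2) ∂timeMeasure ∂P := by
  have h := G.setLIntegral_integral_sq hW hts (B := Set.univ) MeasurableSet.univ
  simp only [Measure.restrict_univ, G.integral_start] at h
  rw [h]
  simp only [ne_eq, OfNat.ofNat_ne_zero, not_false_eq_true, zero_pow, ENNReal.ofReal_zero,
    lintegral_zero, zero_add]
  refine lintegral_congr fun ω => ?_
  exact setLIntegral_congr Ioc_ae_eq_Icc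

end StepFamily

end StepFamily

/-! ### Doob's inequality and the localised isometry -/

section Maximal

variable {Ω : Type*} {mΩ : MeasurableSpace Ω} {F : Filtration ℝ≥0 mΩ} {t : ℝ≥0}

namespace StepFamily

variable {P : Measure Ω} {W : ℝ≥0 → Ω → ℝ} [IsProbabilityMeasure P]

/-- Doob's first-passage argument: the event `B q` that `q` is the first time of `Q` at which the
integral reaches `ε` is known at time `q`, so by the conditional isometry the second moment over `B
q` can only grow between `q` and `T`. The `B q` are disjoint, and the estimates add up. -/
theorem measure_exists_mem_finset_le (G : StepFamily F t) (hW : IsBrownianFor F P W) {T : ℝ≥0}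
    (Q : Finset ℝ≥0) (hQ : ∀ q ∈ Q, q ≤ T) {ε : ℝ} (hε : 0 < ε) :
    ENNReal.ofReal (ε ^ 2) * P {ω | ∃ q ∈ Q, ε ≤ |G.integral W q ω|} ≤
      ∫⁻ ω, ENNReal.ofReal (G.integral W T ω ^ 2) ∂P := by
  have hM := G.measurable_integral hW.adapted
  set B : ℝ≥0 → Set Ω := fun q => {ω | ε ≤ |G.integral W q ω|} ∩
    ⋂ q' ∈ Q.filter (· < q), {ω | |G.integral W q' ω| < ε} with hBdef
  have hB : ∀ q, MeasurableSet[F q] (B q) := fun q => by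
    refine MeasurableSet.inter ?_ (Finset.measurableSet_biInter _ fun q' hq' => ?_)
    · exact (hM q) (measurableSet_le measurable_const measurable_norm)
    · have := (hM q').mono (F.mono (Finset.mem_filter.1 hq').2.le) le_rfl
      exact this (measurableSet_lt measurable_norm measurable_const)
  have hdisj : Set.PairwiseDisjoint (Q : Set ℝ≥0) B := by
    have key : ∀ q ∈ Q, ∀ q' ∈ Q, q < q' → Disjoint (B q) (B q') := by
      intro q hq q' hq' hlt
      rw [Set.disjoint_left]
      intro ω h1 h2
      have := Set.mem_iInter₂.1 h2.2 q (Finset.mem_filter.2 ⟨hq, hlt⟩)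
      exact absurd (Set.mem_ofPred_eq ▸ h1.1) (not_le.2 this)
    intro q hq q' hq' hne
    rcases hne.lt_or_gt with h | h
    · exact key q hq q' hq' h
    · exact (key q' hq' q hq h).symm
  have hcov : {ω | ∃ q ∈ Q, ε ≤ |G.integral W q ω|} ⊆ ⋃ q ∈ Q, B q := by
    rintro ω ⟨q, hq, h⟩
    obtain ⟨q₀, hq₀, hmin⟩ := Finset.exists_min_image
      (Q.filter fun q => ε ≤ |G.integral W q ω|) id ⟨q, Finset.mem_filter.2 ⟨hq, h⟩⟩
    rw [Finset.mem_filter] at hq₀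
    refine Set.mem_iUnion₂.2 ⟨q₀, hq₀.1, hq₀.2, Set.mem_iInter₂.2 fun q' hq' => ?_⟩
    rw [Finset.mem_filter] at hq'
    by_contra hc
    exact absurd (hmin q' (Finset.mem_filter.2 ⟨hq'.1, not_lt.1 hc⟩)) (not_le.2 hq'.2)
  have hBm : ∀ q, MeasurableSet (B q) := fun q => F.le q _ (hB q)
  calc ENNReal.ofReal (ε ^ 2) * P {ω | ∃ q ∈ Q, ε ≤ |G.integral W q ω|}
      ≤ ENNReal.ofReal (ε ^ 2) * ∑ q ∈ Q, P (B q) := by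
        gcongr
        exact (measure_mono hcov).trans (measure_biUnion_finset_le _ _)
    _ = ∑ q ∈ Q, ENNReal.ofReal (ε ^ 2) * P (B q) := Finset.mul_sum _ _ _
    _ ≤ ∑ q ∈ Q, ∫⁻ ω in B q, ENNReal.ofReal (G.integral W T ω ^ 2) ∂P := by
        refine Finset.sum_le_sum fun q hq => ?_
        rw [G.setLIntegral_integral_sq hW (hQ q hq) (hB q)]
        refine le_trans ?_ (le_add_right le_rfl)
        rw [← setLIntegral_const]
        refine setLIntegral_mono' (hBm q) fun ω hω => ENNReal.ofReal_le_ofReal ?_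
        rw [← sq_abs (G.integral W q ω)]
        exact pow_le_pow_left₀ hε.le hω.1 2
    _ = ∫⁻ ω in ⋃ q ∈ Q, B q, ENNReal.ofReal (G.integral W T ω ^ 2) ∂P :=
        (lintegral_biUnion_finset hdisj (fun q _ => hBm q) _).symm
    _ ≤ _ := setLIntegral_le_lintegral _ _

theorem continuous_integral (G : StepFamily F t) {ω : Ω} (h : Continuous (W · ω)) :
    Continuous fun s => G.integral W s ω := by
  unfold integral
  fun_prop

/-- Doob's maximal inequality for stochastic integrals of step processes. -/
theorem measure_exists_mem_Icc_le (G : StepFamily F t) (hW : IsBrownianFor F P W) {T : ℝ≥0}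
    (htT : t ≤ T) {ε : ℝ} (hε : 0 < ε) :
    P {ω | ∃ s ∈ Set.Icc t T, ε ≤ |G.integral W s ω|} ≤ ENNReal.ofReal (4 / ε ^ 2) *
      ∫⁻ ω, ∫⁻ r in Set.Icc t T, ENNReal.ofReal (G.val r ω ^ 2) ∂timeMeasure ∂P := by
  rw [← G.lintegral_integral_sq hW htT]
  have : Nonempty (Set.Icc t T) := ⟨⟨t, le_rfl, htT⟩⟩
  set d : ℕ → Set.Icc t T := TopologicalSpace.denseSeq (Set.Icc t T) with hd
  -- A continuous path that reaches `ε` exceeds `ε/2` at one of countably many dense times, and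
  -- finitely many of these are treated at a time. The halving produces the constant `4`.
  set E : ℕ → Set Ω := fun n => {ω | ∃ q ∈ (Finset.range n).image (fun i => (d i : ℝ≥0)),
    ε / 2 ≤ |G.integral W q ω|} with hE
  have hEmono : Monotone E := by
    rintro n m hnm ω ⟨q, hq, h⟩
    exact ⟨q, Finset.image_subset_image (Finset.range_mono hnm) hq, h⟩
  have hcov : {ω | ∃ s ∈ Set.Icc t T, ε ≤ |G.integral W s ω|} ⊆
      {ω | ¬ Continuous (W · ω)} ∪ ⋃ n, E n := by
    rintro ω ⟨s, hs, h⟩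
    by_cases hc : Continuous (W · ω)
    · right
      have hcont : Continuous fun s : Set.Icc t T => |G.integral W s ω| :=
        (G.continuous_integral hc).abs.comp continuous_subtype_val
      have hopen : IsOpen {s : Set.Icc t T | ε / 2 < |G.integral W s ω|} :=
        isOpen_lt continuous_const hcont
      obtain ⟨i, hi⟩ := (TopologicalSpace.denseRange_denseSeq (Set.Icc t T)).exists_mem_open
        hopen ⟨⟨s, hs⟩, lt_of_lt_of_le (half_lt_self hε) h⟩
      refine Set.mem_iUnion.2 ⟨i + 1, d i, ?_, le_of_lt hi⟩
      exact Finset.mem_image_of_mem _ (Finset.mem_range.2 i.lt_succ_self)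
    · exact Or.inl hc
  have hnull : P {ω | ¬ Continuous (W · ω)} = 0 := ae_iff.1 hW.cont
  calc P {ω | ∃ s ∈ Set.Icc t T, ε ≤ |G.integral W s ω|}
      ≤ P {ω | ¬ Continuous (W · ω)} + P (⋃ n, E n) :=
        (measure_mono hcov).trans (measure_union_le _ _)
    _ = ⨆ n, P (E n) := by rw [hnull, zero_add, hEmono.measure_iUnion]
    _ ≤ _ := by
        refine iSup_le fun n => ?_
        have h := G.measure_exists_mem_finset_le hW (T := T)
          ((Finset.range n).image (fun i => (d i : ℝ≥0))) (fun q hq => by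
            obtain ⟨i, -, rfl⟩ := Finset.mem_image.1 hq
            exact (d i).2.2) (half_pos hε)
        have h4 : 4 / ε ^ 2 = ((ε / 2) ^ 2)⁻¹ := by field_simp; norm_num
        have hpos : 0 < (ε / 2) ^ 2 := by positivity
        rw [h4, ENNReal.ofReal_inv_of_pos hpos]
        calc P (E n) = (ENNReal.ofReal ((ε / 2) ^ 2))⁻¹ *
              (ENNReal.ofReal ((ε / 2) ^ 2) * P (E n)) := by
              rw [← mul_assoc, ENNReal.inv_mul_cancel (by simpa using hpos.not_ge)
                ENNReal.ofReal_ne_top, one_mul]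
          _ ≤ _ := by gcongr

/-- The Itô isometry inequality localised to a decreasing adapted family of events. -/
theorem setLIntegral_integral_sq_le (G : StepFamily F t) (hW : IsBrownianFor F P W)
    {A : ℝ≥0 → Set Ω} (hA : ∀ s, t ≤ s → MeasurableSet[F s] (A s)) (hanti : Antitone A)
    (hjoint : MeasurableSet {p : ℝ≥0 × Ω | p.2 ∈ A p.1}) {s : ℝ≥0} (hts : t ≤ s) :
    ∫⁻ ω in A s, ENNReal.ofReal (G.integral W s ω ^ 2) ∂P ≤
      ∫⁻ ω, ∫⁻ r in Set.Icc t s,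
        (A r).indicator (fun ω => ENNReal.ofReal (G.val r ω ^ 2)) ω ∂timeMeasure ∂P := by
  obtain ⟨C, hC0, hC⟩ := G.exists_abs_val_le
  have hAm : ∀ s, t ≤ s → MeasurableSet (A s) := fun s hs => F.le s _ (hA s hs)
  set K : ℝ≥0∞ := ENNReal.ofReal (C ^ 2) with hK
  have hKv : ∀ r ω, ENNReal.ofReal (G.val r ω ^ 2) ≤ K := fun r ω => by
    refine ENNReal.ofReal_le_ofReal ?_
    rw [← sq_abs]
    exact pow_le_pow_left₀ (abs_nonneg _) (hC r ω) 2
  have hvm : Measurable fun p : ℝ≥0 × Ω => (A p.1).indicator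
      (fun ω => ENNReal.ofReal (G.val p.1 ω ^ 2)) p.2 := by
    have h : (fun p : ℝ≥0 × Ω => (A p.1).indicator
      (fun ω => ENNReal.ofReal (G.val p.1 ω ^ 2)) p.2) =
      {p : ℝ≥0 × Ω | p.2 ∈ A p.1}.indicator
        (fun p => ENNReal.ofReal (G.val p.1 p.2 ^ 2)) := rfl
    rw [h]
    exact (G.measurable_uncurry_val.pow_const 2).ennreal_ofReal.indicator hjoint
  set R : ℝ≥0 → ℝ≥0 → ℝ≥0∞ := fun a b => ∫⁻ ω, ∫⁻ r in Set.Ioc a b,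
    (A r).indicator (fun ω => ENNReal.ofReal (G.val r ω ^ 2)) ω ∂timeMeasure ∂P with hR
  have hRadd : ∀ a b, t ≤ a → a ≤ b → R t a + R a b = R t b := by
    intro a b ha hab
    have hm : Measurable fun ω => ∫⁻ r in Set.Ioc t a,
        (A r).indicator (fun ω => ENNReal.ofReal (G.val r ω ^ 2)) ω ∂timeMeasure :=
      hvm.lintegral_prod_left'
    simp only [hR]
    rw [← lintegral_add_left hm]
    refine lintegral_congr fun ω => ?_
    rw [← Set.Ioc_union_Ioc_eq_Ioc ha hab, lintegral_union measurableSet_Ioc]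
    exact Set.disjoint_left.2 fun r h1 h2 => absurd h1.2 (not_le.2 h2.1)
  -- Between `a` and `b` the energy on `A b` is accounted for by `R a b`, since `A b` lies in every
  -- earlier `A r`. On `A a \ A b` it is at most `K (b - a)`. Carrying `K (b - a) P(A ·)` on both
  -- sides makes these losses telescope.
  have hstep : ∀ a b, t ≤ a → a ≤ b →
      ∫⁻ ω in A b, ENNReal.ofReal (G.integral W b ω ^ 2) ∂P +
        K * ENNReal.ofReal (b - a : ℝ) * P (A b) ≤
      ∫⁻ ω in A a, ENNReal.ofReal (G.integral W a ω ^ 2) ∂P +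
        K * ENNReal.ofReal (b - a : ℝ) * P (A a) + R a b := by
    intro a b ha hab
    have hsub : A b ⊆ A a := hanti hab
    have h1 : ∫⁻ ω in A b, ENNReal.ofReal (G.integral W b ω ^ 2) ∂P ≤
        ∫⁻ ω in A a, ENNReal.ofReal (G.integral W b ω ^ 2) ∂P := lintegral_mono_set hsub
    rw [G.setLIntegral_integral_sq hW hab (hA a ha)] at h1
    have h2 : ∫⁻ ω in A a, ∫⁻ r in Set.Ioc a b, ENNReal.ofReal (G.val r ω ^ 2) ∂timeMeasure ∂P ≤
        R a b + K * ENNReal.ofReal (b - a : ℝ) * P (A a \ A b) := by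
      have hun : A a = A b ∪ (A a \ A b) := (Set.union_sdiff_cancel hsub).symm
      conv_lhs => rw [hun]
      rw [lintegral_union ((hAm a ha).diff (hAm b (ha.trans hab))) Set.disjoint_sdiff_right]
      refine add_le_add ?_ ?_
      · refine le_trans ?_ (setLIntegral_le_lintegral (A b) _)
        refine setLIntegral_mono' (hAm b (ha.trans hab)) fun ω hω => ?_
        refine setLIntegral_mono' measurableSet_Ioc fun r hr => ?_
        rw [Set.indicator_of_mem (hanti hr.2 hω)]
      · rw [← setLIntegral_const]
        refine lintegral_mono fun ω => ?_
        calc ∫⁻ r in Set.Ioc a b, ENNReal.ofReal (G.val r ω ^ 2) ∂timeMeasure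
            ≤ ∫⁻ r in Set.Ioc a b, K ∂timeMeasure := lintegral_mono fun r => hKv r ω
          _ = _ := by rw [setLIntegral_const, timeMeasure_Ioc]
    have h3 : P (A a) = P (A a \ A b) + P (A b) := by
      rw [measure_sdiff_add_inter (A a) (hAm b (ha.trans hab)) |>.symm,
        Set.inter_eq_self_of_subset_right hsub]
    calc _ ≤ (∫⁻ ω in A a, ENNReal.ofReal (G.integral W a ω ^ 2) ∂P +
          (R a b + K * ENNReal.ofReal (b - a : ℝ) * P (A a \ A b))) +
          K * ENNReal.ofReal (b - a : ℝ) * P (A b) := by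
          gcongr
          exact h1.trans (by gcongr)
      _ = _ := by rw [h3, mul_add]; ring
  have hmain : ∀ n : ℕ, ∫⁻ ω in A s, ENNReal.ofReal (G.integral W s ω ^ 2) ∂P ≤
      R t s + K * ENNReal.ofReal ((s - t : ℝ) * (1 / ((n : ℝ) + 1))) := by
    intro n
    -- On a uniform grid the telescoped losses amount to at most `K δ` in total, which vanishes as
    -- the mesh tends to zero.
    set δ : ℝ≥0 := (s - t) / (n + 1 : ℕ) with hδ
    have hind : ∀ j : ℕ, ∫⁻ ω in A (t + j * δ), ENNReal.ofReal (G.integral W (t + j * δ) ω ^ 2) ∂P +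
        K * ENNReal.ofReal δ * P (A (t + j * δ)) ≤ R t (t + j * δ) + K * ENNReal.ofReal δ := by
      intro j
      induction j with
      | zero =>
        simp only [Nat.cast_zero, zero_mul, add_zero, G.integral_start]
        simp only [ne_eq, OfNat.ofNat_ne_zero, not_false_eq_true, zero_pow, ENNReal.ofReal_zero,
          lintegral_zero, zero_add]
        refine le_add_left ?_
        calc K * ENNReal.ofReal δ * P (A t) ≤ K * ENNReal.ofReal δ * 1 := by
              gcongr; exact prob_le_one
          _ = _ := mul_one _
      | succ j ih =>
        have ha : t ≤ t + j * δ := le_self_add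
        have hab : t + j * δ ≤ t + (j + 1 : ℕ) * δ := by
          push_cast; gcongr; simp
        have h := hstep _ _ ha hab
        have hd : ((t + (j + 1 : ℕ) * δ : ℝ≥0) : ℝ) - (t + j * δ : ℝ≥0) = δ := by
          push_cast; ring
        rw [hd] at h
        rw [← hRadd _ _ ha hab]
        refine h.trans ?_
        calc _ ≤ R t (t + j * δ) + K * ENNReal.ofReal δ + R (t + j * δ) (t + (j + 1 : ℕ) * δ) := by
              gcongr
          _ = _ := by ring
    have h := hind (n + 1)
    have hs : t + (n + 1 : ℕ) * δ = s := by
      rw [hδ, mul_div_cancel₀ _ (by positivity), add_tsub_cancel_of_le hts]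
    rw [hs] at h
    have hδ' : (δ : ℝ) = (s - t : ℝ) * (1 / ((n : ℝ) + 1)) := by
      rw [hδ, NNReal.coe_div, NNReal.coe_sub hts]; push_cast; ring
    rw [hδ'] at h
    exact le_self_add.trans h
  have hlim : Tendsto (fun n : ℕ => R t s +
      K * ENNReal.ofReal ((s - t : ℝ) * (1 / ((n : ℝ) + 1)))) atTop (𝓝 (R t s + K * 0)) := by
    refine tendsto_const_nhds.add (ENNReal.Tendsto.const_mul ?_ (Or.inr ENNReal.ofReal_ne_top))
    have := (tendsto_one_div_add_atTop_nhds_zero_nat (𝕜 := ℝ)).const_mul (s - t : ℝ)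
    simpa using ENNReal.tendsto_ofReal this
  have h := ge_of_tendsto' hlim hmain
  rw [mul_zero, add_zero] at h
  refine h.trans (le_of_eq (lintegral_congr fun ω => ?_))
  exact setLIntegral_congr Ioc_ae_eq_Icc

/-- The difference of two step families. -/
def sub (G G' : StepFamily F t) : StepFamily F t where
  ι := G.ι ⊕ G'.ι
  left := Sum.elim G.left G'.left
  right := Sum.elim G.right G'.right
  coeff := Sum.elim G.coeff fun i ω => -G'.coeff i ω
  start_le := by rintro (i | i); exacts [G.start_le i, G'.start_le i]
  left_le_right := by rintro (i | i); exacts [G.left_le_right i, G'.left_le_right i]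
  measurable := by rintro (i | i); exacts [G.measurable i, (G'.measurable i).neg]
  bounded := by
    obtain ⟨C, hC⟩ := G.bounded
    obtain ⟨C', hC'⟩ := G'.bounded
    refine ⟨max C C', ?_⟩
    rintro (i | i) ω
    · exact (hC i ω).trans (le_max_left _ _)
    · simp only [Sum.elim_inr, abs_neg]
      exact (hC' i ω).trans (le_max_right _ _)

theorem sub_val (G G' : StepFamily F t) (s : ℝ≥0) (ω : Ω) :
    (G.sub G').val s ω = G.val s ω - G'.val s ω := by
  refine (Fintype.sum_sum_type (fun i : G.ι ⊕ G'.ι =>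
    (Set.Ioc (Sum.elim G.left G'.left i) (Sum.elim G.right G'.right i)).indicator
      (fun _ => Sum.elim G.coeff (fun i ω => -G'.coeff i ω) i ω) s)).trans ?_
  simp only [Sum.elim_inl, Sum.elim_inr, val, sub_eq_add_neg, ← Finset.sum_neg_distrib]
  congr 1
  refine Finset.sum_congr rfl fun i _ => ?_
  by_cases h : s ∈ Set.Ioc (G'.left i) (G'.right i)
  · rw [Set.indicator_of_mem h, Set.indicator_of_mem h]
  · rw [Set.indicator_of_notMem h, Set.indicator_of_notMem h, neg_zero]

theorem sub_integral (G G' : StepFamily F t) (s : ℝ≥0) (ω : Ω) :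
    (G.sub G').integral W s ω = G.integral W s ω - G'.integral W s ω := by
  refine (Fintype.sum_sum_type (fun i : G.ι ⊕ G'.ι =>
    Sum.elim G.coeff (fun i ω => -G'.coeff i ω) i ω *
      (W (min (Sum.elim G.right G'.right i) s) ω -
        W (min (Sum.elim G.left G'.left i) s) ω))).trans ?_
  simp only [Sum.elim_inl, Sum.elim_inr, integral, neg_mul, Finset.sum_neg_distrib,
    sub_eq_add_neg (Finset.sum _ _)]

end StepFamily

/-- A simple process, viewed as a step family. -/
def SimpleProcess.toStepFamily (G : SimpleProcess F t) : StepFamily F t where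
  ι := Fin G.n
  left i := G.time i
  right i := G.time (i + 1)
  coeff i := G.coeff i
  start_le i := G.start_le i
  left_le_right i := G.mono (Nat.le_succ _)
  measurable i := G.measurable i
  bounded := by
    obtain ⟨C, hC⟩ := G.bounded
    exact ⟨C, fun i => hC i⟩

theorem SimpleProcess.toStepFamily_val (G : SimpleProcess F t) (s : ℝ≥0) (ω : Ω) :
    G.toStepFamily.val s ω = G.val s ω :=
  Fin.sum_univ_eq_sum_range (fun i => (Set.Ioc (G.time i) (G.time (i + 1))).indicator
    (fun _ => G.coeff i ω) s) G.n

theorem SimpleProcess.toStepFamily_integral (G : SimpleProcess F t) (W : ℝ≥0 → Ω → ℝ) (s : ℝ≥0)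
    (ω : Ω) : G.toStepFamily.integral W s ω = G.integral W s ω :=
  Fin.sum_univ_eq_sum_range (fun i => G.coeff i ω *
    (W (min (G.time (i + 1)) s) ω - W (min (G.time i) s) ω)) G.n

end Maximal

/-! ### Path energy and progressive measurability -/

section Energy

/-- The energy `∫_t^s f²` of a path `f`. -/
noncomputable def pathEnergy (t s : ℝ≥0) (f : ℝ≥0 → ℝ) : ℝ≥0∞ :=
  ∫⁻ r in Set.Icc t s, ENNReal.ofReal (f r ^ 2) ∂timeMeasure

theorem pathEnergy_mono {t s s' : ℝ≥0} (h : s ≤ s') (f : ℝ≥0 → ℝ) :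
    pathEnergy t s f ≤ pathEnergy t s' f :=
  lintegral_mono_set (Set.Icc_subset_Icc_right h)

theorem pathEnergy_congr {t s : ℝ≥0} {f g : ℝ≥0 → ℝ} (h : ∀ r ∈ Set.Icc t s, f r = g r) :
    pathEnergy t s f = pathEnergy t s g :=
  setLIntegral_congr_fun measurableSet_Icc fun r hr => by simp only [h r hr]

theorem ofReal_add_sq_le (a b : ℝ) : ENNReal.ofReal ((a + b) ^ 2) ≤
    2 * ENNReal.ofReal (a ^ 2) + 2 * ENNReal.ofReal (b ^ 2) := by
  have h2 : (2 : ℝ≥0∞) = ENNReal.ofReal 2 := by simp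
  rw [h2, ← ENNReal.ofReal_mul (by norm_num), ← ENNReal.ofReal_mul (by norm_num),
    ← ENNReal.ofReal_add (by positivity) (by positivity)]
  exact ENNReal.ofReal_le_ofReal (by nlinarith [sq_nonneg (a - b)])

theorem pathEnergy_le_add {t s : ℝ≥0} {f g k : ℝ≥0 → ℝ}
    (hg : AEMeasurable g (timeMeasure.restrict (Set.Icc t s)))
    (h : ∀ r ∈ Set.Icc t s, f r = g r + k r) :
    pathEnergy t s f ≤ 2 * pathEnergy t s g + 2 * pathEnergy t s k := by
  have hm : AEMeasurable (fun r => ENNReal.ofReal (g r ^ 2))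
      (timeMeasure.restrict (Set.Icc t s)) := (hg.pow_const 2).ennreal_ofReal
  rw [pathEnergy_congr h, pathEnergy, pathEnergy, pathEnergy, ← lintegral_const_mul'' _ hm,
    ← lintegral_const_mul' _ _ (by simp), ← lintegral_add_left' (hm.const_mul _)]
  exact lintegral_mono fun r => ofReal_add_sq_le _ _

theorem pathEnergy_le_of_abs_le {t s : ℝ≥0} {f g : ℝ≥0 → ℝ} {C : ℝ}
    (h : ∀ r ∈ Set.Icc t s, |f r| ≤ C * |g r|) :
    pathEnergy t s f ≤ ENNReal.ofReal (C ^ 2) * pathEnergy t s g := by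
  rw [pathEnergy, pathEnergy, ← lintegral_const_mul' _ _ ENNReal.ofReal_ne_top]
  refine setLIntegral_mono' measurableSet_Icc fun r hr => ?_
  rw [← ENNReal.ofReal_mul (sq_nonneg _)]
  refine ENNReal.ofReal_le_ofReal ?_
  rw [← sq_abs (f r), ← sq_abs (g r), ← mul_pow]
  exact pow_le_pow_left₀ (abs_nonneg _) (h r hr) 2

theorem pathEnergy_const_le {t s : ℝ≥0} {f : ℝ≥0 → ℝ} {C : ℝ}
    (h : ∀ r ∈ Set.Icc t s, |f r| ≤ C) :
    pathEnergy t s f ≤ ENNReal.ofReal (C ^ 2) * ENNReal.ofReal (s - t) := by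
  rw [pathEnergy, ← timeMeasure_Icc, ← setLIntegral_const]
  refine setLIntegral_mono' measurableSet_Icc fun r hr => ENNReal.ofReal_le_ofReal ?_
  rw [← sq_abs]
  exact pow_le_pow_left₀ (abs_nonneg _) (h r hr) 2

variable {Ω : Type*} {mΩ : MeasurableSpace Ω} {F : Filtration ℝ≥0 mΩ} {t T : ℝ≥0}

theorem measurable_lintegral_left {α : Type*} [MeasurableSpace α] {m : MeasurableSpace Ω}
    {μ : Measure α} [SFinite μ] {f : α × Ω → ℝ≥0∞} (hf : Measurable f) :
    Measurable fun ω => ∫⁻ a, f (a, ω) ∂μ := hf.lintegral_prod_left'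

theorem measurable_integral_left {α : Type*} [MeasurableSpace α] {m : MeasurableSpace Ω}
    {μ : Measure α} [SFinite μ] {f : α × Ω → ℝ} (hf : Measurable f) :
    Measurable fun ω => ∫ a, f (a, ω) ∂μ :=
  hf.stronglyMeasurable.integral_prod_left'.measurable

theorem IsProgressiveOn.measurable_pathEnergy {H : ℝ≥0 → Ω → ℝ} (hH : IsProgressiveOn F t T H)
    {s : ℝ≥0} (hs : s ∈ Set.Icc t T) :
    Measurable[F s] fun ω => pathEnergy t s (fun r => H r ω) := by
  have h : (fun ω => pathEnergy t s (fun r => H r ω)) = fun ω =>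
      ∫⁻ r in Set.Icc t s,
        ENNReal.ofReal (((Set.Icc t s).indicator (fun r => H r ω) r) ^ 2) ∂timeMeasure := by
    ext ω
    refine setLIntegral_congr_fun measurableSet_Icc fun r hr => ?_
    simp only [Set.indicator_of_mem hr]
  rw [h]
  exact measurable_lintegral_left (m := F s) ((hH s hs).pow_const 2).ennreal_ofReal

theorem IsProgressiveOn.measurable_integral {H : ℝ≥0 → Ω → ℝ} (hH : IsProgressiveOn F t T H)
    {s : ℝ≥0} (hs : s ∈ Set.Icc t T) :
    Measurable[F s] fun ω => ∫ r in Set.Icc t s, H r ω ∂timeMeasure := by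
  have h : (fun ω => ∫ r in Set.Icc t s, H r ω ∂timeMeasure) = fun ω =>
      ∫ r in Set.Icc t s, (Set.Icc t s).indicator (fun r => H r ω) r ∂timeMeasure := by
    ext ω
    refine setIntegral_congr_fun measurableSet_Icc fun r hr => ?_
    simp only [Set.indicator_of_mem hr]
  rw [h]
  exact measurable_integral_left (m := F s) (hH s hs)

theorem IsProgressiveOn.measurable_indicator {H : ℝ≥0 → Ω → ℝ} (hH : IsProgressiveOn F t T H)
    {s : ℝ≥0} (hs : s ∈ Set.Icc t T) :
    Measurable fun p : ℝ≥0 × Ω => (Set.Icc t s).indicator (fun r => H r p.2) p.1 := by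
  have h : (inferInstance : MeasurableSpace ℝ≥0).prod (F s) ≤
      (inferInstance : MeasurableSpace ℝ≥0).prod mΩ :=
    sup_le_sup le_rfl (MeasurableSpace.comap_mono (F.le s))
  exact (hH s hs).mono h le_rfl

theorem IsProgressiveOn.aemeasurable {H : ℝ≥0 → Ω → ℝ} (hH : IsProgressiveOn F t T H)
    {s : ℝ≥0} (hs : s ∈ Set.Icc t T) (ω : Ω) :
    AEMeasurable (fun r => H r ω) (timeMeasure.restrict (Set.Icc t s)) := by
  rw [← aemeasurable_indicator_iff measurableSet_Icc]
  exact ((hH.measurable_indicator hs).comp measurable_prodMk_right).aemeasurable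

/-- The inner indicators supply joint measurability and the outer one discards the values outside
the window, so `g` need not vanish at zero. -/
theorem IsProgressiveOn.comp₂ {E E' E'' : Type*} [MeasurableSpace E] [MeasurableSpace E']
    [MeasurableSpace E''] [Zero E] [Zero E'] [Zero E''] {H : ℝ≥0 → Ω → E} {H' : ℝ≥0 → Ω → E'}
    (hH : IsProgressiveOn F t T H) (hH' : IsProgressiveOn F t T H') {g : ℝ≥0 → E → E' → E''}
    (hg : Measurable fun p : ℝ≥0 × E × E' => g p.1 p.2.1 p.2.2) :
    IsProgressiveOn F t T fun r ω => g r (H r ω) (H' r ω) := by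
  intro s hs
  have h : (fun p : ℝ≥0 × Ω => (Set.Icc t s).indicator (fun r => g r (H r p.2) (H' r p.2)) p.1) =
      (Prod.fst ⁻¹' Set.Icc t s).indicator fun p : ℝ≥0 × Ω =>
        g p.1 ((Set.Icc t s).indicator (fun r => H r p.2) p.1)
          ((Set.Icc t s).indicator (fun r => H' r p.2) p.1) := by
    ext p
    by_cases hp : p.1 ∈ Set.Icc t s
    · rw [Set.indicator_of_mem hp, Set.indicator_of_mem (by exact hp), Set.indicator_of_mem hp,
        Set.indicator_of_mem hp]
    · rw [Set.indicator_of_notMem hp, Set.indicator_of_notMem (by exact hp)]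
  rw [h]
  refine Measurable.indicator ?_ (measurable_fst measurableSet_Icc)
  exact hg.comp (Measurable.prodMk measurable_fst (Measurable.prodMk (hH s hs) (hH' s hs)))

theorem IsProgressiveOn.comp {E E' : Type*} [MeasurableSpace E] [MeasurableSpace E']
    [Zero E] [Zero E'] {H : ℝ≥0 → Ω → E} (hH : IsProgressiveOn F t T H) {g : ℝ≥0 → E → E'}
    (hg : Measurable fun p : ℝ≥0 × E => g p.1 p.2) :
    IsProgressiveOn F t T fun r ω => g r (H r ω) :=
  hH.comp₂ hH (g := fun r x _ => g r x) (hg.comp (by fun_prop :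
    Measurable fun p : ℝ≥0 × E × E => (p.1, p.2.1)))

theorem IsProgressiveOn.sub {H H' : ℝ≥0 → Ω → ℝ} (hH : IsProgressiveOn F t T H)
    (hH' : IsProgressiveOn F t T H') : IsProgressiveOn F t T fun r ω => H r ω - H' r ω :=
  hH.comp₂ hH' (g := fun _ x y => x - y) (by fun_prop)

/-- Continuous adapted processes are progressively measurable. -/
theorem isProgressiveOn_of_continuousOn {X : ℝ≥0 → Ω → ℝ}
    (hX : ∀ s ∈ Set.Icc t T, Measurable[F s] (X s))
    (hc : ∀ ω, ContinuousOn (fun s => X s ω) (Set.Icc t T)) : IsProgressiveOn F t T X := by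
  intro s hs
  -- Freezing the path at the ends of `[t, s]` gives a process that is continuous on the whole axis
  -- and `F s`-measurable at every time, hence jointly measurable.
  set u : ℝ≥0 → Ω → ℝ := fun r ω => X (Set.projIcc t s hs.1 r) ω with hu
  have h1 : Measurable[(inferInstance : MeasurableSpace ℝ≥0).prod (F s)] (Function.uncurry u) := by
    refine measurable_uncurry_of_continuous_of_measurable (m := F s) (fun ω => ?_) fun r => ?_
    · exact ((hc ω).mono (Set.Icc_subset_Icc_right hs.2)).comp_continuous
        (continuous_subtype_val.comp continuous_projIcc) fun r => (Set.projIcc t s hs.1 r).2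
    · have hr := (Set.projIcc t s hs.1 r).2
      exact (hX _ ⟨hr.1, hr.2.trans hs.2⟩).mono (F.mono hr.2) le_rfl
  have h : (fun p : ℝ≥0 × Ω => (Set.Icc t s).indicator (fun r => X r p.2) p.1) =
      (Prod.fst ⁻¹' Set.Icc t s).indicator (Function.uncurry u) := by
    ext p
    by_cases hp : p.1 ∈ Set.Icc t s
    · rw [Set.indicator_of_mem hp, Set.indicator_of_mem (by exact hp)]
      simp only [Function.uncurry, hu, Set.projIcc_of_mem hs.1 hp]
    · rw [Set.indicator_of_notMem hp, Set.indicator_of_notMem (by exact hp)]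
  rw [h]
  exact Measurable.indicator h1 (measurable_fst measurableSet_Icc)

/-- Passes from windows `[t, s]` to the notion required of Itô integrands. The process vanishes
before `t` and after `T`, so the window ending at `min i T` carries everything visible by time `i`.
-/
theorem IsProgressiveOn.isProgressive {H : ℝ≥0 → Ω → ℝ} (hH : IsProgressiveOn F t T H)
    (htT : t ≤ T) : IsProgressive F (fun s ω => (Set.Icc t T).indicator (fun r => H r ω) s) := by
  intro i
  rcases lt_or_ge i t with hi | hi
  · have h : (fun p : Set.Iic i × Ω => (Set.Icc t T).indicator (fun r => H r p.2) (p.1 : ℝ≥0)) =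
        fun _ => 0 := by
      ext p
      exact Set.indicator_of_notMem (fun h => absurd (h.1.trans p.1.2) (not_le.2 hi)) _
    rw [h]
    exact measurable_const
  · have hs : min i T ∈ Set.Icc t T := ⟨le_min hi htT, min_le_right _ _⟩
    have h : (fun p : Set.Iic i × Ω => (Set.Icc t T).indicator (fun r => H r p.2) (p.1 : ℝ≥0)) =
        (fun p : ℝ≥0 × Ω => (Set.Icc t (min i T)).indicator (fun r => H r p.2) p.1) ∘
          fun p : Set.Iic i × Ω => ((p.1 : ℝ≥0), p.2) := by
      ext p
      simp only [Function.comp]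
      by_cases hp : (p.1 : ℝ≥0) ∈ Set.Icc t T
      · rw [Set.indicator_of_mem hp, Set.indicator_of_mem (s := Set.Icc t (min i T))
          ⟨hp.1, le_min p.1.2 hp.2⟩]
      · rw [Set.indicator_of_notMem hp, Set.indicator_of_notMem
          (fun h => hp ⟨h.1, h.2.trans (min_le_right _ _)⟩)]
    rw [h]
    have hm : (inferInstance : MeasurableSpace ℝ≥0).prod (F (min i T)) ≤
        (inferInstance : MeasurableSpace ℝ≥0).prod (F i) :=
      sup_le_sup le_rfl (MeasurableSpace.comap_mono (F.mono (min_le_left _ _)))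
    refine ((hH _ hs).mono hm le_rfl).comp ?_
    exact Measurable.prodMk (measurable_subtype_coe.comp measurable_fst) measurable_snd

end Energy

/-! ### Density of simple processes -/

section Density

variable {Ω : Type*} {mΩ : MeasurableSpace Ω} {F : Filtration ℝ≥0 mΩ} {t T : ℝ≥0}

theorem abs_setAverage_closedBall_le {f : ℝ → ℝ} {C : ℝ} (hC0 : 0 ≤ C) (hf : ∀ y, |f y| ≤ C)
    (a δ : ℝ) : |⨍ y in Metric.closedBall a δ, f y| ≤ C := by
  rw [setAverage_eq, smul_eq_mul, abs_mul, abs_of_nonneg (inv_nonneg.2 measureReal_nonneg)]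
  have h1 : ‖∫ y in Metric.closedBall a δ, f y‖ ≤ C * volume.real (Metric.closedBall a δ) :=
    norm_setIntegral_le_of_norm_le_const measure_closedBall_lt_top fun y _ => hf y
  rw [Real.norm_eq_abs] at h1
  calc _ ≤ (volume.real (Metric.closedBall a δ))⁻¹ *
        (C * volume.real (Metric.closedBall a δ)) := by gcongr
    _ ≤ C := by
      rcases eq_or_ne (volume.real (Metric.closedBall a δ)) 0 with h0 | h0
      · rw [h0]; simpa using hC0
      · rw [mul_comm C, inv_mul_cancel_left₀ h0]

/-- The simple process obtained from `H` by averaging over the preceding interval of a grid with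
`N + 1` steps. -/
theorem exists_simpleProcess_eq_average (htT : t ≤ T) {H : ℝ≥0 → Ω → ℝ}
    (hH : IsProgressiveOn F t T H) {C : ℝ} (hC0 : 0 ≤ C)
    (hC : ∀ ω, ∀ r ∈ Set.Icc t T, |H r ω| ≤ C) (N : ℕ) :
    ∃ G : SimpleProcess F t, ∀ r ∈ Set.Ioc t T, ∃ i : ℕ,
      (r : ℝ) ∈ Metric.closedBall ((t : ℝ) + (i - 1 / 2) * ((T - t) / ((N : ℝ) + 1)))
        (3 * (((T : ℝ) - t) / ((N : ℝ) + 1) / 2)) ∧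
      ∀ ω, G.val r ω = ⨍ y in Metric.closedBall
          ((t : ℝ) + (i - 1 / 2) * ((T - t) / ((N : ℝ) + 1))) (((T : ℝ) - t) / ((N : ℝ) + 1) / 2),
        (Set.Icc t T).indicator (fun r => H r ω) y.toNNReal := by
  set δ : ℝ≥0 := (T - t) / (N + 1 : ℕ) with hδ
  have hδ' : ((T : ℝ) - t) / ((N : ℝ) + 1) = δ := by
    rw [hδ, NNReal.coe_div, NNReal.coe_sub htT]; push_cast; rfl
  rw [hδ']
  have hmono : Monotone fun i : ℕ => t + i * δ := fun i j hij => by dsimp only; gcongr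
  -- `B i` is the cell of length `δ` ending at `t + i δ`, so the average over it is known when the
  -- `i`-th interval begins. The cell before `t` sees at most the value at `t`.
  set B : ℕ → Set ℝ := fun i => Metric.closedBall ((t : ℝ) + (i - 1 / 2) * δ) (δ / 2) with hB
  have hle : ∀ i, ∀ y ∈ B i, y.toNNReal ≤ t + i * δ := by
    intro i y hy
    rw [hB, Metric.mem_closedBall, Real.dist_eq, abs_le] at hy
    rw [Real.toNNReal_le_iff_le_coe]
    push_cast
    linarith [hy.2]
  have hbound : ∀ ω y, |(Set.Icc t T).indicator (fun r => H r ω) y| ≤ C := by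
    intro ω y
    by_cases hy : y ∈ Set.Icc t T
    · rw [Set.indicator_of_mem hy]; exact hC ω y hy
    · rw [Set.indicator_of_notMem hy, abs_zero]; exact hC0
  let G : SimpleProcess F t :=
    { n := N + 1
      time := fun i => t + i * δ
      coeff := fun i ω => ⨍ y in B i, (Set.Icc t T).indicator (fun r => H r ω) y.toNNReal
      start_le := fun i => le_self_add
      mono := hmono
      measurable := fun i => by
        set s := min (t + i * δ) T with hs
        have hsm : s ∈ Set.Icc t T := ⟨le_min le_self_add htT, min_le_right _ _⟩
        have h : (fun ω => ⨍ y in B i, (Set.Icc t T).indicator (fun r => H r ω) y.toNNReal) =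
            fun ω => (volume.real (B i))⁻¹ *
              ∫ y in B i, (Set.Icc t s).indicator (fun r => H r ω) y.toNNReal := by
          ext ω
          rw [setAverage_eq, smul_eq_mul]
          congr 1
          refine setIntegral_congr_fun Metric.isClosed_closedBall.measurableSet fun y hy => ?_
          have hy' := hle i y hy
          by_cases h2 : y.toNNReal ∈ Set.Icc t T
          · rw [Set.indicator_of_mem h2, Set.indicator_of_mem
              (s := Set.Icc t s) ⟨h2.1, le_min hy' h2.2⟩]
          · rw [Set.indicator_of_notMem h2, Set.indicator_of_notMem
              (fun h => h2 ⟨h.1, h.2.trans hsm.2⟩)]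
        rw [h]
        refine Measurable.const_mul ?_ _
        have hm : Measurable[F s] fun ω =>
            ∫ y in B i, (Set.Icc t s).indicator (fun r => H r ω) y.toNNReal :=
          measurable_integral_left (m := F s) (f := fun p : ℝ × Ω =>
            (Set.Icc t s).indicator (fun r => H r p.2) p.1.toNNReal)
            ((hH s hsm).comp (Measurable.prodMk (measurable_real_toNNReal.comp measurable_fst)
              measurable_snd))
        exact hm.mono (F.mono (min_le_left _ _)) le_rfl
      bounded := by
        exact ⟨C, fun i ω => abs_setAverage_closedBall_le hC0 (fun y => hbound ω _) _ _⟩ }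
  refine ⟨G, fun r hr => ?_⟩
  have hlast : t + (N + 1 : ℕ) * δ = T := by
    rw [hδ, mul_div_cancel₀ _ (by positivity), add_tsub_cancel_of_le htT]
  have hex : ∃ j : ℕ, r ≤ t + j * δ := ⟨N + 1, by rw [hlast]; exact hr.2⟩
  classical
  -- The first grid point not before `r` closes the interval containing `r`; it is not the zeroth
  -- one because `t < r`.
  obtain ⟨i, hi⟩ : ∃ i, Nat.find hex = i + 1 := by
    refine Nat.exists_eq_succ_of_ne_zero fun h0 => ?_
    have := Nat.find_spec hex
    rw [h0] at this
    simp only [Nat.cast_zero, zero_mul, add_zero] at this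
    exact absurd hr.1 (not_lt.2 this)
  have hi2 : r ≤ t + (i + 1 : ℕ) * δ := hi ▸ Nat.find_spec hex
  have hi1 : t + i * δ < r := not_le.1 (Nat.find_min hex (m := i) (by omega))
  have hiN : i < N + 1 := by
    have := Nat.find_min' hex (m := N + 1) (by rw [hlast]; exact hr.2)
    omega
  refine ⟨i, ?_, fun ω => ?_⟩
  -- The point `r` lies in the cell following `B i`, at distance at most `3δ/2` from the centre of
  -- `B i`: three times its radius.
  · have h1 : ((t + i * δ : ℝ≥0) : ℝ) < r := hi1
    have h2 : (r : ℝ) ≤ ((t + (i + 1 : ℕ) * δ : ℝ≥0) : ℝ) := hi2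
    push_cast at h1 h2
    rw [Metric.mem_closedBall, Real.dist_eq, abs_le]
    constructor <;> nlinarith [δ.2]
  · have hval : G.val r ω = ∑ j ∈ Finset.range (N + 1),
      (Set.Ioc (t + j * δ) (t + (j + 1 : ℕ) * δ)).indicator (fun _ => G.coeff j ω) r := rfl
    rw [hval, Finset.sum_eq_single_of_mem i (Finset.mem_range.2 hiN)]
    · rw [Set.indicator_of_mem (s := Set.Ioc (t + i * δ) (t + (i + 1 : ℕ) * δ)) ⟨hi1, hi2⟩]
    · intro j _ hj
      refine Set.indicator_of_notMem (fun h => hj ?_) _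
      by_contra hne
      rcases lt_or_gt_of_ne hne with hlt | hlt
      · have : t + (j + 1 : ℕ) * δ ≤ t + i * δ := hmono hlt
        exact absurd (h.2.trans this) (not_le.2 hi1)
      · have : t + (i + 1 : ℕ) * δ ≤ t + j * δ := hmono hlt
        exact absurd (hi2.trans this) (not_le.2 h.1)

theorem SimpleProcess.isProgressiveOn_val (G : SimpleProcess F t) (T : ℝ≥0) :
    IsProgressiveOn F t T G.val := by
  have h : G.val = G.toStepFamily.val := by ext; rw [G.toStepFamily_val]
  rw [h]
  exact G.toStepFamily.isProgressiveOn_val T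

variable {P : Measure Ω} [IsProbabilityMeasure P]

/-- Lebesgue differentiation on each path: the averaging balls need not contain `r`, only have it
within three radii of their centres, and they shrink, so the averages tend to `H` at almost every
time. Boundedness permits dominated convergence, first in time and then over `Ω`. -/
theorem exists_simpleProcess_lintegral_le_of_bounded (htT : t ≤ T) {H : ℝ≥0 → Ω → ℝ}
    (hH : IsProgressiveOn F t T H) {C : ℝ} (hC0 : 0 ≤ C)
    (hC : ∀ ω, ∀ r ∈ Set.Icc t T, |H r ω| ≤ C) {η : ℝ≥0∞} (hη : 0 < η) :
    ∃ G : SimpleProcess F t,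
      ∫⁻ ω, pathEnergy t T (fun r => G.val r ω - H r ω) ∂P ≤ η := by
  have hTm : T ∈ Set.Icc t T := ⟨htT, le_rfl⟩
  rcases htT.eq_or_lt with heq | hlt
  · obtain ⟨G, -⟩ := exists_simpleProcess_eq_average htT hH hC0 hC 0
    refine ⟨G, ?_⟩
    have h0 : ∀ f, pathEnergy t T f = 0 := fun f => by
      rw [pathEnergy, setLIntegral_measure_zero]
      rw [timeMeasure_Icc, heq]; simp
    simp [h0]
  choose G hG using exists_simpleProcess_eq_average htT hH hC0 hC
  have hbound : ∀ ω y, |(Set.Icc t T).indicator (fun r => H r ω) y| ≤ C := by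
    intro ω y
    by_cases hy : y ∈ Set.Icc t T
    · rw [Set.indicator_of_mem hy]; exact hC ω y hy
    · rw [Set.indicator_of_notMem hy, abs_zero]; exact hC0
  have hGC : ∀ N, ∀ r ∈ Set.Ioc t T, ∀ ω, |(G N).val r ω| ≤ C := by
    intro N r hr ω
    obtain ⟨i, -, h⟩ := hG N r hr
    rw [h ω]
    exact abs_setAverage_closedBall_le hC0 (fun y => hbound ω _) _ _
  have hδlim : Tendsto (fun N : ℕ => ((T : ℝ) - t) / ((N : ℝ) + 1) / 2) atTop (𝓝[>] 0) := by
    have hlt' : (0 : ℝ) < T - t := sub_pos.2 hlt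
    refine tendsto_nhdsWithin_iff.2 ⟨?_, Eventually.of_forall fun N => ?_⟩
    · have := (tendsto_one_div_add_atTop_nhds_zero_nat (𝕜 := ℝ)).const_mul (((T : ℝ) - t) / 2)
      rw [mul_zero] at this
      refine this.congr fun N => ?_
      ring
    · exact Set.mem_Ioi.2 (by positivity)
  have hptw : ∀ ω, ∀ᵐ r : ℝ≥0 ∂timeMeasure, r ∈ Set.Ioc t T →
      Tendsto (fun N => (G N).val r ω) atTop (𝓝 (H r ω)) := by
    intro ω
    have hm : Measurable fun y : ℝ => (Set.Icc t T).indicator (fun r => H r ω) y.toNNReal :=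
      ((hH.measurable_indicator hTm).comp measurable_prodMk_right).comp measurable_real_toNNReal
    have hloc : LocallyIntegrable
        (fun y : ℝ => (Set.Icc t T).indicator (fun r => H r ω) y.toNNReal) volume :=
      (memLp_top_of_bound hm.aestronglyMeasurable C
        (ae_of_all _ fun y => hbound ω _)).locallyIntegrable le_top
    have hae := IsUnifLocDoublingMeasure.ae_tendsto_average volume hloc 3
    filter_upwards [ae_timeMeasure_of_ae hae] with r hr hmem
    choose i hi1 hi2 using fun N => hG N r hmem
    have := hr (fun N : ℕ => (t : ℝ) + (i N - 1 / 2) * ((T - t) / ((N : ℝ) + 1)))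
      (fun N : ℕ => ((T : ℝ) - t) / ((N : ℝ) + 1) / 2) hδlim (Eventually.of_forall hi1)
    rw [Real.toNNReal_coe, Set.indicator_of_mem (s := Set.Icc t T) ⟨hmem.1.le, hmem.2⟩] at this
    refine this.congr fun N => ?_
    rw [hi2 N ω]
  have hIoc : ∀ᵐ r ∂timeMeasure.restrict (Set.Icc t T), r ∈ Set.Ioc t T := by
    rw [← restrict_Ioc_eq_restrict_Icc]
    exact ae_restrict_mem measurableSet_Ioc
  have hdom : ∀ N ω, ∀ᵐ r ∂timeMeasure.restrict (Set.Icc t T),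
      ENNReal.ofReal (((G N).val r ω - H r ω) ^ 2) ≤ ENNReal.ofReal ((2 * C) ^ 2) := by
    intro N ω
    filter_upwards [hIoc] with r hr
    refine ENNReal.ofReal_le_ofReal ?_
    rw [← sq_abs]
    refine pow_le_pow_left₀ (abs_nonneg _) ((abs_sub _ _).trans ?_) 2
    linarith [hGC N r hr ω, hC ω r ⟨hr.1.le, hr.2⟩]
  have hprog : ∀ N, IsProgressiveOn F t T fun r ω => (G N).val r ω - H r ω := fun N =>
    ((G N).isProgressiveOn_val T).sub hH
  have hinner : ∀ ω, Tendsto (fun N => pathEnergy t T (fun r => (G N).val r ω - H r ω)) atTop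
      (𝓝 0) := by
    intro ω
    have h0 : ∫⁻ _ in Set.Icc t T, (0 : ℝ≥0∞) ∂timeMeasure = 0 := lintegral_zero
    rw [← h0]
    refine tendsto_lintegral_of_dominated_convergence' (fun _ => ENNReal.ofReal ((2 * C) ^ 2))
      (fun N => (((hprog N).aemeasurable hTm ω).pow_const 2).ennreal_ofReal)
      (fun N => hdom N ω) ?_ ?_
    · rw [lintegral_const, Measure.restrict_apply_univ, timeMeasure_Icc]
      exact ENNReal.mul_ne_top ENNReal.ofReal_ne_top ENNReal.ofReal_ne_top
    · filter_upwards [ae_restrict_of_ae (hptw ω), hIoc] with r hr hmem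
      have := ((hr hmem).sub_const (H r ω)).pow 2
      rw [sub_self, zero_pow two_ne_zero] at this
      simpa using ENNReal.tendsto_ofReal this
  have houter : Tendsto (fun N => ∫⁻ ω, pathEnergy t T (fun r => (G N).val r ω - H r ω) ∂P) atTop
      (𝓝 0) := by
    have h0 : ∫⁻ _, (0 : ℝ≥0∞) ∂P = 0 := lintegral_zero
    rw [← h0]
    refine tendsto_lintegral_of_dominated_convergence'
      (fun _ => ENNReal.ofReal ((2 * C) ^ 2) * ENNReal.ofReal (T - t))
      (fun N => (((hprog N).measurable_pathEnergy hTm).mono (F.le T) le_rfl).aemeasurable)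
      (fun N => ae_of_all _ fun ω => ?_) ?_ (ae_of_all _ hinner)
    · refine (lintegral_mono_ae (hdom N ω)).trans ?_
      rw [setLIntegral_const, timeMeasure_Icc]
    · rw [lintegral_const]
      exact ENNReal.mul_ne_top (ENNReal.mul_ne_top ENNReal.ofReal_ne_top ENNReal.ofReal_ne_top)
        (measure_ne_top _ _)
  obtain ⟨N, hN⟩ := (houter.eventually (eventually_le_nhds hη)).exists
  exact ⟨G N, hN⟩

/-- Simple processes are dense among the progressively measurable processes of finite energy. -/
theorem exists_simpleProcess_lintegral_le (htT : t ≤ T) {H : ℝ≥0 → Ω → ℝ}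
    (hH : IsProgressiveOn F t T H)
    (hfin : ∫⁻ ω, pathEnergy t T (fun r => H r ω) ∂P ≠ ∞) {η : ℝ≥0∞} (hη : 0 < η) :
    ∃ G : SimpleProcess F t,
      ∫⁻ ω, pathEnergy t T (fun r => G.val r ω - H r ω) ∂P ≤ η := by
  have hTm : T ∈ Set.Icc t T := ⟨htT, le_rfl⟩
  -- Truncation at level `N` reduces to bounded integrands; the truncation error is dominated by `H`
  -- itself.
  set K : ℕ → ℝ≥0 → Ω → ℝ := fun N r ω => max (-(N : ℝ)) (min (H r ω) N) with hK
  have hKp : ∀ N, IsProgressiveOn F t T (K N) := fun N =>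
    hH.comp (g := fun _ x => max (-(N : ℝ)) (min x N)) (by fun_prop)
  have hKH : ∀ N, IsProgressiveOn F t T fun r ω => K N r ω - H r ω := fun N => (hKp N).sub hH
  have hle : ∀ N r ω, |K N r ω - H r ω| ≤ |H r ω| := by
    intro N r ω
    have hN : (0 : ℝ) ≤ N := N.cast_nonneg
    simp only [hK]
    rcases le_total (H r ω) N with h1 | h1 <;> rcases le_total (H r ω) (-N) with h2 | h2
    · rw [min_eq_left h1, max_eq_left h2, abs_of_nonneg (by linarith),
        abs_of_nonpos (by linarith)]; linarith
    · rw [min_eq_left h1, max_eq_right h2]; simp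
    · rw [min_eq_right h1, max_eq_right (by linarith), abs_of_nonpos (by linarith),
        abs_of_nonneg (by linarith)]; linarith
    · rw [min_eq_right h1, max_eq_right (by linarith), abs_of_nonpos (by linarith),
        abs_of_nonneg (by linarith)]; linarith
  have hlim : ∀ r ω, Tendsto (fun N => K N r ω) atTop (𝓝 (H r ω)) := by
    intro r ω
    obtain ⟨N₀, hN₀⟩ := exists_nat_ge |H r ω|
    refine tendsto_const_nhds.congr' ?_
    filter_upwards [eventually_ge_atTop N₀] with N hN
    have h1 : |H r ω| ≤ N := hN₀.trans (by exact_mod_cast hN)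
    rw [abs_le] at h1
    simp only [hK]
    rw [min_eq_left h1.2, max_eq_right h1.1]
  have hEm : Measurable fun ω => pathEnergy t T (fun r => H r ω) :=
    (hH.measurable_pathEnergy hTm).mono (F.le T) le_rfl
  have hdom : ∀ N r ω, ENNReal.ofReal ((K N r ω - H r ω) ^ 2) ≤ ENNReal.ofReal (H r ω ^ 2) := by
    intro N r ω
    refine ENNReal.ofReal_le_ofReal ?_
    rw [← sq_abs, ← sq_abs (H r ω)]
    exact pow_le_pow_left₀ (abs_nonneg _) (hle N r ω) 2
  have hinner : ∀ᵐ ω ∂P, Tendsto (fun N => pathEnergy t T (fun r => K N r ω - H r ω)) atTop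
      (𝓝 0) := by
    filter_upwards [ae_lt_top hEm hfin] with ω hω
    have h0 : ∫⁻ _ in Set.Icc t T, (0 : ℝ≥0∞) ∂timeMeasure = 0 := lintegral_zero
    rw [← h0]
    refine tendsto_lintegral_of_dominated_convergence' (fun r => ENNReal.ofReal (H r ω ^ 2))
      (fun N => (((hKH N).aemeasurable hTm ω).pow_const 2).ennreal_ofReal)
      (fun N => ae_of_all _ fun r => hdom N r ω) hω.ne (ae_of_all _ fun r => ?_)
    have := ((hlim r ω).sub_const (H r ω)).pow 2
    rw [sub_self, zero_pow two_ne_zero] at this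
    simpa using ENNReal.tendsto_ofReal this
  have houter : Tendsto (fun N => ∫⁻ ω, pathEnergy t T (fun r => K N r ω - H r ω) ∂P) atTop
      (𝓝 0) := by
    have h0 : ∫⁻ _, (0 : ℝ≥0∞) ∂P = 0 := lintegral_zero
    rw [← h0]
    exact tendsto_lintegral_of_dominated_convergence' _
      (fun N => (((hKH N).measurable_pathEnergy hTm).mono (F.le T) le_rfl).aemeasurable)
      (fun N => ae_of_all _ fun ω => lintegral_mono fun r => hdom N r ω) hfin hinner
  -- Two errors of size `η/4` suffice, as the square of a sum costs a factor `2` for each.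
  have hη4 : 0 < η / 4 := ENNReal.div_pos hη.ne' (by simp)
  obtain ⟨N, hN⟩ := (houter.eventually (eventually_le_nhds hη4)).exists
  obtain ⟨G, hG⟩ := exists_simpleProcess_lintegral_le_of_bounded (P := P) htT (hKp N)
    (C := N) N.cast_nonneg (fun ω r _ => by
      have hN : (0 : ℝ) ≤ N := N.cast_nonneg
      rw [abs_le]
      exact ⟨le_max_left _ _, max_le (by linarith) (min_le_right _ _)⟩) hη4
  refine ⟨G, ?_⟩
  have hGK : IsProgressiveOn F t T fun r ω => G.val r ω - K N r ω :=
    (G.isProgressiveOn_val T).sub (hKp N)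
  calc ∫⁻ ω, pathEnergy t T (fun r => G.val r ω - H r ω) ∂P
      ≤ ∫⁻ ω, (2 * pathEnergy t T (fun r => G.val r ω - K N r ω) +
          2 * pathEnergy t T (fun r => K N r ω - H r ω)) ∂P :=
        lintegral_mono fun ω => pathEnergy_le_add (hGK.aemeasurable hTm ω) fun r _ => by ring
    _ = 2 * ∫⁻ ω, pathEnergy t T (fun r => G.val r ω - K N r ω) ∂P +
          2 * ∫⁻ ω, pathEnergy t T (fun r => K N r ω - H r ω) ∂P := by
        rw [lintegral_add_left (((hGK.measurable_pathEnergy hTm).mono (F.le T) le_rfl).const_mul _),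
          lintegral_const_mul' _ _ (by simp), lintegral_const_mul' _ _ (by simp)]
    _ ≤ 2 * (η / 4) + 2 * (η / 4) := by gcongr
    _ = η := by
        rw [← add_mul, show (2 + 2 : ℝ≥0∞) = 4 by norm_num]
        exact ENNReal.mul_div_cancel (by simp) (by simp)

end Density

/-! ### Energy localisation, Grönwall's lemma and differences of Itô integrals -/

section Uniqueness

/-- The energy accumulated while the running energy does not exceed `c` is at most `c`. -/
theorem setLIntegral_indicator_pathEnergy_le (t s : ℝ≥0) (f : ℝ≥0 → ℝ) (c : ℝ≥0∞) :
    ∫⁻ r in Set.Icc t s, {r | pathEnergy t r f ≤ c}.indicator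
      (fun r => ENNReal.ofReal (f r ^ 2)) r ∂timeMeasure ≤ min (pathEnergy t s f) c := by
  set J : Set ℝ≥0 := {r | pathEnergy t r f ≤ c} with hJ
  refine le_min (lintegral_mono fun r => Set.indicator_le_self _ _ _) ?_
  refine (lintegral_indicator_le _ _).trans ?_
  rw [Measure.restrict_restrict' measurableSet_Icc]
  rcases (J ∩ Set.Icc t s).eq_empty_or_nonempty with he | hne
  · rw [he]; simp
  have hbdd : BddAbove (J ∩ Set.Icc t s) := ⟨s, fun r hr => hr.2.2⟩
  obtain ⟨u, humono, hulim, hu⟩ := exists_seq_tendsto_sSup hne hbdd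
  -- The set `J ∩ [t, s]` is exhausted by intervals `[t, u n]` with `u n` in `J`, up to its
  -- supremum, which is a null set. No continuity of the running energy is required.
  have hcov : J ∩ Set.Icc t s ⊆ (⋃ n, Set.Icc t (u n)) ∪ {sSup (J ∩ Set.Icc t s)} := by
    intro r hr
    rcases (le_csSup hbdd hr).lt_or_eq with hlt | heq
    · obtain ⟨n, hn⟩ := (hulim.eventually (lt_mem_nhds hlt)).exists
      exact Or.inl (Set.mem_iUnion.2 ⟨n, hr.2.1, hn.le⟩)
    · exact Or.inr heq
  refine (lintegral_mono_set hcov).trans ((lintegral_union_le _ _ _).trans ?_)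
  rw [setLIntegral_measure_zero {sSup (J ∩ Set.Icc t s)} _ (measure_singleton _), add_zero,
    setLIntegral_iUnion_of_directed]
  · exact iSup_le fun n => (hu n).1
  · exact (show Monotone fun n => Set.Icc t (u n) from
      fun i j hij => Set.Icc_subset_Icc_right (humono hij)).directed_le

/-- A Grönwall lemma for bounded functions. -/
theorem eq_zero_of_le_mul_setLIntegral {t T : ℝ≥0} {φ : ℝ≥0 → ℝ≥0∞} {M K : ℝ≥0∞} (hM : M ≠ ∞)
    (hK : K ≠ ∞) (hφM : ∀ s ∈ Set.Icc t T, φ s ≤ M)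
    (hφ : ∀ s ∈ Set.Icc t T, φ s ≤ K * ∫⁻ r in Set.Icc t s, φ r ∂timeMeasure) :
    ∀ s ∈ Set.Icc t T, φ s = 0 := by
  -- With this rate `K/a ≤ 1/2`, so the weighted supremum `m` of `φ` satisfies `m ≤ m/2`; being
  -- finite, it is zero.
  set a : ℝ := 2 * (K.toReal + 1) with ha
  have ha0 : 0 < a := by positivity
  set w : ℝ≥0 → ℝ≥0∞ := fun s => ENNReal.ofReal (Real.exp (a * s)) with hw
  have hw0 : ∀ s, w s ≠ 0 := fun s => by simp [hw, Real.exp_pos]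
  have hwt : ∀ s, w s ≠ ∞ := fun s => ENNReal.ofReal_ne_top
  set m : ℝ≥0∞ := ⨆ s ∈ Set.Icc t T, (w s)⁻¹ * φ s with hm
  have hmM : m ≠ ∞ := by
    refine ne_top_of_le_ne_top hM (iSup₂_le fun s hs => ?_)
    have h1 : (w s)⁻¹ ≤ 1 := by
      rw [ENNReal.inv_le_one]
      simp only [hw]
      rw [ENNReal.one_le_ofReal]
      exact Real.one_le_exp (by positivity)
    calc (w s)⁻¹ * φ s ≤ 1 * M := by gcongr; exact hφM s hs
      _ = M := one_mul M
  have hφm : ∀ s ∈ Set.Icc t T, φ s ≤ m * w s := by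
    intro s hs
    have h : (w s)⁻¹ * φ s ≤ m := le_iSup₂ (f := fun s _ => (w s)⁻¹ * φ s) s hs
    calc φ s = w s * ((w s)⁻¹ * φ s) := by
          rw [← mul_assoc, ENNReal.mul_inv_cancel (hw0 s) (hwt s), one_mul]
      _ ≤ w s * m := by gcongr
      _ = m * w s := mul_comm _ _
  have hstep : ∀ s ∈ Set.Icc t T, (w s)⁻¹ * φ s ≤ m / 2 := by
    intro s hs
    have h1 : ∫⁻ r in Set.Icc t s, φ r ∂timeMeasure ≤ m * ENNReal.ofReal (a⁻¹ * Real.exp (a * s)) := by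
      refine le_trans ?_ (mul_le_mul_right (setLIntegral_exp_le t s ha0) m)
      rw [← lintegral_const_mul' _ _ hmM]
      exact setLIntegral_mono' measurableSet_Icc fun r hr => hφm r ⟨hr.1, hr.2.trans hs.2⟩
    rw [ENNReal.ofReal_mul (by positivity)] at h1
    have hKa : K * ENNReal.ofReal a⁻¹ ≤ 2⁻¹ := by
      rw [← ENNReal.ofReal_toReal hK, ← ENNReal.ofReal_mul ENNReal.toReal_nonneg,
        show (2⁻¹ : ℝ≥0∞) = ENNReal.ofReal 2⁻¹ by
          rw [ENNReal.ofReal_inv_of_pos two_pos]; simp]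
      refine ENNReal.ofReal_le_ofReal ?_
      rw [ha, mul_inv, ← mul_assoc, mul_comm K.toReal, mul_assoc]
      have : K.toReal * (K.toReal + 1)⁻¹ ≤ 1 := by
        rw [← div_eq_mul_inv, div_le_one (by positivity)]; linarith
      linarith
    calc (w s)⁻¹ * φ s ≤ (w s)⁻¹ * (K * (m * (ENNReal.ofReal a⁻¹ * w s))) := by
          gcongr
          exact (hφ s hs).trans (by gcongr)
      _ = (K * ENNReal.ofReal a⁻¹) * m * ((w s)⁻¹ * w s) := by ring
      _ ≤ 2⁻¹ * m * 1 := by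
          rw [ENNReal.inv_mul_cancel (hw0 s) (hwt s)]; gcongr
      _ = m / 2 := by rw [mul_one, mul_comm, div_eq_mul_inv]
  have hm0 : m = 0 := by
    by_contra h
    exact absurd (iSup₂_le hstep : m ≤ m / 2) (not_le.2 (ENNReal.half_lt_self h hmM))
  intro s hs
  have := hφm s hs
  rw [hm0, zero_mul] at this
  exact le_antisymm this zero_le

variable {Ω : Type*} {mΩ : MeasurableSpace Ω} {F : Filtration ℝ≥0 mΩ} {t T : ℝ≥0}

/-- Capping time at `T` makes the events that the running energy is at most `c` decreasing and
jointly measurable on the whole time axis, the form in which the localised isometry takes them. -/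
theorem IsProgressiveOn.measurable_pathEnergy_min {H : ℝ≥0 → Ω → ℝ}
    (hH : IsProgressiveOn F t T H) (htT : t ≤ T) :
    Measurable fun p : ℝ≥0 × Ω => pathEnergy t (min p.1 T) (fun r => H r p.2) := by
  have h : (fun p : ℝ≥0 × Ω => pathEnergy t (min p.1 T) (fun r => H r p.2)) = fun p =>
      ∫⁻ r, {q : ℝ≥0 × ℝ≥0 × Ω | q.1 ≤ min q.2.1 T}.indicator (fun q =>
        ENNReal.ofReal (((Set.Icc t T).indicator (fun r => H r q.2.2) q.1) ^ 2)) (r, p)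
        ∂timeMeasure := by
    ext p
    rw [pathEnergy, ← lintegral_indicator measurableSet_Icc]
    refine lintegral_congr fun r => ?_
    by_cases h1 : r ≤ min p.1 T
    · rw [Set.indicator_of_mem (s := {q : ℝ≥0 × ℝ≥0 × Ω | q.1 ≤ min q.2.1 T}) h1]
      by_cases h2 : t ≤ r
      · rw [Set.indicator_of_mem (s := Set.Icc t (min p.1 T)) ⟨h2, h1⟩,
          Set.indicator_of_mem (s := Set.Icc t T) ⟨h2, h1.trans (min_le_right _ _)⟩]
      · rw [Set.indicator_of_notMem (fun h => h2 h.1), Set.indicator_of_notMem (fun h => h2 h.1)]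
        simp
    · rw [Set.indicator_of_notMem (s := {q : ℝ≥0 × ℝ≥0 × Ω | q.1 ≤ min q.2.1 T}) h1,
        Set.indicator_of_notMem (fun h => h1 h.2)]
  rw [h]
  refine measurable_lintegral_left (Measurable.indicator ?_ ?_)
  · have h1 : Measurable fun q : ℝ≥0 × ℝ≥0 × Ω => (q.1, q.2.2) := by fun_prop
    exact (((hH.measurable_indicator ⟨htT, le_rfl⟩).comp h1).pow_const 2).ennreal_ofReal
  · exact measurableSet_le measurable_fst (by fun_prop)

theorem antitone_pathEnergy_le (H : ℝ≥0 → Ω → ℝ) (c : ℝ≥0∞) :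
    Antitone fun r : ℝ≥0 => {ω | pathEnergy t (min r T) (fun r => H r ω) ≤ c} :=
  fun _ _ h _ hω => (pathEnergy_mono (min_le_min_right T h) _).trans hω

theorem IsProgressiveOn.measurableSet_pathEnergy_le {H : ℝ≥0 → Ω → ℝ}
    (hH : IsProgressiveOn F t T H) (htT : t ≤ T) (c : ℝ≥0∞) (r : ℝ≥0) (hr : t ≤ r) :
    MeasurableSet[F r] {ω | pathEnergy t (min r T) (fun r => H r ω) ≤ c} :=
  F.mono (min_le_left r T) _
    (hH.measurable_pathEnergy (s := min r T) ⟨le_min hr htT, min_le_right _ _⟩ measurableSet_Iic)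

variable {P : Measure Ω} {W : ℝ≥0 → Ω → ℝ}

/-- Borel–Cantelli along a subsequence: the `j`-th chosen process has both errors below `2^{-j}`
outside an event of probability at most `2 · 2^{-j}`. -/
theorem IsItoIntegral.exists_seq {H Y : ℝ≥0 → Ω → ℝ} (h : IsItoIntegral F P W t T H Y) :
    ∃ G : ℕ → SimpleProcess F t, ∀ᵐ ω ∂P,
      Tendsto (fun k => pathEnergy t T (fun r => (G k).val r ω - H r ω)) atTop (𝓝 0) ∧
      ∀ s ∈ Set.Icc t T, Tendsto (fun k => (G k).integral W s ω) atTop (𝓝 (Y s ω)) := by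
  obtain ⟨G, hG1, hG2⟩ := h.approx
  have hpos : ∀ j : ℕ, (0 : ℝ) < (1 / 2) ^ j := fun j => by positivity
  have hpos' : ∀ j : ℕ, (0 : ℝ≥0∞) < (1 / 2) ^ j := fun j => ENNReal.pow_pos (by simp) j
  have hk : ∀ j : ℕ, ∃ k, P ({ω | (1 / 2) ^ j ≤ pathEnergy t T (fun r => (G k).val r ω - H r ω)} ∪
      {ω | ∃ s ∈ Set.Icc t T, (1 / 2) ^ j ≤ |(G k).integral W s ω - Y s ω|}) ≤
      (1 / 2) ^ j + (1 / 2) ^ j := by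
    intro j
    have e1 := (hG1 _ (hpos' j)).eventually (eventually_le_nhds (hpos' j))
    have e2 := (hG2 _ (hpos j)).eventually (eventually_le_nhds (hpos' j))
    obtain ⟨k, h1, h2⟩ := (e1.and e2).exists
    exact ⟨k, (measure_union_le _ _).trans (add_le_add h1 h2)⟩
  choose k hk using hk
  refine ⟨fun j => G (k j), ?_⟩
  have hsum : ∑' j, P ({ω | (1 / 2) ^ j ≤ pathEnergy t T (fun r => (G (k j)).val r ω - H r ω)} ∪
      {ω | ∃ s ∈ Set.Icc t T, (1 / 2) ^ j ≤ |(G (k j)).integral W s ω - Y s ω|}) ≠ ∞ := by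
    refine ne_top_of_le_ne_top ?_ (ENNReal.tsum_le_tsum hk)
    rw [ENNReal.tsum_add, ENNReal.tsum_geometric]
    simp
  filter_upwards [ae_eventually_notMem hsum] with ω hω
  constructor
  · refine tendsto_of_tendsto_of_tendsto_of_le_of_le' tendsto_const_nhds
      (ENNReal.tendsto_pow_atTop_nhds_zero_of_lt_one (r := 1 / 2) (by simp))
      (Eventually.of_forall fun _ => zero_le) ?_
    filter_upwards [hω] with j hj
    exact (not_le.1 fun hc => hj (Or.inl hc)).le
  · intro s hs
    rw [tendsto_iff_norm_sub_tendsto_zero]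
    refine tendsto_of_tendsto_of_tendsto_of_le_of_le' tendsto_const_nhds
      (tendsto_pow_atTop_nhds_zero_of_lt_one (r := (1 / 2 : ℝ)) (by norm_num) (by norm_num))
      (Eventually.of_forall fun _ => norm_nonneg _) ?_
    filter_upwards [hω] with j hj
    exact (not_le.1 fun hc => hj (Or.inr ⟨s, hs, hc⟩)).le

variable [IsProbabilityMeasure P]

/-- A localised isometry inequality for the difference of two Itô integrals. -/
theorem IsItoIntegral.setLIntegral_sub_sq_le (hW : IsBrownianFor F P W) (htT : t ≤ T)
    {H H' Y Y' : ℝ≥0 → Ω → ℝ} (hH : IsProgressiveOn F t T H) (hH' : IsProgressiveOn F t T H')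
    (hY : IsItoIntegral F P W t T H Y) (hY' : IsItoIntegral F P W t T H' Y')
    {A : ℝ≥0 → Set Ω} (hA : ∀ s, t ≤ s → MeasurableSet[F s] (A s)) (hanti : Antitone A)
    (hjoint : MeasurableSet {p : ℝ≥0 × Ω | p.2 ∈ A p.1}) {s : ℝ≥0} (hs : s ∈ Set.Icc t T) :
    ∫⁻ ω in A s, ENNReal.ofReal ((Y s ω - Y' s ω) ^ 2) ∂P ≤
      2 * ∫⁻ ω, ∫⁻ r in Set.Icc t s,
        (A r).indicator (fun ω => ENNReal.ofReal ((H r ω - H' r ω) ^ 2)) ω ∂timeMeasure ∂P := by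
  obtain ⟨G, hG⟩ := hY.exists_seq
  obtain ⟨G', hG'⟩ := hY'.exists_seq
  have hTm : T ∈ Set.Icc t T := ⟨htT, le_rfl⟩
  set D : ℕ → StepFamily F t := fun k => (G k).toStepFamily.sub (G' k).toStepFamily with hD
  have hDv : ∀ k r ω, (D k).val r ω = (G k).val r ω - (G' k).val r ω := fun k r ω => by
    rw [hD, StepFamily.sub_val, SimpleProcess.toStepFamily_val, SimpleProcess.toStepFamily_val]
  have hDi : ∀ k r ω, (D k).integral W r ω = (G k).integral W r ω - (G' k).integral W r ω :=
    fun k r ω => by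
      rw [hD, StepFamily.sub_integral, SimpleProcess.toStepFamily_integral,
        SimpleProcess.toStepFamily_integral]
  set f : ℕ → ℝ≥0 → Ω → ℝ := fun k r ω => (D k).val r ω - (H r ω - H' r ω) with hf
  have hfp : ∀ k, IsProgressiveOn F t T (f k) := fun k =>
    ((D k).isProgressiveOn_val T).sub (hH.sub hH')
  -- The approximation error `f k` is localised as well. Its energy tends to zero only almost
  -- surely, but on these events it contributes at most `min(energy, 1)`, whose mean tends to zero
  -- by dominated convergence.
  set E : ℕ → ℝ≥0 → Set Ω := fun k r => {ω | pathEnergy t (min r T) (fun r => f k r ω) ≤ 1} with hE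
  set Ak : ℕ → ℝ≥0 → Set Ω := fun k r => A r ∩ E k r with hAk
  have hAkm : ∀ k r, t ≤ r → MeasurableSet[F r] (Ak k r) := fun k r hr =>
    (hA r hr).inter ((hfp k).measurableSet_pathEnergy_le htT 1 r hr)
  have hbound : ∀ k, ∫⁻ ω in Ak k s, ENNReal.ofReal ((D k).integral W s ω ^ 2) ∂P ≤
      2 * ∫⁻ ω, ∫⁻ r in Set.Icc t s,
        (A r).indicator (fun ω => ENNReal.ofReal ((H r ω - H' r ω) ^ 2)) ω ∂timeMeasure ∂P +
      2 * ∫⁻ ω, min (pathEnergy t T (fun r => f k r ω)) 1 ∂P := by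
    intro k
    refine ((D k).setLIntegral_integral_sq_le hW (hAkm k)
      (fun i j hij => Set.inter_subset_inter (hanti hij)
        (antitone_pathEnergy_le (T := T) (t := t) (f k) 1 hij))
      (hjoint.inter (measurableSet_le ((hfp k).measurable_pathEnergy_min htT)
        measurable_const)) hs.1).trans ?_
    have hmin : Measurable fun ω => 2 * min (pathEnergy t T (fun r => f k r ω)) 1 :=
      ((((hfp k).measurable_pathEnergy hTm).mono (F.le T) le_rfl).min measurable_const).const_mul _
    rw [← lintegral_const_mul' 2 _ (by simp), ← lintegral_const_mul' 2 _ (by simp),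
      ← lintegral_add_right _ hmin]
    refine lintegral_mono fun ω => ?_
    have hJ := setLIntegral_indicator_pathEnergy_le t s (fun r => f k r ω) 1
    set J : Set ℝ≥0 := {r | pathEnergy t r (fun r => f k r ω) ≤ 1} with hJdef
    have hJm : MeasurableSet J := by
      refine Set.OrdConnected.measurableSet ⟨fun a _ b hb c hc => ?_⟩
      exact (pathEnergy_mono hc.2 _).trans hb
    have hjm : AEMeasurable (fun r => 2 * J.indicator (fun r => ENNReal.ofReal (f k r ω ^ 2)) r)
        (timeMeasure.restrict (Set.Icc t s)) :=
      ((((hfp k).aemeasurable hs ω).pow_const 2).ennreal_ofReal.indicator hJm).const_mul _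
    calc ∫⁻ r in Set.Icc t s, (Ak k r).indicator
          (fun ω => ENNReal.ofReal ((D k).val r ω ^ 2)) ω ∂timeMeasure
        ≤ ∫⁻ r in Set.Icc t s, (2 * (A r).indicator
            (fun ω => ENNReal.ofReal ((H r ω - H' r ω) ^ 2)) ω +
            2 * J.indicator (fun r => ENNReal.ofReal (f k r ω ^ 2)) r) ∂timeMeasure := by
          refine setLIntegral_mono' measurableSet_Icc fun r hr => ?_
          by_cases hω : ω ∈ Ak k r
          · have hrT : min r T = r := min_eq_left (hr.2.trans hs.2)
            have hrJ : r ∈ J := by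
              have := hω.2
              simp only [hE, hrT] at this
              exact this
            rw [Set.indicator_of_mem hω, Set.indicator_of_mem hω.1, Set.indicator_of_mem hrJ]
            refine le_trans (le_of_eq ?_) (ofReal_add_sq_le _ _)
            congr 2
            simp only [hf]; ring
          · rw [Set.indicator_of_notMem hω]; exact zero_le
      _ = 2 * ∫⁻ r in Set.Icc t s, (A r).indicator
            (fun ω => ENNReal.ofReal ((H r ω - H' r ω) ^ 2)) ω ∂timeMeasure +
          2 * ∫⁻ r in Set.Icc t s, J.indicator (fun r => ENNReal.ofReal (f k r ω ^ 2)) r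
            ∂timeMeasure := by
          rw [lintegral_add_right' _ hjm, lintegral_const_mul' _ _ (by simp),
            lintegral_const_mul' _ _ (by simp)]
      _ ≤ _ := by
          gcongr
          exact hJ.trans (min_le_min_right _ (pathEnergy_mono hs.2 _))
  have hflim : ∀ᵐ ω ∂P, Tendsto (fun k => pathEnergy t T (fun r => f k r ω)) atTop (𝓝 0) := by
    filter_upwards [hG, hG'] with ω h1 h2
    have hlim : Tendsto (fun k => 2 * pathEnergy t T (fun r => (G k).val r ω - H r ω) +
        2 * pathEnergy t T (fun r => (G' k).val r ω - H' r ω)) atTop (𝓝 (2 * 0 + 2 * 0)) :=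
      (ENNReal.Tendsto.const_mul h1.1 (Or.inr (by simp))).add
        (ENNReal.Tendsto.const_mul h2.1 (Or.inr (by simp)))
    rw [mul_zero, add_zero] at hlim
    refine tendsto_of_tendsto_of_tendsto_of_le_of_le tendsto_const_nhds hlim
      (fun _ => zero_le) fun k => ?_
    have hm := (((G k).isProgressiveOn_val T).sub hH).aemeasurable hTm ω
    refine (pathEnergy_le_add (k := fun r => -((G' k).val r ω - H' r ω)) hm fun r _ => ?_).trans ?_
    · simp only [hf, hDv]; ring
    · simp only [pathEnergy, neg_sq]; exact le_rfl
  have hlim0 : Tendsto (fun k => ∫⁻ ω, min (pathEnergy t T (fun r => f k r ω)) 1 ∂P) atTop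
      (𝓝 0) := by
    have h0 : ∫⁻ _, (0 : ℝ≥0∞) ∂P = 0 := lintegral_zero
    rw [← h0]
    refine tendsto_lintegral_of_dominated_convergence (fun _ => 1)
      (fun k => (((hfp k).measurable_pathEnergy hTm).mono (F.le T) le_rfl).min measurable_const)
      (fun k => ae_of_all _ fun ω => min_le_right _ _) (by simp) ?_
    filter_upwards [hflim] with ω hω
    have := hω.min (tendsto_const_nhds (x := (1 : ℝ≥0∞)))
    simpa using this
  -- Almost surely the energy of `f k` is eventually at most `1`, so a point of `A s` eventually
  -- stays in `Ak k s`; the extra localisation is lost in the limit and Fatou's lemma applies.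
  have hfatou : ∫⁻ ω in A s, ENNReal.ofReal ((Y s ω - Y' s ω) ^ 2) ∂P ≤
      liminf (fun k => ∫⁻ ω in Ak k s, ENNReal.ofReal ((D k).integral W s ω ^ 2) ∂P) atTop := by
    have hAms : MeasurableSet (A s) := F.le s _ (hA s hs.1)
    have hAkms : ∀ k, MeasurableSet (Ak k s) := fun k => F.le s _ (hAkm k s hs.1)
    simp_rw [← lintegral_indicator hAms, ← lintegral_indicator (hAkms _)]
    refine le_trans ?_ (lintegral_liminf_le fun k => ?_)
    · refine lintegral_mono_ae ?_
      filter_upwards [hG, hG', hflim] with ω h1 h2 h3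
      by_cases hω : ω ∈ A s
      · refine le_of_eq (Tendsto.liminf_eq ?_).symm
        rw [Set.indicator_of_mem hω]
        have hl : Tendsto (fun k => ENNReal.ofReal ((D k).integral W s ω ^ 2)) atTop
            (𝓝 (ENNReal.ofReal ((Y s ω - Y' s ω) ^ 2))) := by
          refine ENNReal.tendsto_ofReal (Tendsto.pow ?_ 2)
          simp_rw [hDi]
          exact (h1.2 s hs).sub (h2.2 s hs)
        refine hl.congr' ?_
        filter_upwards [h3.eventually (eventually_le_nhds one_pos)] with k hk
        have hmem : ω ∈ Ak k s := ⟨hω, (pathEnergy_mono (min_le_right _ _) _).trans hk⟩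
        rw [Set.indicator_of_mem hmem]
      · rw [Set.indicator_of_notMem hω]; exact zero_le
    · refine Measurable.indicator (Measurable.ennreal_ofReal (Measurable.pow_const ?_ 2)) (hAkms k)
      exact ((D k).measurable_integral hW.adapted s).mono (F.le s) le_rfl
  refine hfatou.trans ((liminf_le_liminf (Eventually.of_forall hbound)).trans (le_of_eq ?_))
  refine Tendsto.liminf_eq ?_
  have h2 := ENNReal.Tendsto.const_mul hlim0 (a := 2) (Or.inr (by simp))
  rw [mul_zero] at h2
  simpa using h2.const_add _

end Uniqueness

/-! ### Pathwise uniqueness -/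

section Uniqueness

variable {Ω : Type*} {mΩ : MeasurableSpace Ω} {F : Filtration ℝ≥0 mΩ} {t T : ℝ≥0}
  {P : Measure Ω} {W : ℝ≥0 → Ω → ℝ}

theorem pathEnergy_lt_top_of_continuousOn {f : ℝ≥0 → ℝ} (hf : ContinuousOn f (Set.Icc t T)) :
    pathEnergy t T f < ∞ := by
  obtain ⟨C, hC⟩ := (isCompact_Icc.image_of_continuousOn hf.abs).bddAbove
  refine (pathEnergy_const_le (C := C) fun r hr => hC ⟨r, hr, rfl⟩).trans_lt ?_
  exact ENNReal.mul_lt_top ENNReal.ofReal_lt_top ENNReal.ofReal_lt_top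

theorem sq_setIntegral_Icc_le {s : ℝ≥0} (hs : s ≤ T) {f : ℝ≥0 → ℝ}
    (hf : AEMeasurable f (timeMeasure.restrict (Set.Icc t s))) :
    ENNReal.ofReal ((∫ r in Set.Icc t s, f r ∂timeMeasure) ^ 2) ≤
      ENNReal.ofReal (T - t) * pathEnergy t s f := by
  refine (sq_setIntegral_le f hf).trans ?_
  rw [Measure.restrict_apply_univ, timeMeasure_Icc]
  exact mul_le_mul_left (ENNReal.ofReal_le_ofReal (sub_le_sub_right (by exact_mod_cast hs) _)) _

variable [IsProbabilityMeasure P]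

/-- Pathwise uniqueness for stochastic differential equations with Lipschitz coefficients. -/
theorem IsStrongSolution.ae_eq (hW : IsBrownianFor F P W) (htT : t ≤ T) {B S : ℝ≥0 → ℝ → ℝ}
    (hBm : Measurable fun p : ℝ≥0 × ℝ => B p.1 p.2)
    (hSm : Measurable fun p : ℝ≥0 × ℝ => S p.1 p.2) {C : ℝ}
    (hB : ∀ r ∈ Set.Icc t T, ∀ y z, |B r y - B r z| ≤ C * |y - z|)
    (hS : ∀ r ∈ Set.Icc t T, ∀ y z, |S r y - S r z| ≤ C * |y - z|) {x : ℝ}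
    {X X' : ℝ≥0 → Ω → ℝ} (hX : IsStrongSolution F P W t T x B S X)
    (hX' : IsStrongSolution F P W t T x B S X') :
    ∀ᵐ ω ∂P, ∀ s ∈ Set.Icc t T, X s ω = X' s ω := by
  have hTm : T ∈ Set.Icc t T := ⟨htT, le_rfl⟩
  obtain ⟨Y, hY, hXeq⟩ := hX.equation
  obtain ⟨Y', hY', hXeq'⟩ := hX'.equation
  have hXp := isProgressiveOn_of_continuousOn hX.adapted hX.continuous
  have hXp' := isProgressiveOn_of_continuousOn hX'.adapted hX'.continuous
  have hHp : IsProgressiveOn F t T fun s ω => S s (X s ω) := hXp.comp hSm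
  have hHp' : IsProgressiveOn F t T fun s ω => S s (X' s ω) := hXp'.comp hSm
  have hBp : IsProgressiveOn F t T fun s ω => B s (X s ω) - B s (X' s ω) :=
    (hXp.comp hBm).sub (hXp'.comp hBm)
  set Z : ℝ≥0 → Ω → ℝ := fun s ω => X s ω - X' s ω with hZ
  have hZp : IsProgressiveOn F t T Z := hXp.sub hXp'
  -- Solutions come without moment bounds, so the difference is observed only while its running
  -- energy is at most `n`.
  set A : ℕ → ℝ≥0 → Set Ω := fun n r => {ω | pathEnergy t (min r T) (fun r => Z r ω) ≤ n} with hA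
  have hAF : ∀ n s, t ≤ s → MeasurableSet[F s] (A n s) := fun n s hs =>
    hZp.measurableSet_pathEnergy_le htT n s hs
  have hAanti : ∀ n, Antitone (A n) := fun n => antitone_pathEnergy_le (t := t) (T := T) Z n
  have hAj : ∀ n, MeasurableSet {p : ℝ≥0 × Ω | p.2 ∈ A n p.1} := fun n =>
    measurableSet_le (hZp.measurable_pathEnergy_min htT) measurable_const
  have hAm : ∀ n s, t ≤ s → MeasurableSet (A n s) := fun n s hs => F.le s _ (hAF n s hs)
  set φ : ℕ → ℝ≥0 → ℝ≥0∞ := fun n s => ∫⁻ ω in A n s, ENNReal.ofReal (Z s ω ^ 2) ∂P with hφ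
  have hswap : ∀ n, ∀ s ∈ Set.Icc t T, ∫⁻ ω, ∫⁻ r in Set.Icc t s,
      (A n r).indicator (fun ω => ENNReal.ofReal (Z r ω ^ 2)) ω ∂timeMeasure ∂P =
      ∫⁻ r in Set.Icc t s, φ n r ∂timeMeasure := by
    intro n s hs
    have h1 : ∀ ω, ∫⁻ r in Set.Icc t s,
        (A n r).indicator (fun ω => ENNReal.ofReal (Z r ω ^ 2)) ω ∂timeMeasure =
        ∫⁻ r in Set.Icc t s, {p : ℝ≥0 × Ω | p.2 ∈ A n p.1}.indicator (fun p =>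
          ENNReal.ofReal ((Set.Icc t T).indicator (fun r => Z r p.2) p.1 ^ 2)) (r, ω)
          ∂timeMeasure := by
      intro ω
      refine setLIntegral_congr_fun measurableSet_Icc fun r hr => ?_
      have hr' : r ∈ Set.Icc t T := ⟨hr.1, hr.2.trans hs.2⟩
      by_cases hω : ω ∈ A n r
      · rw [Set.indicator_of_mem hω, Set.indicator_of_mem (by exact hω),
          Set.indicator_of_mem hr']
      · rw [Set.indicator_of_notMem hω, Set.indicator_of_notMem (by exact hω)]
    have hm : Measurable fun p : Ω × ℝ≥0 => {p : ℝ≥0 × Ω | p.2 ∈ A n p.1}.indicator (fun p =>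
          ENNReal.ofReal ((Set.Icc t T).indicator (fun r => Z r p.2) p.1 ^ 2)) (p.2, p.1) :=
      ((((hZp.measurable_indicator hTm).pow_const 2).ennreal_ofReal).indicator (hAj n)).comp
        measurable_swap
    simp_rw [h1]
    rw [lintegral_lintegral_swap hm.aemeasurable]
    refine setLIntegral_congr_fun measurableSet_Icc fun r hr => ?_
    have hr' : r ∈ Set.Icc t T := ⟨hr.1, hr.2.trans hs.2⟩
    simp only [hφ]
    rw [← lintegral_indicator (hAm n r hr.1)]
    refine lintegral_congr fun ω => ?_
    by_cases hω : ω ∈ A n r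
    · rw [Set.indicator_of_mem hω, Set.indicator_of_mem (by exact hω), Set.indicator_of_mem hr']
    · rw [Set.indicator_of_notMem hω, Set.indicator_of_notMem (by exact hω)]
  have hpath : ∀ n, ∀ s ∈ Set.Icc t T, ∀ ω, ∫⁻ r in Set.Icc t s,
      (A n r).indicator (fun ω => ENNReal.ofReal (Z r ω ^ 2)) ω ∂timeMeasure ≤ n := by
    intro n s hs ω
    refine le_trans ?_ ((setLIntegral_indicator_pathEnergy_le t s (fun r => Z r ω) n).trans
      (min_le_right _ _))
    refine setLIntegral_mono' measurableSet_Icc fun r hr => ?_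
    by_cases hω : ω ∈ A n r
    · rw [Set.indicator_of_mem hω, Set.indicator_of_mem]
      have := hω
      simp only [hA, Set.mem_ofPred_eq, min_eq_left (hr.2.trans hs.2)] at this
      exact this
    · rw [Set.indicator_of_notMem hω]; exact zero_le
  -- The drift contributes `2 (T - t) C²` by Cauchy–Schwarz, and the stochastic integral `2 · 2 C²`,
  -- one factor `2` coming from the localised isometry.
  set K : ℝ≥0∞ := 2 * (ENNReal.ofReal (T - t) * ENNReal.ofReal (C ^ 2)) +
    2 * (2 * ENNReal.ofReal (C ^ 2)) with hK
  have hKt : K ≠ ∞ := by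
    simp only [hK]
    exact ENNReal.add_ne_top.2 ⟨ENNReal.mul_ne_top (by simp)
      (ENNReal.mul_ne_top ENNReal.ofReal_ne_top ENNReal.ofReal_ne_top),
      ENNReal.mul_ne_top (by simp) (ENNReal.mul_ne_top (by simp) ENNReal.ofReal_ne_top)⟩
  have hgron : ∀ n, ∀ s ∈ Set.Icc t T, φ n s ≤ K * ∫⁻ r in Set.Icc t s, φ n r ∂timeMeasure := by
    intro n s hs
    rw [← hswap n s hs]
    set Ψ := ∫⁻ ω, ∫⁻ r in Set.Icc t s,
      (A n r).indicator (fun ω => ENNReal.ofReal (Z r ω ^ 2)) ω ∂timeMeasure ∂P with hΨ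
    have hBps := hBp.aemeasurable hs
    have h1 : φ n s ≤ ∫⁻ ω in A n s, (2 * ENNReal.ofReal
        ((∫ r in Set.Icc t s, (B r (X r ω) - B r (X' r ω)) ∂timeMeasure) ^ 2) +
        2 * ENNReal.ofReal ((Y s ω - Y' s ω) ^ 2)) ∂P := by
      refine lintegral_mono_ae (ae_restrict_of_ae ?_)
      filter_upwards [hXeq, hXeq', hX.drift_integrable, hX'.drift_integrable] with ω e1 e2 i1 i2
      refine le_trans (le_of_eq ?_) (ofReal_add_sq_le _ _)
      congr 2
      rw [integral_sub (i1.mono_set (Set.Icc_subset_Icc_right hs.2))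
        (i2.mono_set (Set.Icc_subset_Icc_right hs.2))]
      simp only [hZ, e1 s hs, e2 s hs]; ring
    have hIm : Measurable fun ω => 2 * ENNReal.ofReal
        ((∫ r in Set.Icc t s, (B r (X r ω) - B r (X' r ω)) ∂timeMeasure) ^ 2) :=
      ((((hBp.measurable_integral hs).mono (F.le s) le_rfl).pow_const 2).ennreal_ofReal).const_mul _
    rw [lintegral_add_left hIm, lintegral_const_mul' _ _ (by simp),
      lintegral_const_mul' _ _ (by simp)] at h1
    have hlip : ∀ {B : ℝ≥0 → ℝ → ℝ}, (∀ r ∈ Set.Icc t T, ∀ y z, |B r y - B r z| ≤ C * |y - z|) →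
        ∀ ω r, r ∈ Set.Icc t s → ENNReal.ofReal ((B r (X r ω) - B r (X' r ω)) ^ 2) ≤
          ENNReal.ofReal (C ^ 2) * ENNReal.ofReal (Z r ω ^ 2) := by
      intro B hB ω r hr
      rw [← ENNReal.ofReal_mul (sq_nonneg _)]
      refine ENNReal.ofReal_le_ofReal ?_
      rw [← sq_abs (B r (X r ω) - B r (X' r ω)), ← sq_abs (Z r ω), ← mul_pow]
      exact pow_le_pow_left₀ (abs_nonneg _) (hB r ⟨hr.1, hr.2.trans hs.2⟩ _ _) 2
    have h2 : ∫⁻ ω in A n s, ENNReal.ofReal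
        ((∫ r in Set.Icc t s, (B r (X r ω) - B r (X' r ω)) ∂timeMeasure) ^ 2) ∂P ≤
        ENNReal.ofReal (T - t) * ENNReal.ofReal (C ^ 2) * Ψ := by
      rw [hΨ, ← lintegral_const_mul' _ _
        (ENNReal.mul_ne_top ENNReal.ofReal_ne_top ENNReal.ofReal_ne_top),
        ← lintegral_indicator (hAm n s hs.1)]
      refine lintegral_mono fun ω => ?_
      by_cases hω : ω ∈ A n s
      · rw [Set.indicator_of_mem hω]
        refine (sq_setIntegral_Icc_le hs.2 (hBps ω)).trans ?_
        rw [mul_assoc, pathEnergy,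
          ← lintegral_const_mul' (ENNReal.ofReal (C ^ 2)) _ ENNReal.ofReal_ne_top]
        refine mul_le_mul_right ?_ _
        refine setLIntegral_mono' measurableSet_Icc fun r hr => ?_
        have hmem : ω ∈ A n r := hAanti n hr.2 hω
        rw [Set.indicator_of_mem hmem]
        exact hlip hB ω r hr
      · rw [Set.indicator_of_notMem hω]; exact zero_le
    have h3 : ∫⁻ ω in A n s, ENNReal.ofReal ((Y s ω - Y' s ω) ^ 2) ∂P ≤
        2 * (ENNReal.ofReal (C ^ 2) * Ψ) := by
      refine (IsItoIntegral.setLIntegral_sub_sq_le hW htT hHp hHp' hY hY' (hAF n) (hAanti n)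
        (hAj n) hs).trans ?_
      refine mul_le_mul_right ?_ 2
      rw [hΨ, ← lintegral_const_mul' _ _ ENNReal.ofReal_ne_top]
      refine lintegral_mono fun ω => ?_
      rw [← lintegral_const_mul' _ _ ENNReal.ofReal_ne_top]
      refine setLIntegral_mono' measurableSet_Icc fun r hr => ?_
      by_cases hω : ω ∈ A n r
      · rw [Set.indicator_of_mem hω, Set.indicator_of_mem hω]
        exact hlip hS ω r hr
      · rw [Set.indicator_of_notMem hω]; exact zero_le
    calc φ n s ≤ _ := h1
      _ ≤ 2 * (ENNReal.ofReal (T - t) * ENNReal.ofReal (C ^ 2) * Ψ) +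
          2 * (2 * (ENNReal.ofReal (C ^ 2) * Ψ)) := by gcongr
      _ = K * Ψ := by rw [hK]; ring
  have hφ0 : ∀ n, ∀ s ∈ Set.Icc t T, φ n s = 0 := by
    intro n
    -- The a priori bound needed for Grönwall comes from the inequality itself: pathwise, the
    -- localised energy is at most `n`.
    refine eq_zero_of_le_mul_setLIntegral (M := K * n) (ENNReal.mul_ne_top hKt (by simp)) hKt
      (fun s hs => ?_) (hgron n)
    refine (hgron n s hs).trans (mul_le_mul_right ?_ _)
    rw [← hswap n s hs]
    calc _ ≤ ∫⁻ _, (n : ℝ≥0∞) ∂P := lintegral_mono fun ω => hpath n s hs ω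
      _ = n := by simp
  have hpt : ∀ s ∈ Set.Icc t T, ∀ᵐ ω ∂P, X s ω = X' s ω := by
    intro s hs
    have hall : ∀ᵐ ω ∂P, ∀ n : ℕ, ω ∈ A n s → Z s ω = 0 := by
      refine ae_all_iff.2 fun n => ?_
      have hZm : Measurable (Z s) := ((hX.adapted s hs).sub (hX'.adapted s hs)).mono (F.le s) le_rfl
      have h0 := hφ0 n s hs
      simp only [hφ] at h0
      rw [lintegral_eq_zero_iff (hZm.pow_const 2).ennreal_ofReal,
        Filter.EventuallyEq, ae_restrict_iff' (hAm n s hs.1)] at h0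
      filter_upwards [h0] with ω hω hmem
      have := hω hmem
      simp only [Pi.zero_apply, ENNReal.ofReal_eq_zero] at this
      exact pow_eq_zero_iff two_ne_zero |>.1 (le_antisymm this (sq_nonneg _))
    filter_upwards [hall] with ω hω
    have hfin : pathEnergy t T (fun r => Z r ω) < ∞ :=
      pathEnergy_lt_top_of_continuousOn ((hX.continuous ω).sub (hX'.continuous ω))
    obtain ⟨n, hn⟩ := ENNReal.exists_nat_gt hfin.ne
    have := hω n ((pathEnergy_mono (min_le_right _ _) _).trans hn.le)
    exact sub_eq_zero.1 this
  -- Equality at countably many dense times holds simultaneously almost surely, and continuity of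
  -- the paths extends it to `[t, T]`.
  have : Nonempty (Set.Icc t T) := ⟨⟨t, le_rfl, htT⟩⟩
  have hdense : ∀ᵐ ω ∂P, ∀ i : ℕ, X (TopologicalSpace.denseSeq (Set.Icc t T) i) ω =
      X' (TopologicalSpace.denseSeq (Set.Icc t T) i) ω :=
    ae_all_iff.2 fun i => hpt _ (TopologicalSpace.denseSeq (Set.Icc t T) i).2
  filter_upwards [hdense] with ω hω s hs
  have h1 : Continuous fun s : Set.Icc t T => X s ω := (hX.continuous ω).domRestrict
  have h2 : Continuous fun s : Set.Icc t T => X' s ω := (hX'.continuous ω).domRestrict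
  have := (TopologicalSpace.denseRange_denseSeq (Set.Icc t T)).equalizer h1 h2 (funext hω)
  exact congrFun this ⟨s, hs⟩

end Uniqueness

/-! ### Continuous adapted versions and limits -/

section Limit

variable {Ω : Type*} {mΩ : MeasurableSpace Ω} {F : Filtration ℝ≥0 mΩ} {t T : ℝ≥0}
  {P : Measure Ω} {W : ℝ≥0 → Ω → ℝ}

theorem continuous_integral_indicator_Iic {f : ℝ≥0 → ℝ} (hf : Integrable f timeMeasure) :
    Continuous fun s : ℝ≥0 => ∫ r, (Set.Iic s).indicator f r ∂timeMeasure := by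
  refine continuous_iff_continuousAt.2 fun s₀ => ?_
  refine continuousAt_of_dominated (bound := fun r => ‖f r‖)
    (Eventually.of_forall fun s => (hf.indicator measurableSet_Iic).aestronglyMeasurable)
    (Eventually.of_forall fun s => ae_of_all _ fun r => norm_indicator_le_norm_self _ _)
    hf.norm ?_
  have h0 : ∀ᵐ r ∂timeMeasure, r ≠ s₀ := by
    rw [ae_iff]; simp
  filter_upwards [h0] with r hr
  rcases lt_or_gt_of_ne hr with h | h
  · refine (continuousAt_const (y := f r)).congr ?_
    filter_upwards [lt_mem_nhds h] with s hs
    rw [Set.indicator_of_mem (Set.mem_Iic.2 (le_of_lt hs))]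
  · refine (continuousAt_const (y := (0 : ℝ))).congr ?_
    filter_upwards [gt_mem_nhds h] with s hs
    rw [Set.indicator_of_notMem (s := Set.Iic s) (fun h => absurd hs (not_lt.2 h))]

theorem continuousOn_setIntegral_Icc {f : ℝ≥0 → ℝ}
    (hf : IntegrableOn f (Set.Icc t T) timeMeasure) :
    ContinuousOn (fun s => ∫ r in Set.Icc t s, f r ∂timeMeasure) (Set.Icc t T) := by
  refine (continuous_integral_indicator_Iic
    (hf.integrable_indicator measurableSet_Icc)).continuousOn.congr fun s hs => ?_
  rw [← integral_indicator measurableSet_Icc]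
  refine integral_congr_ae (ae_of_all _ fun r => ?_)
  rw [Set.indicator_indicator]
  congr 1
  ext r
  simp only [Set.mem_Icc, Set.mem_inter_iff, Set.mem_Iic]
  exact ⟨fun h => ⟨h.2, h.1, h.2.trans hs.2⟩, fun h => ⟨h.2.1, h.1⟩⟩

theorem integrableOn_of_pathEnergy_lt_top {f : ℝ≥0 → ℝ}
    (hf : AEMeasurable f (timeMeasure.restrict (Set.Icc t T))) (h : pathEnergy t T f < ∞) :
    IntegrableOn f (Set.Icc t T) timeMeasure := by
  have h2 : MemLp f 2 (timeMeasure.restrict (Set.Icc t T)) := by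
    rw [memLp_two_iff_integrable_sq hf.aestronglyMeasurable]
    refine ⟨(hf.pow_const 2).aestronglyMeasurable, ?_⟩
    rw [hasFiniteIntegral_iff_ofReal (ae_of_all _ fun _ => sq_nonneg _)]
    exact h
  exact h2.integrable one_le_two

/-- A Brownian motion has an adapted version all of whose paths are continuous. -/
theorem IsBrownianFor.exists_continuous_version (hW : IsBrownianFor F P W) :
    ∃ W' : ℝ≥0 → Ω → ℝ, (∀ s, Measurable[F s] (W' s)) ∧ (∀ ω, Continuous (W' · ω)) ∧
      ∀ᵐ ω ∂P, ∀ s, W' s ω = W s ω := by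
  -- A measurable null hull of the exceptional set belongs to every `F s` by augmentation, so paths
  -- can be set to zero on it without losing adaptedness.
  set N := toMeasurable P {ω | ¬ Continuous (W · ω)} with hN
  have hN0 : P N = 0 := by rw [hN, measure_toMeasurable]; exact ae_iff.1 hW.cont
  have hNm : ∀ s, MeasurableSet[F s] N :=
    hW.null N (measurableSet_toMeasurable _ _) hN0
  refine ⟨fun s => Nᶜ.indicator (W s), fun s => (hW.adapted s).indicator (hNm s).compl,
    fun ω => ?_, ?_⟩
  · by_cases hω : ω ∈ N
    · have : (fun s => Nᶜ.indicator (W s) ω) = fun _ => 0 := by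
        ext s; exact Set.indicator_of_notMem (s := Nᶜ) (fun h => h hω) _
      rw [this]; exact continuous_const
    · have h1 : (fun s => Nᶜ.indicator (W s) ω) = (W · ω) := by
        ext s; exact Set.indicator_of_mem hω _
      rw [h1]
      by_contra hc
      exact hω (subset_toMeasurable _ _ hc)
  · filter_upwards [measure_eq_zero_iff_ae_notMem.1 hN0] with ω hω s
    exact Set.indicator_of_mem hω _

/-- A sequence of continuous adapted processes with summable probabilities of large increments
converges uniformly to a continuous adapted process. -/
theorem exists_continuous_adapted_limit
    (hnull : ∀ N : Set Ω, MeasurableSet N → P N = 0 → ∀ s, MeasurableSet[F s] N)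
    {X : ℕ → ℝ≥0 → Ω → ℝ} (hXa : ∀ n, ∀ s ∈ Set.Icc t T, Measurable[F s] (X n s))
    (hXc : ∀ n ω, ContinuousOn (fun s => X n s ω) (Set.Icc t T))
    (hsum : ∑' n, P {ω | ∃ s ∈ Set.Icc t T, (1 / 2) ^ n ≤ |X (n + 1) s ω - X n s ω|} ≠ ∞) :
    ∃ Z : ℝ≥0 → Ω → ℝ, (∀ s ∈ Set.Icc t T, Measurable[F s] (Z s)) ∧
      (∀ ω, ContinuousOn (fun s => Z s ω) (Set.Icc t T)) ∧
      (∀ᵐ ω ∂P, ∀ s ∈ Set.Icc t T, Tendsto (fun n => X n s ω) atTop (𝓝 (Z s ω))) ∧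
      ∀ᵐ ω ∂P, ∀ n, (∀ m, n ≤ m → ∀ s ∈ Set.Icc t T, |X (m + 1) s ω - X m s ω| < (1 / 2) ^ m) →
        ∀ s ∈ Set.Icc t T, |X n s ω - Z s ω| ≤ 2 * (1 / 2) ^ n := by
  set E : ℕ → Set Ω := fun n =>
    {ω | ∃ s ∈ Set.Icc t T, (1 / 2) ^ n ≤ |X (n + 1) s ω - X n s ω|} with hE
  set N := toMeasurable P {ω | ¬ ∀ᶠ n in atTop, ω ∉ E n} with hN
  have hN0 : P N = 0 := by
    rw [hN, measure_toMeasurable]; exact ae_iff.1 (ae_eventually_notMem hsum)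
  have hNm : ∀ s, MeasurableSet[F s] N := hnull N (measurableSet_toMeasurable _ _) hN0
  have hgood : ∀ ω ∉ N, ∃ n, ∀ m, n ≤ m → ∀ s ∈ Set.Icc t T,
      |X (m + 1) s ω - X m s ω| < (1 / 2) ^ m := by
    intro ω hω
    have h1 : ∀ᶠ n in atTop, ω ∉ E n := by
      by_contra hc
      exact hω (subset_toMeasurable _ _ hc)
    obtain ⟨n, hn⟩ := eventually_atTop.1 h1
    exact ⟨n, fun m hm s hs => not_le.1 fun hc => hn m hm ⟨s, hs, hc⟩⟩
  have hgeom : ∀ n k : ℕ, (1 / 2 : ℝ) ^ (n + k) = 2 * (1 / 2) ^ n / 2 / 2 ^ k := by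
    intro n k
    rw [pow_add, one_div_pow (a := (2 : ℝ)) k]
    ring
  -- Cutting off on `N` makes the sequence converge for every `ω`, so the limit is adapted, not
  -- merely almost surely equal to an adapted process.
  set V : ℕ → ℝ≥0 → Ω → ℝ := fun n s => Nᶜ.indicator (X n s) with hV
  have hVlim : ∀ s ∈ Set.Icc t T, ∀ ω, ∃ l, Tendsto (fun n => V n s ω) atTop (𝓝 l) := by
    intro s hs ω
    by_cases hω : ω ∈ N
    · refine ⟨0, tendsto_const_nhds.congr fun n => ?_⟩
      exact (Set.indicator_of_notMem (s := Nᶜ) (fun h => h hω) _).symm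
    · obtain ⟨n, hn⟩ := hgood ω hω
      have hc : CauchySeq fun k => X (k + n) s ω := by
        refine cauchySeq_of_le_geometric_two (C := 2 * (1 / 2) ^ n) fun k => ?_
        rw [← hgeom, Real.dist_eq, abs_sub_comm, add_comm n k, add_right_comm]
        exact (hn (k + n) (Nat.le_add_left _ _) s hs).le
      obtain ⟨l, hl⟩ := cauchySeq_tendsto_of_complete hc
      refine ⟨l, ((tendsto_add_atTop_iff_nat (f := fun k => X k s ω) n).1 hl).congr fun k => ?_⟩
      exact (Set.indicator_of_mem (s := Nᶜ) hω _).symm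
  set Z : ℝ≥0 → Ω → ℝ := fun s ω => limUnder atTop fun n => V n s ω with hZ
  have hZlim : ∀ s ∈ Set.Icc t T, ∀ ω, Tendsto (fun n => V n s ω) atTop (𝓝 (Z s ω)) :=
    fun s hs ω => tendsto_nhds_limUnder (hVlim s hs ω)
  have hXlim : ∀ ω ∉ N, ∀ s ∈ Set.Icc t T, Tendsto (fun n => X n s ω) atTop (𝓝 (Z s ω)) :=
    fun ω hω s hs => (hZlim s hs ω).congr fun k => Set.indicator_of_mem (s := Nᶜ) hω _
  -- The bound is the geometric tail `∑_{m ≥ n} 2^{-m}`.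
  have hdist : ∀ ω ∉ N, ∀ n,
      (∀ m, n ≤ m → ∀ s ∈ Set.Icc t T, |X (m + 1) s ω - X m s ω| < (1 / 2) ^ m) →
        ∀ s ∈ Set.Icc t T, |X n s ω - Z s ω| ≤ 2 * (1 / 2) ^ n := by
    intro ω hω n hn s hs
    have h1 : ∀ k, dist (X (n + k) s ω) (X (n + (k + 1)) s ω) ≤ 2 * (1 / 2) ^ n / 2 / 2 ^ k := by
      intro k
      rw [← hgeom, Real.dist_eq, abs_sub_comm, ← add_assoc]
      exact (hn (n + k) (Nat.le_add_right _ _) s hs).le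
    have h2 : Tendsto (fun k => X (n + k) s ω) atTop (𝓝 (Z s ω)) := by
      simp_rw [add_comm n]
      exact (tendsto_add_atTop_iff_nat (f := fun k => X k s ω) n).2 (hXlim ω hω s hs)
    have := dist_le_of_le_geometric_two_of_tendsto₀ h1 h2
    rwa [add_zero, Real.dist_eq] at this
  refine ⟨Z, fun s hs => ?_, fun ω => ?_, ?_, ?_⟩
  · refine @measurable_of_tendsto_metrizable Ω ℝ (F s) _ _ _ _ (fun n => V n s) (Z s)
      (fun n => (hXa n s hs).indicator (hNm s).compl) ?_
    rw [tendsto_pi_nhds]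
    exact hZlim s hs
  · by_cases hω : ω ∈ N
    · refine (continuousOn_const (c := (0 : ℝ))).congr fun s hs => ?_
      refine tendsto_nhds_unique (hZlim s hs ω) (tendsto_const_nhds.congr fun n => ?_)
      exact (Set.indicator_of_notMem (s := Nᶜ) (fun h => h hω) _).symm
    · obtain ⟨n₀, hn₀⟩ := hgood ω hω
      have hu : TendstoUniformlyOn (fun n s => X n s ω) (fun s => Z s ω) atTop (Set.Icc t T) := by
        rw [Metric.tendstoUniformlyOn_iff]
        intro ε hε
        have h1 : Tendsto (fun n : ℕ => 2 * (1 / 2 : ℝ) ^ n) atTop (𝓝 (2 * 0)) :=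
          (tendsto_pow_atTop_nhds_zero_of_lt_one (by norm_num) (by norm_num)).const_mul 2
        rw [mul_zero] at h1
        filter_upwards [h1.eventually (gt_mem_nhds hε), eventually_ge_atTop n₀] with n hn hn2 s hs
        rw [dist_comm, Real.dist_eq]
        exact (hdist ω hω n (fun m hm => hn₀ m (hn2.trans hm)) s hs).trans_lt hn
      exact hu.continuousOn (Frequently.of_forall fun n => hXc n ω)
  · filter_upwards [measure_eq_zero_iff_ae_notMem.1 hN0] with ω hω using hXlim ω hω
  · filter_upwards [measure_eq_zero_iff_ae_notMem.1 hN0] with ω hω using hdist ω hω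

end Limit

/-! ### Picard approximations with simple integrands -/

section Picard

/-- `B` is jointly measurable, Lipschitz in space on `[t, T]`, and `B(·, 0)` has finite energy. -/
structure IsLipschitzCoeff (t T : ℝ≥0) (C : ℝ) (B : ℝ≥0 → ℝ → ℝ) : Prop where
  measurable : Measurable fun p : ℝ≥0 × ℝ => B p.1 p.2
  lipschitz : ∀ r ∈ Set.Icc t T, ∀ y z, |B r y - B r z| ≤ C * |y - z|
  energy : pathEnergy t T (fun r => B r 0) < ∞

variable {t T : ℝ≥0} {C : ℝ} {B S : ℝ≥0 → ℝ → ℝ}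

theorem IsLipschitzCoeff.pathEnergy_sub_le (hB : IsLipschitzCoeff t T C B) {s : ℝ≥0} (hs : s ≤ T)
    (f g : ℝ≥0 → ℝ) : pathEnergy t s (fun r => B r (f r) - B r (g r)) ≤
      ENNReal.ofReal (C ^ 2) * pathEnergy t s (fun r => f r - g r) :=
  pathEnergy_le_of_abs_le fun r hr => hB.lipschitz r ⟨hr.1, hr.2.trans hs⟩ _ _

theorem IsLipschitzCoeff.pathEnergy_le (hB : IsLipschitzCoeff t T C B) (f : ℝ≥0 → ℝ) :
    pathEnergy t T (fun r => B r (f r)) ≤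
      2 * pathEnergy t T (fun r => B r 0) + 2 * (ENNReal.ofReal (C ^ 2) * pathEnergy t T f) := by
  have hm : Measurable fun r => B r 0 := hB.measurable.comp measurable_prodMk_right
  refine (pathEnergy_le_add (k := fun r => B r (f r) - B r 0) hm.aemeasurable
    fun r _ => by ring).trans ?_
  gcongr
  refine (hB.pathEnergy_sub_le le_rfl f fun _ => 0).trans ?_
  simp

variable {Ω : Type*} {mΩ : MeasurableSpace Ω} {F : Filtration ℝ≥0 mΩ}
  {P : Measure Ω} {W W' : ℝ≥0 → Ω → ℝ} {X : ℝ≥0 → Ω → ℝ}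

/-- Continuous adapted processes on `[t, T]`. -/
structure IsContinuousAdapted (F : Filtration ℝ≥0 mΩ) (t T : ℝ≥0) (X : ℝ≥0 → Ω → ℝ) : Prop where
  adapted : ∀ s ∈ Set.Icc t T, Measurable[F s] (X s)
  continuous : ∀ ω, ContinuousOn (fun s => X s ω) (Set.Icc t T)

theorem IsContinuousAdapted.isProgressiveOn (hX : IsContinuousAdapted F t T X) :
    IsProgressiveOn F t T X := isProgressiveOn_of_continuousOn hX.adapted hX.continuous

theorem IsContinuousAdapted.pathEnergy_lt_top (hX : IsContinuousAdapted F t T X)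
    (hB : IsLipschitzCoeff t T C B) (ω : Ω) : pathEnergy t T (fun r => B r (X r ω)) < ∞ := by
  refine (hB.pathEnergy_le _).trans_lt ?_
  exact ENNReal.add_lt_top.2 ⟨ENNReal.mul_lt_top (by simp) hB.energy,
    ENNReal.mul_lt_top (by simp) (ENNReal.mul_lt_top ENNReal.ofReal_lt_top
      (pathEnergy_lt_top_of_continuousOn (hX.continuous ω)))⟩

theorem IsContinuousAdapted.integrableOn (hX : IsContinuousAdapted F t T X) (htT : t ≤ T)
    (hB : IsLipschitzCoeff t T C B) (ω : Ω) :
    IntegrableOn (fun r => B r (X r ω)) (Set.Icc t T) timeMeasure :=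
  integrableOn_of_pathEnergy_lt_top
    ((hX.isProgressiveOn.comp hB.measurable).aemeasurable ⟨htT, le_rfl⟩ ω)
    (hX.pathEnergy_lt_top hB ω)

theorem IsContinuousAdapted.add {X' : ℝ≥0 → Ω → ℝ} (hX : IsContinuousAdapted F t T X)
    (hX' : IsContinuousAdapted F t T X') : IsContinuousAdapted F t T fun s ω => X s ω + X' s ω :=
  ⟨fun s hs => (hX.adapted s hs).add (hX'.adapted s hs),
    fun ω => (hX.continuous ω).add (hX'.continuous ω)⟩

theorem IsContinuousAdapted.const_add_drift (hX : IsContinuousAdapted F t T X) (htT : t ≤ T)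
    (hB : IsLipschitzCoeff t T C B) (x : ℝ) :
    IsContinuousAdapted F t T fun s ω => x + ∫ r in Set.Icc t s, B r (X r ω) ∂timeMeasure :=
  ⟨fun _ hs => ((hX.isProgressiveOn.comp hB.measurable).measurable_integral hs).const_add x,
    fun ω => continuousOn_const.add (continuousOn_setIntegral_Icc (hX.integrableOn htT hB ω))⟩

theorem StepFamily.isContinuousAdapted_integral (G : StepFamily F t)
    (hWa : ∀ s, Measurable[F s] (W' s)) (hWc : ∀ ω, Continuous (W' · ω)) :
    IsContinuousAdapted F t T (G.integral W') :=
  ⟨fun s _ => G.measurable_integral hWa s, fun ω => (G.continuous_integral (hWc ω)).continuousOn⟩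

theorem StepFamily.integral_congr (G : StepFamily F t) {ω : Ω} (h : ∀ s, W' s ω = W s ω)
    (s : ℝ≥0) : G.integral W' s ω = G.integral W s ω := by
  simp only [StepFamily.integral, h]

theorem IsProgressiveOn.lintegral_pathEnergy [SFinite P] {H : ℝ≥0 → Ω → ℝ}
    (hH : IsProgressiveOn F t T H) {s : ℝ≥0} (hs : s ∈ Set.Icc t T) :
    ∫⁻ ω, pathEnergy t s (fun r => H r ω) ∂P =
      ∫⁻ r in Set.Icc t s, ∫⁻ ω, ENNReal.ofReal (H r ω ^ 2) ∂P ∂timeMeasure := by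
  have hm : Measurable fun p : Ω × ℝ≥0 =>
      ENNReal.ofReal ((Set.Icc t s).indicator (fun r => H r p.1) p.2 ^ 2) :=
    (((hH.measurable_indicator hs).comp measurable_swap).pow_const 2).ennreal_ofReal
  have h1 : ∀ ω, pathEnergy t s (fun r => H r ω) = ∫⁻ r in Set.Icc t s,
      ENNReal.ofReal ((Set.Icc t s).indicator (fun r => H r ω) r ^ 2) ∂timeMeasure := fun ω =>
    setLIntegral_congr_fun measurableSet_Icc fun r hr => by
      simp only [Set.indicator_of_mem hr]
  simp_rw [h1]
  rw [lintegral_lintegral_swap hm.aemeasurable]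
  exact setLIntegral_congr_fun measurableSet_Icc fun r hr => by
    simp only [Set.indicator_of_mem hr]

variable [IsProbabilityMeasure P]

theorem StepFamily.lintegral_pathEnergy_ne_top (G : StepFamily F t) (T : ℝ≥0) :
    ∫⁻ ω, pathEnergy t T (fun r => G.val r ω) ∂P ≠ ∞ := by
  obtain ⟨C, -, hC⟩ := G.exists_abs_val_le
  refine ne_top_of_le_ne_top ?_ (lintegral_mono (g := fun _ => ENNReal.ofReal (C ^ 2) *
    ENNReal.ofReal (T - t)) fun ω => pathEnergy_const_le fun r _ => hC r ω)
  rw [lintegral_const, measure_univ, mul_one]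
  exact ENNReal.mul_ne_top ENNReal.ofReal_ne_top ENNReal.ofReal_ne_top

theorem StepFamily.lintegral_integral_version_sq (hW : IsBrownianFor F P W)
    (hWW : ∀ᵐ ω ∂P, ∀ s, W' s ω = W s ω) (G : StepFamily F t) {s : ℝ≥0} (hs : t ≤ s) :
    ∫⁻ ω, ENNReal.ofReal (G.integral W' s ω ^ 2) ∂P =
      ∫⁻ ω, pathEnergy t s (fun r => G.val r ω) ∂P := by
  refine Eq.trans (lintegral_congr_ae ?_) (G.lintegral_integral_sq hW hs)
  filter_upwards [hWW] with ω hω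
  rw [G.integral_congr hω]

/-- Second moment bound for a drift plus a stochastic integral. -/
theorem lintegral_drift_add_integral_sq_le (hW : IsBrownianFor F P W)
    (hWW : ∀ᵐ ω ∂P, ∀ s, W' s ω = W s ω) {H : ℝ≥0 → Ω → ℝ} (hH : IsProgressiveOn F t T H)
    (G : StepFamily F t) {s : ℝ≥0} (hs : s ∈ Set.Icc t T) :
    ∫⁻ ω, ENNReal.ofReal ((∫ r in Set.Icc t s, H r ω ∂timeMeasure + G.integral W' s ω) ^ 2) ∂P ≤
      2 * (ENNReal.ofReal (T - t) * ∫⁻ ω, pathEnergy t s (fun r => H r ω) ∂P) +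
      2 * ∫⁻ ω, pathEnergy t s (fun r => G.val r ω) ∂P := by
  rw [← G.lintegral_integral_version_sq hW hWW hs.1, ← lintegral_const_mul' _ _
    ENNReal.ofReal_ne_top, ← lintegral_const_mul' 2 _ (by simp),
    ← lintegral_const_mul' 2 _ (by simp), ← lintegral_add_left]
  · refine lintegral_mono fun ω => (ofReal_add_sq_le _ _).trans ?_
    gcongr
    exact sq_setIntegral_Icc_le hs.2 (hH.aemeasurable hs ω)
  · exact (((hH.measurable_pathEnergy hs).mono (F.le s) le_rfl).const_mul _).const_mul _

theorem lintegral_pathEnergy_ne_top_of_moment {H : ℝ≥0 → Ω → ℝ} (hH : IsProgressiveOn F t T H)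
    (htT : t ≤ T) {M : ℝ≥0∞} (hM : M ≠ ∞)
    (h : ∀ s ∈ Set.Icc t T, ∫⁻ ω, ENNReal.ofReal (H s ω ^ 2) ∂P ≤ M) :
    ∫⁻ ω, pathEnergy t T (fun r => H r ω) ∂P ≠ ∞ := by
  rw [hH.lintegral_pathEnergy ⟨htT, le_rfl⟩]
  refine ne_top_of_le_ne_top ?_ (setLIntegral_mono' (g := fun _ => M) measurableSet_Icc h)
  rw [setLIntegral_const, timeMeasure_Icc]
  exact ENNReal.mul_ne_top hM ENNReal.ofReal_ne_top

theorem IsLipschitzCoeff.lintegral_pathEnergy_ne_top (hB : IsLipschitzCoeff t T C B)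
    (hX : ∫⁻ ω, pathEnergy t T (fun r => X r ω) ∂P ≠ ∞) :
    ∫⁻ ω, pathEnergy t T (fun r => B r (X r ω)) ∂P ≠ ∞ := by
  refine ne_top_of_le_ne_top ?_ (lintegral_mono fun ω => hB.pathEnergy_le (fun r => X r ω))
  rw [lintegral_add_left measurable_const, lintegral_const, measure_univ, mul_one,
    lintegral_const_mul' _ _ (by simp), lintegral_const_mul' _ _ ENNReal.ofReal_ne_top]
  exact ENNReal.add_ne_top.2 ⟨ENNReal.mul_ne_top (by simp) hB.energy.ne,
    ENNReal.mul_ne_top (by simp) (ENNReal.mul_ne_top ENNReal.ofReal_ne_top hX)⟩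

/-- Successive approximations, with stochastic integrals of simple processes. -/
theorem exists_picard_sequence (hW : IsBrownianFor F P W) (htT : t ≤ T)
    (hWa : ∀ s, Measurable[F s] (W' s)) (hWc : ∀ ω, Continuous (W' · ω))
    (hWW : ∀ᵐ ω ∂P, ∀ s, W' s ω = W s ω) (hB : IsLipschitzCoeff t T C B)
    (hS : IsLipschitzCoeff t T C S) (x : ℝ) {η : ℕ → ℝ≥0∞} (hη : ∀ n, 0 < η n) :
    ∃ (X : ℕ → ℝ≥0 → Ω → ℝ) (G : ℕ → SimpleProcess F t),
      (∀ n, IsContinuousAdapted F t T (X n)) ∧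
      (∀ n, ∃ M : ℝ≥0∞, M ≠ ∞ ∧ ∀ s ∈ Set.Icc t T, ∫⁻ ω, ENNReal.ofReal (X n s ω ^ 2) ∂P ≤ M) ∧
      (∀ n, ∫⁻ ω, pathEnergy t T (fun r => (G n).val r ω - S r (X n r ω)) ∂P ≤ η n) ∧
      (∀ s ω, X 0 s ω = x) ∧
      ∀ n s ω, X (n + 1) s ω = x + ∫ r in Set.Icc t s, B r (X n r ω) ∂timeMeasure +
        (G n).toStepFamily.integral W' s ω := by
  have hTm : T ∈ Set.Icc t T := ⟨htT, le_rfl⟩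
  -- The invariant of the iteration. A second moment bounded uniformly in time gives `S(·, X)`
  -- finite mean energy, which is what density of simple processes needs.
  let Q : (ℝ≥0 → Ω → ℝ) → Prop := fun X => IsContinuousAdapted F t T X ∧
    ∃ M : ℝ≥0∞, M ≠ ∞ ∧ ∀ s ∈ Set.Icc t T, ∫⁻ ω, ENNReal.ofReal (X s ω ^ 2) ∂P ≤ M
  have hG : ∀ (n : ℕ) (X : {X // Q X}), ∃ G : SimpleProcess F t,
      ∫⁻ ω, pathEnergy t T (fun r => G.val r ω - S r (X.1 r ω)) ∂P ≤ η n := by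
    rintro n ⟨X, hX, M, hM, hXM⟩
    exact exists_simpleProcess_lintegral_le htT (hX.isProgressiveOn.comp hS.measurable)
      (hS.lintegral_pathEnergy_ne_top
        (lintegral_pathEnergy_ne_top_of_moment hX.isProgressiveOn htT hM hXM)) (hη n)
  choose G hG using hG
  have hstep : ∀ (n : ℕ) (X : {X // Q X}), Q fun s ω =>
      x + ∫ r in Set.Icc t s, B r (X.1 r ω) ∂timeMeasure +
        (G n X).toStepFamily.integral W' s ω := by
    intro n X
    obtain ⟨hX, M, hM, hXM⟩ := X.2
    set g := (G n X).toStepFamily with hg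
    have hE := hB.lintegral_pathEnergy_ne_top
        (lintegral_pathEnergy_ne_top_of_moment hX.isProgressiveOn htT hM hXM)
    have hE' := g.lintegral_pathEnergy_ne_top (P := P) T
    refine ⟨(hX.const_add_drift htT hB x).add (g.isContinuousAdapted_integral hWa hWc),
      -- The new moment bound comes from separating the constant `x`, then the drift from the
      -- isometric part; both energies are enlarged to `[t, T]` for uniformity in `s`.
      2 * ENNReal.ofReal (x ^ 2) + 2 * (2 * (ENNReal.ofReal (T - t) *
        ∫⁻ ω, pathEnergy t T (fun r => B r (X.1 r ω)) ∂P) +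
        2 * ∫⁻ ω, pathEnergy t T (fun r => g.val r ω) ∂P), ?_, fun s hs => ?_⟩
    · refine ENNReal.add_ne_top.2 ⟨ENNReal.mul_ne_top (by simp) ENNReal.ofReal_ne_top,
        ENNReal.mul_ne_top (by simp) (ENNReal.add_ne_top.2 ⟨?_, ?_⟩)⟩
      · exact ENNReal.mul_ne_top (by simp) (ENNReal.mul_ne_top ENNReal.ofReal_ne_top hE)
      · exact ENNReal.mul_ne_top (by simp) hE'
    · have hBp := hX.isProgressiveOn.comp hB.measurable
      calc _ ≤ ∫⁻ ω, (2 * ENNReal.ofReal (x ^ 2) + 2 * ENNReal.ofReal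
            ((∫ r in Set.Icc t s, B r (X.1 r ω) ∂timeMeasure + g.integral W' s ω) ^ 2)) ∂P := by
            refine lintegral_mono fun ω => ?_
            simp only [add_assoc]
            exact ofReal_add_sq_le _ _
        _ = 2 * ENNReal.ofReal (x ^ 2) + 2 * ∫⁻ ω, ENNReal.ofReal
            ((∫ r in Set.Icc t s, B r (X.1 r ω) ∂timeMeasure + g.integral W' s ω) ^ 2) ∂P := by
            rw [lintegral_add_left measurable_const, lintegral_const, measure_univ, mul_one,
              lintegral_const_mul' 2 _ (by simp)]
        _ ≤ _ := by
            gcongr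
            refine (lintegral_drift_add_integral_sq_le hW hWW hBp g hs).trans ?_
            have hmono : ∀ f, pathEnergy t s f ≤ pathEnergy t T f := pathEnergy_mono hs.2
            gcongr <;> exact hmono _
  have h0 : Q fun _ _ => x := by
    refine ⟨⟨fun s _ => measurable_const, fun ω => continuousOn_const⟩, ENNReal.ofReal (x ^ 2),
      ENNReal.ofReal_ne_top, fun s _ => ?_⟩
    rw [lintegral_const, measure_univ, mul_one]
  let X : ℕ → {X // Q X} := fun n => Nat.rec ⟨_, h0⟩ (fun n X => ⟨_, hstep n X⟩) n
  exact ⟨fun n => (X n).1, fun n => G n (X n), fun n => (X n).2.1, fun n => (X n).2.2,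
    fun n => hG n (X n), fun _ _ => rfl, fun _ _ _ => rfl⟩

end Picard

/-! ### Geometric decay of the Picard increments -/

section Existence

theorem setLIntegral_le_of_le_exp {t s : ℝ≥0} {φ : ℝ≥0 → ℝ≥0∞} {m : ℝ≥0∞} {a : ℝ} (ha : 0 < a)
    (h : ∀ r ∈ Set.Icc t s, φ r ≤ m * ENNReal.ofReal (Real.exp (a * r))) :
    ∫⁻ r in Set.Icc t s, φ r ∂timeMeasure ≤
      m * (ENNReal.ofReal a⁻¹ * ENNReal.ofReal (Real.exp (a * s))) := by
  rw [← ENNReal.ofReal_mul (by positivity)]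
  refine le_trans ?_ (mul_le_mul_right (setLIntegral_exp_le t s ha) m)
  rw [← lintegral_const_mul _ (by fun_prop)]
  exact setLIntegral_mono' measurableSet_Icc h

/-- Geometric decay for a sequence satisfying a perturbed Grönwall recursion. -/
theorem exists_setLIntegral_le_geometric {t T : ℝ≥0} {φ : ℕ → ℝ≥0 → ℝ≥0∞} {K M : ℝ≥0∞}
    (hK : K ≠ ∞) (hM : M ≠ ∞) (h0 : ∀ s ∈ Set.Icc t T, φ 0 s ≤ M)
    (hstep : ∀ n, ∀ s ∈ Set.Icc t T,
      φ (n + 1) s ≤ K * ∫⁻ r in Set.Icc t s, φ n r ∂timeMeasure + 12 * (1 / 16) ^ n) :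
    ∃ κ : ℝ≥0∞, κ ≠ ∞ ∧ ∀ n, ∫⁻ r in Set.Icc t T, φ n r ∂timeMeasure ≤ κ * (1 / 8) ^ n := by
  -- This rate makes `K/a ≤ 1/16`, so the integral term contracts by `1/16` in the exponentially
  -- weighted norm.
  set a : ℝ := 16 * (K.toReal + 1) with ha
  have ha0 : 0 < a := by positivity
  set w : ℝ≥0 → ℝ≥0∞ := fun s => ENNReal.ofReal (Real.exp (a * s)) with hw
  have hw1 : ∀ s, 1 ≤ w s := fun s => by
    simp only [hw]
    rw [ENNReal.one_le_ofReal]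
    exact Real.one_le_exp (by positivity)
  have hKa : K * ENNReal.ofReal a⁻¹ ≤ 1 / 16 := by
    rw [← ENNReal.ofReal_toReal hK, ← ENNReal.ofReal_mul ENNReal.toReal_nonneg,
      show (1 / 16 : ℝ≥0∞) = ENNReal.ofReal (1 / 16) by
        rw [ENNReal.ofReal_div_of_pos (by norm_num)]; simp]
    refine ENNReal.ofReal_le_ofReal ?_
    have : K.toReal * (K.toReal + 1)⁻¹ ≤ 1 := by
      rw [← div_eq_mul_inv, div_le_one (by positivity)]; linarith
    rw [ha, mul_inv]
    linarith
  -- The constant `192 = 12 · 16` lets the perturbation be absorbed as another sixteenth of the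
  -- bound; the two sixteenths give the ratio `1/8`.
  have hbound : ∀ n, ∀ s ∈ Set.Icc t T, φ n s ≤ (M + 192) * (1 / 8) ^ n * w s := by
    intro n
    induction n with
    | zero =>
      intro s hs
      calc φ 0 s ≤ M := h0 s hs
        _ ≤ (M + 192) * 1 := by rw [mul_one]; exact le_self_add
        _ ≤ (M + 192) * (1 / 8) ^ 0 * w s := by
          rw [pow_zero, mul_assoc, one_mul]
          exact mul_le_mul_right (hw1 s) _
    | succ n ih =>
      intro s hs
      have h1 := setLIntegral_le_of_le_exp ha0
        (fun r (hr : r ∈ Set.Icc t s) => ih r ⟨hr.1, hr.2.trans hs.2⟩)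
      have h12 : (12 : ℝ≥0∞) ≤ (M + 192) * (1 / 16) := by
        calc (12 : ℝ≥0∞) = 192 * (1 / 16) := by
              rw [show (192 : ℝ≥0∞) = 12 * 16 by norm_num, mul_assoc, one_div,
                ENNReal.mul_inv_cancel (by simp) (by simp), mul_one]
          _ ≤ _ := by gcongr; exact le_add_self
      have h16 : (1 / 16 : ℝ≥0∞) + 1 / 16 = 1 / 8 := by
        rw [ENNReal.div_add_div_same, ENNReal.div_eq_div_iff (by simp) (by simp) (by simp)
          (by simp)]
        norm_num
      calc φ (n + 1) s ≤ _ := hstep n s hs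
        _ ≤ K * ((M + 192) * (1 / 8) ^ n * (ENNReal.ofReal a⁻¹ * w s)) +
            (M + 192) * (1 / 16) * (1 / 8) ^ n * w s := by
            refine add_le_add (mul_le_mul_right h1 K) ?_
            calc (12 : ℝ≥0∞) * (1 / 16) ^ n ≤ (M + 192) * (1 / 16) * (1 / 8) ^ n := by
                  gcongr; norm_num
              _ = (M + 192) * (1 / 16) * (1 / 8) ^ n * 1 := (mul_one _).symm
              _ ≤ _ := by gcongr; exact hw1 s
        _ = (K * ENNReal.ofReal a⁻¹) * (M + 192) * (1 / 8) ^ n * w s +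
            (1 / 16) * (M + 192) * (1 / 8) ^ n * w s := by ring
        _ ≤ (1 / 16) * (M + 192) * (1 / 8) ^ n * w s +
            (1 / 16) * (M + 192) * (1 / 8) ^ n * w s := by gcongr
        _ = (1 / 16 + 1 / 16) * (M + 192) * (1 / 8) ^ n * w s := by ring
        _ = (M + 192) * (1 / 8) ^ (n + 1) * w s := by rw [h16, pow_succ]; ring
  refine ⟨(M + 192) * (ENNReal.ofReal a⁻¹ * w T), ?_, fun n => ?_⟩
  · exact ENNReal.mul_ne_top (by simp [hM]) (ENNReal.mul_ne_top ENNReal.ofReal_ne_top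
      ENNReal.ofReal_ne_top)
  · refine (setLIntegral_le_of_le_exp ha0 (hbound n)).trans (le_of_eq ?_)
    simp only [hw]; ring

variable {t T : ℝ≥0} {C : ℝ} {B S : ℝ≥0 → ℝ → ℝ} {Ω : Type*} {mΩ : MeasurableSpace Ω}
  {F : Filtration ℝ≥0 mΩ} {P : Measure Ω} {W W' : ℝ≥0 → Ω → ℝ}

theorem pathEnergy_sub_comm (s : ℝ≥0) (f g : ℝ≥0 → ℝ) :
    pathEnergy t s (fun r => f r - g r) = pathEnergy t s (fun r => g r - f r) := by
  simp only [pathEnergy]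
  refine lintegral_congr fun r => ?_
  rw [← neg_sub, neg_sq]

theorem StepFamily.measure_exists_mem_Icc_version_le [IsProbabilityMeasure P]
    (hW : IsBrownianFor F P W) (hWW : ∀ᵐ ω ∂P, ∀ s, W' s ω = W s ω) (G : StepFamily F t)
    (htT : t ≤ T) {ε : ℝ} (hε : 0 < ε) :
    P {ω | ∃ s ∈ Set.Icc t T, ε ≤ |G.integral W' s ω|} ≤ ENNReal.ofReal (4 / ε ^ 2) *
      ∫⁻ ω, pathEnergy t T (fun r => G.val r ω) ∂P := by
  refine le_trans (measure_mono_ae ?_) (G.measure_exists_mem_Icc_le hW htT hε)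
  filter_upwards [hWW] with ω hω
  rintro ⟨s, hs, h⟩
  exact ⟨s, hs, by rwa [G.integral_congr hω] at h⟩

/-- The energy of the difference of two simple processes approximating `S(·, X)`, `S(·, X')`. -/
theorem lintegral_pathEnergy_sub_le (hS : IsLipschitzCoeff t T C S)
    {X X' : ℝ≥0 → Ω → ℝ} (hX : IsContinuousAdapted F t T X) (hX' : IsContinuousAdapted F t T X')
    (G G' : SimpleProcess F t) {s : ℝ≥0} (hs : s ∈ Set.Icc t T) :
    ∫⁻ ω, pathEnergy t s (fun r => (G'.toStepFamily.sub G.toStepFamily).val r ω) ∂P ≤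
      2 * ∫⁻ ω, pathEnergy t T (fun r => G'.val r ω - S r (X' r ω)) ∂P +
      2 * (2 * (ENNReal.ofReal (C ^ 2) * ∫⁻ ω, pathEnergy t s (fun r => X' r ω - X r ω) ∂P) +
        2 * ∫⁻ ω, pathEnergy t T (fun r => G.val r ω - S r (X r ω)) ∂P) := by
  have hTm : T ∈ Set.Icc t T := ⟨hs.1.trans hs.2, le_rfl⟩
  have hp := (G'.isProgressiveOn_val T).sub (hX'.isProgressiveOn.comp hS.measurable)
  have hq := (hX'.isProgressiveOn.comp hS.measurable).sub (hX.isProgressiveOn.comp hS.measurable)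
  have hd := hX'.isProgressiveOn.sub hX.isProgressiveOn
  have hmp : Measurable fun ω => pathEnergy t T (fun r => G'.val r ω - S r (X' r ω)) :=
    (hp.measurable_pathEnergy hTm).mono (F.le T) le_rfl
  have hmd : Measurable fun ω => pathEnergy t s (fun r => X' r ω - X r ω) :=
    (hd.measurable_pathEnergy hs).mono (F.le s) le_rfl
  calc _ ≤ ∫⁻ ω, (2 * pathEnergy t T (fun r => G'.val r ω - S r (X' r ω)) +
        2 * (2 * (ENNReal.ofReal (C ^ 2) * pathEnergy t s (fun r => X' r ω - X r ω)) +
          2 * pathEnergy t T (fun r => G.val r ω - S r (X r ω)))) ∂P := by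
        refine lintegral_mono fun ω => ?_
        refine (pathEnergy_le_add (hp.aemeasurable hs ω)
          (k := fun r => (S r (X' r ω) - S r (X r ω)) + (S r (X r ω) - G.val r ω))
          fun r _ => ?_).trans ?_
        · rw [StepFamily.sub_val, SimpleProcess.toStepFamily_val, SimpleProcess.toStepFamily_val]
          ring
        · have h1 := pathEnergy_le_add (hq.aemeasurable hs ω)
            (f := fun r => (S r (X' r ω) - S r (X r ω)) + (S r (X r ω) - G.val r ω))
            (k := fun r => S r (X r ω) - G.val r ω) fun r _ => rfl
          rw [pathEnergy_sub_comm s (fun r => S r (X r ω))] at h1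
          have hmono : ∀ f, pathEnergy t s f ≤ pathEnergy t T f := pathEnergy_mono hs.2
          refine add_le_add (mul_le_mul_right (hmono _) _) (mul_le_mul_right (h1.trans ?_) _)
          exact add_le_add (mul_le_mul_right (hS.pathEnergy_sub_le hs.2 _ _) _)
            (mul_le_mul_right (hmono _) _)
    _ = _ := by
        rw [lintegral_add_left (hmp.const_mul _), lintegral_const_mul' 2 _ (by simp),
          lintegral_const_mul' 2 _ (by simp), lintegral_add_left ((hmd.const_mul _).const_mul _),
          lintegral_const_mul' 2 _ (by simp), lintegral_const_mul' 2 _ (by simp),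
          lintegral_const_mul' _ _ ENNReal.ofReal_ne_top]

variable [IsProbabilityMeasure P]

/-- The increments of the successive approximations are summably small in probability. -/
theorem exists_picard_measure_le (hW : IsBrownianFor F P W) (htT : t ≤ T)
    (hWW : ∀ᵐ ω ∂P, ∀ s, W' s ω = W s ω) (hB : IsLipschitzCoeff t T C B)
    (hS : IsLipschitzCoeff t T C S) {x : ℝ} {X : ℕ → ℝ≥0 → Ω → ℝ} {G : ℕ → SimpleProcess F t}
    (hX : ∀ n, IsContinuousAdapted F t T (X n))
    (hM : ∀ n, ∃ M : ℝ≥0∞, M ≠ ∞ ∧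
      ∀ s ∈ Set.Icc t T, ∫⁻ ω, ENNReal.ofReal (X n s ω ^ 2) ∂P ≤ M)
    (hG : ∀ n, ∫⁻ ω, pathEnergy t T (fun r => (G n).val r ω - S r (X n r ω)) ∂P ≤ (1 / 16) ^ n)
    (hXG : ∀ n s ω, X (n + 1) s ω = x + ∫ r in Set.Icc t s, B r (X n r ω) ∂timeMeasure +
        (G n).toStepFamily.integral W' s ω) :
    ∑' n, P {ω | ∃ s ∈ Set.Icc t T, (1 / 2) ^ n ≤ |X (n + 1) s ω - X n s ω|} ≠ ∞ := by
  have hTm : T ∈ Set.Icc t T := ⟨htT, le_rfl⟩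
  set c₁ := ENNReal.ofReal ((T : ℝ) - t) with hc₁
  set c₂ := ENNReal.ofReal (C ^ 2) with hc₂
  have hc₁t : c₁ ≠ ∞ := ENNReal.ofReal_ne_top
  have hc₂t : c₂ ≠ ∞ := ENNReal.ofReal_ne_top
  set Δ : ℕ → ℝ≥0 → Ω → ℝ := fun n s ω => X (n + 1) s ω - X n s ω with hΔ
  have hΔp : ∀ n, IsProgressiveOn F t T (Δ n) := fun n =>
    (hX (n + 1)).isProgressiveOn.sub (hX n).isProgressiveOn
  set D : ℕ → StepFamily F t := fun n => (G (n + 1)).toStepFamily.sub (G n).toStepFamily with hD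
  have hη : ∀ n, (1 / 16 : ℝ≥0∞) ^ (n + 1) ≤ (1 / 16) ^ n := fun n =>
    pow_le_pow_of_le_one zero_le (by simp) n.le_succ
  -- The errors of the two simple processes enter with factors `2` and `4`, hence the `6`.
  have hDE : ∀ n, ∀ s ∈ Set.Icc t T, ∫⁻ ω, pathEnergy t s (fun r => (D n).val r ω) ∂P ≤
      4 * (c₂ * ∫⁻ ω, pathEnergy t s (fun r => Δ n r ω) ∂P) + 6 * (1 / 16) ^ n := by
    intro n s hs
    refine (lintegral_pathEnergy_sub_le hS (hX n) (hX (n + 1)) (G n) (G (n + 1)) hs).trans ?_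
    calc _ ≤ 2 * (1 / 16) ^ n + 2 * (2 * (c₂ * ∫⁻ ω, pathEnergy t s (fun r => Δ n r ω) ∂P) +
          2 * (1 / 16) ^ n) := by
          gcongr
          · exact (hG (n + 1)).trans (hη n)
          · exact hG n
      _ = _ := by ring
  have hBp : ∀ n, IsProgressiveOn F t T fun r ω => B r (X (n + 1) r ω) - B r (X n r ω) := fun n =>
    ((hX (n + 1)).isProgressiveOn.comp hB.measurable).sub
      ((hX n).isProgressiveOn.comp hB.measurable)
  have hdiff : ∀ n, ∀ s ∈ Set.Icc t T, ∀ ω, Δ (n + 1) s ω =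
      ∫ r in Set.Icc t s, (B r (X (n + 1) r ω) - B r (X n r ω)) ∂timeMeasure +
        (D n).integral W' s ω := by
    intro n s hs ω
    have hsub : Set.Icc t s ⊆ Set.Icc t T := Set.Icc_subset_Icc_right hs.2
    rw [integral_sub (((hX (n + 1)).integrableOn htT hB ω).mono_set hsub)
      (((hX n).integrableOn htT hB ω).mono_set hsub), hD, StepFamily.sub_integral]
    simp only [hΔ]
    rw [hXG (n + 1), hXG n]
    ring
  set φ : ℕ → ℝ≥0 → ℝ≥0∞ := fun n s => ∫⁻ ω, ENNReal.ofReal (Δ n s ω ^ 2) ∂P with hφ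
  have hJ : ∀ n, ∀ s ∈ Set.Icc t T, ∫⁻ ω, pathEnergy t s (fun r => Δ n r ω) ∂P =
      ∫⁻ r in Set.Icc t s, φ n r ∂timeMeasure := fun n s hs => (hΔp n).lintegral_pathEnergy hs
  have hBE : ∀ n, ∀ s ∈ Set.Icc t T,
      ∫⁻ ω, pathEnergy t s (fun r => B r (X (n + 1) r ω) - B r (X n r ω)) ∂P ≤
        c₂ * ∫⁻ ω, pathEnergy t s (fun r => Δ n r ω) ∂P := by
    intro n s hs
    rw [← lintegral_const_mul' _ _ hc₂t]
    exact lintegral_mono fun ω => hB.pathEnergy_sub_le hs.2 _ _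
  obtain ⟨κ, hκ, hκJ⟩ : ∃ κ : ℝ≥0∞, κ ≠ ∞ ∧
      ∀ n, ∫⁻ r in Set.Icc t T, φ n r ∂timeMeasure ≤ κ * (1 / 8) ^ n := by
    obtain ⟨M₀, hM₀, h₀⟩ := hM 0
    obtain ⟨M₁, hM₁, h₁⟩ := hM 1
    -- In `K`, `2 c₁ c₂` comes from the drift and `8 c₂ = 2 · 4 c₂` from the stochastic part, whose
    -- approximation error likewise doubles from `6` to `12`.
    refine exists_setLIntegral_le_geometric (K := 2 * (c₁ * c₂) + 8 * c₂)
      (M := 2 * M₁ + 2 * M₀) ?_ ?_ (fun s hs => ?_) fun n s hs => ?_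
    · exact ENNReal.add_ne_top.2 ⟨ENNReal.mul_ne_top (by simp) (ENNReal.mul_ne_top hc₁t hc₂t),
        ENNReal.mul_ne_top (by simp) hc₂t⟩
    · exact ENNReal.add_ne_top.2 ⟨ENNReal.mul_ne_top (by simp) hM₁,
        ENNReal.mul_ne_top (by simp) hM₀⟩
    · have hm : Measurable fun ω => 2 * ENNReal.ofReal (X 1 s ω ^ 2) :=
        ((((hX 1).adapted s hs).mono (F.le s) le_rfl).pow_const 2).ennreal_ofReal.const_mul _
      calc φ 0 s ≤ ∫⁻ ω, (2 * ENNReal.ofReal (X 1 s ω ^ 2) +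
            2 * ENNReal.ofReal (X 0 s ω ^ 2)) ∂P := by
            refine lintegral_mono fun ω => ?_
            have := ofReal_add_sq_le (X 1 s ω) (-X 0 s ω)
            rw [neg_sq, ← sub_eq_add_neg] at this
            exact this
        _ = 2 * ∫⁻ ω, ENNReal.ofReal (X 1 s ω ^ 2) ∂P +
            2 * ∫⁻ ω, ENNReal.ofReal (X 0 s ω ^ 2) ∂P := by
            rw [lintegral_add_left hm, lintegral_const_mul' _ _ (by simp),
              lintegral_const_mul' _ _ (by simp)]
        _ ≤ _ := by gcongr; exacts [h₁ s hs, h₀ s hs]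
    · rw [← hJ n s hs]
      set J := ∫⁻ ω, pathEnergy t s (fun r => Δ n r ω) ∂P with hJdef
      have h1 := lintegral_drift_add_integral_sq_le hW hWW (hBp n) (D n) hs
      simp_rw [← hdiff n s hs] at h1
      calc φ (n + 1) s ≤ _ := h1
        _ ≤ 2 * (c₁ * (c₂ * J)) + 2 * (4 * (c₂ * J) + 6 * (1 / 16) ^ n) := by
            gcongr
            · exact hBE n s hs
            · exact hDE n s hs
        _ = _ := by ring
  set κ' : ℝ≥0∞ := 16 * (c₁ * (c₂ * κ)) + 64 * (4 * (c₂ * κ) + 6) with hκ'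
  have hκ't : κ' ≠ ∞ := by
    have : c₂ * κ ≠ ∞ := ENNReal.mul_ne_top hc₂t hκ
    exact ENNReal.add_ne_top.2 ⟨ENNReal.mul_ne_top (by simp) (ENNReal.mul_ne_top hc₁t this),
      ENNReal.mul_ne_top (by simp) (ENNReal.add_ne_top.2 ⟨ENNReal.mul_ne_top (by simp) this,
        by simp⟩)⟩
  have hsucc : ∀ n, P {ω | ∃ s ∈ Set.Icc t T, (1 / 2) ^ (n + 1) ≤ |Δ (n + 1) s ω|} ≤
      κ' * (1 / 2) ^ n := by
    intro n
    -- Half of the threshold `2^{-(n+1)}`: when the increment is large, the drift or the stochastic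
    -- integral reaches `δ`. Chebyshev and Doob cost `δ^{-2} = 16 · 4^n`, and `4^n · 8^{-n} =
    -- 2^{-n}` is summable.
    set δ : ℝ := (1 / 2) ^ (n + 2) with hδ
    have hδ0 : 0 < δ := by positivity
    set J := ∫⁻ ω, pathEnergy t T (fun r => Δ n r ω) ∂P with hJdef
    have hJle : J ≤ κ * (1 / 8) ^ n := by rw [hJdef, hJ n T hTm]; exact hκJ n
    have hcov : {ω | ∃ s ∈ Set.Icc t T, (1 / 2) ^ (n + 1) ≤ |Δ (n + 1) s ω|} ⊆
        {ω | ENNReal.ofReal (δ ^ 2) ≤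
          c₁ * pathEnergy t T (fun r => B r (X (n + 1) r ω) - B r (X n r ω))} ∪
        {ω | ∃ s ∈ Set.Icc t T, δ ≤ |(D n).integral W' s ω|} := by
      rintro ω ⟨s, hs, h⟩
      by_cases h2 : δ ≤ |(D n).integral W' s ω|
      · exact Or.inr ⟨s, hs, h2⟩
      · left
        rw [hdiff n s hs] at h
        set I := ∫ r in Set.Icc t s, (B r (X (n + 1) r ω) - B r (X n r ω)) ∂timeMeasure with hI
        have h3 : δ ≤ |I| := by
          have h4 := h.trans (abs_add_le _ _)
          have h5 : (1 / 2 : ℝ) ^ (n + 1) = 2 * δ := by rw [hδ, pow_succ _ (n + 1)]; ring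
          linarith [not_le.1 h2]
        calc ENNReal.ofReal (δ ^ 2) ≤ ENNReal.ofReal (I ^ 2) := by
              refine ENNReal.ofReal_le_ofReal ?_
              rw [← sq_abs I]
              exact pow_le_pow_left₀ hδ0.le h3 2
          _ ≤ _ := sq_setIntegral_Icc_le hs.2 ((hBp n).aemeasurable hs ω)
          _ ≤ _ := mul_le_mul_right (pathEnergy_mono hs.2 _) _
    have hδ4 : ENNReal.ofReal (1 / δ ^ 2) = 16 * 4 ^ n := by
      have : (1 : ℝ) / δ ^ 2 = 16 * 4 ^ n := by
        rw [hδ, one_div_pow, one_div_pow, one_div_one_div, ← pow_mul, mul_comm, pow_mul]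
        norm_num [pow_add]; ring
      rw [this, ENNReal.ofReal_mul (by norm_num), ENNReal.ofReal_pow (by norm_num)]
      simp
    have hδ16 : ENNReal.ofReal (4 / δ ^ 2) = 64 * 4 ^ n := by
      rw [← mul_one_div, ENNReal.ofReal_mul (by norm_num), hδ4, ← mul_assoc]
      congr 1
      simp only [ENNReal.ofReal_ofNat]
      norm_num
    have h1 : P {ω | ENNReal.ofReal (δ ^ 2) ≤
          c₁ * pathEnergy t T (fun r => B r (X (n + 1) r ω) - B r (X n r ω))} ≤
        16 * 4 ^ n * (c₁ * (c₂ * J)) := by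
      have hm : Measurable fun ω =>
          c₁ * pathEnergy t T (fun r => B r (X (n + 1) r ω) - B r (X n r ω)) :=
        (((hBp n).measurable_pathEnergy hTm).mono (F.le T) le_rfl).const_mul _
      refine (meas_ge_le_lintegral_div hm.aemeasurable
        (by rw [Ne, ENNReal.ofReal_eq_zero, not_le]; positivity) ENNReal.ofReal_ne_top).trans ?_
      rw [lintegral_const_mul' _ _ hc₁t, div_eq_mul_inv,
        ← ENNReal.ofReal_inv_of_pos (by positivity), ← one_div, hδ4, mul_comm]
      gcongr
      exact hBE n T hTm
    have h2 := (D n).measure_exists_mem_Icc_version_le hW hWW htT hδ0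
    rw [hδ16] at h2
    have h48 : (4 : ℝ≥0∞) ^ n * (1 / 8) ^ n = (1 / 2) ^ n := by
      rw [← mul_pow]
      congr 1
      rw [mul_one_div, ENNReal.div_eq_div_iff (by simp) (by simp) (by simp) (by simp)]
      norm_num
    calc _ ≤ _ := measure_mono hcov
      _ ≤ _ := measure_union_le _ _
      _ ≤ 16 * 4 ^ n * (c₁ * (c₂ * J)) + 64 * 4 ^ n * (4 * (c₂ * J) + 6 * (1 / 16) ^ n) := by
          refine add_le_add h1 (h2.trans ?_)
          gcongr
          exact hDE n T hTm
      _ ≤ 16 * 4 ^ n * (c₁ * (c₂ * (κ * (1 / 8) ^ n))) +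
          64 * 4 ^ n * (4 * (c₂ * (κ * (1 / 8) ^ n)) + 6 * (1 / 8) ^ n) := by
          gcongr; norm_num
      _ = κ' * (4 ^ n * (1 / 8) ^ n) := by rw [hκ']; ring
      _ = κ' * (1 / 2) ^ n := by rw [h48]
  clear_value κ'
  -- The summand `1` takes care of `n = 0`, where no estimate is available; the factor `2`
  -- compensates the index shift.
  have hall : ∀ n, P {ω | ∃ s ∈ Set.Icc t T, (1 / 2) ^ n ≤ |Δ n s ω|} ≤
      (1 + 2 * κ') * (1 / 2) ^ n := by
    intro n
    cases n with
    | zero =>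
      refine prob_le_one.trans ?_
      rw [pow_zero (1 / 2 : ℝ≥0∞), mul_one]
      exact le_self_add
    | succ n =>
      refine (hsucc n).trans ?_
      have h2 : (1 / 2 : ℝ≥0∞) ^ n = 2 * (1 / 2) ^ (n + 1) := by
        rw [pow_succ, mul_comm, mul_assoc, one_div, ENNReal.inv_mul_cancel (by simp) (by simp),
          mul_one]
      calc κ' * (1 / 2) ^ n = 2 * κ' * (1 / 2) ^ (n + 1) := by rw [h2]; ring
        _ ≤ (1 + 2 * κ') * (1 / 2) ^ (n + 1) := mul_le_mul_left le_add_self _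
  refine ne_top_of_le_ne_top ?_ (ENNReal.tsum_le_tsum hall)
  rw [ENNReal.tsum_mul_left, ENNReal.tsum_geometric]
  refine ENNReal.mul_ne_top ?_ (by simp)
  exact ENNReal.add_ne_top.2 ⟨by simp, ENNReal.mul_ne_top (by simp) hκ't⟩

end Existence

/-! ### Existence of a strong solution -/

section StrongSolution

variable {t T : ℝ≥0} {C : ℝ} {B S : ℝ≥0 → ℝ → ℝ} {Ω : Type*} {mΩ : MeasurableSpace Ω}
  {F : Filtration ℝ≥0 mΩ} {P : Measure Ω} {W W' : ℝ≥0 → Ω → ℝ}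

theorem tendsto_measure_zero_of_ae_le_union {D A U : ℕ → Set Ω}
    (h : ∀ᶠ n in atTop, ∀ᵐ ω ∂P, ω ∈ D n → ω ∈ A n ∪ U n)
    (hA : Tendsto (fun n => P (A n)) atTop (𝓝 0)) (hU : Tendsto (fun n => P (U n)) atTop (𝓝 0)) :
    Tendsto (fun n => P (D n)) atTop (𝓝 0) := by
  have h2 := hA.add hU
  rw [add_zero] at h2
  refine tendsto_of_tendsto_of_tendsto_of_le_of_le' tendsto_const_nhds h2
    (Eventually.of_forall fun _ => zero_le) ?_
  filter_upwards [h] with n hn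
  exact (measure_mono_ae hn).trans (measure_union_le _ _)

/-- If the values of simple processes approximate `H`, then they also approximate a limit `H'`
which is close to `H`. -/
theorem tendsto_measure_pathEnergy_sub {H : ℕ → ℝ≥0 → Ω → ℝ} {H' : ℝ≥0 → Ω → ℝ}
    {G : ℕ → SimpleProcess F t} (hH : ∀ n, IsProgressiveOn F t T (H n)) (htT : t ≤ T)
    (hG : ∀ n, ∫⁻ ω, pathEnergy t T (fun r => (G n).val r ω - H n r ω) ∂P ≤ (1 / 16) ^ n)
    {U : ℕ → Set Ω} (hU : Tendsto (fun n => P (U n)) atTop (𝓝 0)) {d : ℕ → ℝ≥0∞}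
    (hd : Tendsto d atTop (𝓝 0))
    (hUd : ∀ᵐ ω ∂P, ∀ n, ω ∉ U n → pathEnergy t T (fun r => H n r ω - H' r ω) ≤ d n)
    {ε : ℝ≥0∞} (hε : 0 < ε) :
    Tendsto (fun n => P {ω | ε ≤ pathEnergy t T (fun r => (G n).val r ω - H' r ω)})
      atTop (𝓝 0) := by
  have hTm : T ∈ Set.Icc t T := ⟨htT, le_rfl⟩
  -- The minimum with `1` keeps `δ` finite when `ε = ∞`; the quarter leaves room for the two factors
  -- `2` in the energy of a sum.
  set δ : ℝ≥0∞ := min ε 1 / 4 with hδ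
  have hδ0 : δ ≠ 0 := by
    rw [hδ, Ne, ENNReal.div_eq_zero_iff, not_or]
    exact ⟨(lt_min hε one_pos).ne', by simp⟩
  have hδt : δ ≠ ∞ := ENNReal.div_ne_top (ne_top_of_le_ne_top ENNReal.one_ne_top (min_le_right _ _))
    (by simp)
  have hδ4 : 2 * δ + 2 * δ = min ε 1 := by
    rw [← add_mul, show (2 : ℝ≥0∞) + 2 = 4 by norm_num, hδ]
    exact ENNReal.mul_div_cancel (by simp) (by simp)
  have hp : ∀ n, IsProgressiveOn F t T fun r ω => (G n).val r ω - H n r ω := fun n =>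
    ((G n).isProgressiveOn_val T).sub (hH n)
  refine tendsto_measure_zero_of_ae_le_union
    (A := fun n => {ω | δ ≤ pathEnergy t T (fun r => (G n).val r ω - H n r ω)}) ?_ ?_ hU
  · filter_upwards [hd.eventually (eventually_lt_nhds (pos_iff_ne_zero.2 hδ0))] with n hn
    filter_upwards [hUd] with ω hω h
    by_contra hcon
    have h1 : pathEnergy t T (fun r => (G n).val r ω - H n r ω) < δ :=
      not_le.1 fun h => hcon (Or.inl h)
    have h2 := (hω n fun h => hcon (Or.inr h)).trans_lt hn
    have h3 := pathEnergy_le_add (f := fun r => (G n).val r ω - H' r ω)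
      (k := fun r => H n r ω - H' r ω) ((hp n).aemeasurable hTm ω) fun r _ => by ring
    have h4 : 2 * pathEnergy t T (fun r => (G n).val r ω - H n r ω) +
        2 * pathEnergy t T (fun r => H n r ω - H' r ω) < 2 * δ + 2 * δ :=
      ENNReal.add_lt_add (ENNReal.mul_lt_mul_right (by simp) (by simp) h1)
        (ENNReal.mul_lt_mul_right (by simp) (by simp) h2)
    rw [hδ4] at h4
    exact absurd (((min_le_left ε 1).trans h).trans h3) (not_le.2 h4)
  · have hlim : Tendsto (fun n : ℕ => (1 / 16 : ℝ≥0∞) ^ n / δ) atTop (𝓝 0) := by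
      have := ENNReal.Tendsto.div_const (b := δ) (ENNReal.tendsto_pow_atTop_nhds_zero_of_lt_one
        (r := 1 / 16) (by rw [one_div, ENNReal.inv_lt_one]; norm_num)) (Or.inr hδ0)
      simpa using this
    refine tendsto_of_tendsto_of_tendsto_of_le_of_le tendsto_const_nhds hlim
      (fun _ => zero_le) fun n => ?_
    refine (meas_ge_le_lintegral_div
      (((hp n).measurable_pathEnergy hTm).mono (F.le T) le_rfl).aemeasurable hδ0 hδt).trans ?_
    exact ENNReal.div_le_div_right (hG n) _

theorem abs_setIntegral_Icc_sub_le {f g : ℝ≥0 → ℝ} {s : ℝ≥0} (hs : s ∈ Set.Icc t T) {M : ℝ}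
    (hM : 0 ≤ M) (hf : IntegrableOn f (Set.Icc t T) timeMeasure)
    (hg : IntegrableOn g (Set.Icc t T) timeMeasure)
    (h : ∀ r ∈ Set.Icc t T, |f r - g r| ≤ M) :
    |∫ r in Set.Icc t s, f r ∂timeMeasure - ∫ r in Set.Icc t s, g r ∂timeMeasure| ≤
      M * (T - t) := by
  have hsub : Set.Icc t s ⊆ Set.Icc t T := Set.Icc_subset_Icc_right hs.2
  rw [← integral_sub (hf.mono_set hsub) (hg.mono_set hsub)]
  have h1 := norm_setIntegral_le_of_norm_le_const (μ := timeMeasure) (s := Set.Icc t s)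
    (f := fun r => f r - g r) (C := M) (by rw [timeMeasure_Icc]; exact ENNReal.ofReal_lt_top)
    fun r hr => h r (hsub hr)
  refine h1.trans (mul_le_mul_of_nonneg_left ?_ hM)
  have hts : (t : ℝ) ≤ s := hs.1
  have hsT : (s : ℝ) ≤ T := hs.2
  rw [Measure.real, timeMeasure_Icc, ENNReal.toReal_ofReal (by linarith)]
  linarith

variable [IsProbabilityMeasure P]

/-- Existence of a strong solution of a stochastic differential equation with Lipschitz
coefficients. -/
theorem exists_isStrongSolution (hW : IsBrownianFor F P W) (htT : t ≤ T) (hC : 0 ≤ C)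
    (hB : IsLipschitzCoeff t T C B) (hS : IsLipschitzCoeff t T C S) (x : ℝ) :
    ∃ X, IsStrongSolution F P W t T x B S X := by
  obtain ⟨W', hWa, hWc, hWW⟩ := hW.exists_continuous_version
  obtain ⟨X, G, hX, hM, hG, hX0, hXG⟩ := exists_picard_sequence hW htT hWa hWc hWW hB hS x
    (η := fun n => (1 / 16) ^ n) fun n => by
      simp only [one_div]; exact ENNReal.pow_pos (by simp) n
  have hsum := exists_picard_measure_le hW htT hWW hB hS hX hM hG hXG
  obtain ⟨Z, hZa, hZc, hZlim, hZb⟩ := exists_continuous_adapted_limit hW.null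
    (fun n => (hX n).adapted) (fun n => (hX n).continuous) hsum
  have hZ : IsContinuousAdapted F t T Z := ⟨hZa, hZc⟩
  have htm : t ∈ Set.Icc t T := ⟨le_rfl, htT⟩
  set E : ℕ → Set Ω := fun n => {ω | ∃ s ∈ Set.Icc t T, (1 / 2) ^ n ≤ |X (n + 1) s ω - X n s ω|}
    with hE
  -- `U n` is the event that some increment from index `n` on is large, and its probability is at
  -- most a tail of the convergent series. Outside it, almost surely, every later iterate is within
  -- `2 · 2^{-n}` of `Z`, uniformly in time.
  set U : ℕ → Set Ω := fun n => ⋃ k, E (k + n) with hUdef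
  have hUlim : Tendsto (fun n => P (U n)) atTop (𝓝 0) :=
    tendsto_of_tendsto_of_tendsto_of_le_of_le tendsto_const_nhds
      (ENNReal.tendsto_sum_nat_add (fun n => P (E n)) hsum) (fun _ => zero_le)
      fun n => measure_iUnion_le _
  have hnear : ∀ᵐ ω ∂P, ∀ n, ω ∉ U n → ∀ m, n ≤ m → ∀ s ∈ Set.Icc t T,
      |X m s ω - Z s ω| ≤ 2 * (1 / 2) ^ n := by
    filter_upwards [hZb] with ω hω n hn m hnm s hs
    refine (hω m (fun k hk s hs => not_le.1 fun h => hn ?_) s hs).trans ?_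
    · refine Set.mem_iUnion.2 ⟨k - n, ?_⟩
      rw [Nat.sub_add_cancel (hnm.trans hk)]
      exact ⟨s, hs, h⟩
    · have : (1 / 2 : ℝ) ^ m ≤ (1 / 2) ^ n :=
        pow_le_pow_of_le_one (by norm_num) (by norm_num) hnm
      linarith
  have hpow : Tendsto (fun n : ℕ => 2 * (1 / 2 : ℝ) ^ n) atTop (𝓝 0) := by
    have := (tendsto_pow_atTop_nhds_zero_of_lt_one (r := (1 / 2 : ℝ)) (by norm_num)
      (by norm_num)).const_mul 2
    rwa [mul_zero] at this
  -- `Y` is defined as what the equation leaves for the stochastic integral, so the equation holds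
  -- by construction. It remains to show that `Y` is the Itô integral of `S(·, Z)`, with the `G n`
  -- as approximating simple processes.
  set Y : ℝ≥0 → Ω → ℝ := fun s ω =>
    Z s ω - (x + ∫ r in Set.Icc t s, B r (Z r ω) ∂timeMeasure) with hY
  have hdrift := hZ.const_add_drift htT hB x
  refine ⟨Z, hZa, hZc, ?_, ae_of_all _ fun ω => hZ.integrableOn htT hB ω, Y, ?_,
    ae_of_all _ fun ω s _ => by simp only [hY]; ring⟩
  · have hXt : ∀ n ω, X n t ω = x := by
      intro n ω
      cases n with
      | zero => exact hX0 t ω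
      | succ n =>
        have h0 : (timeMeasure.restrict (Set.Icc t t)) = 0 := by
          rw [Measure.restrict_eq_zero, timeMeasure_Icc]; simp
        rw [hXG, StepFamily.integral_start, h0, integral_zero_measure]; ring
    filter_upwards [hZlim] with ω hω
    have h := hω t htm
    simp_rw [hXt] at h
    exact tendsto_nhds_unique h tendsto_const_nhds
  refine ⟨(hZ.isProgressiveOn.comp hS.measurable).isProgressive htT,
    ae_of_all _ fun ω => hZ.pathEnergy_lt_top hS ω,
    fun s hs => (hZa s hs).sub (hdrift.adapted s hs),
    fun ω => (hZc ω).sub (hdrift.continuous ω), G, fun ε hε => ?_, fun ε hε => ?_⟩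
  · refine tendsto_measure_pathEnergy_sub (H := fun n r ω => S r (X n r ω))
      (fun n => (hX n).isProgressiveOn.comp hS.measurable) htT hG hUlim
      (d := fun n => ENNReal.ofReal (C ^ 2) *
        (ENNReal.ofReal ((2 * (1 / 2) ^ n) ^ 2) * ENNReal.ofReal (T - t))) ?_ ?_ hε
    · have h1 : Tendsto (fun n : ℕ => ENNReal.ofReal ((2 * (1 / 2 : ℝ) ^ n) ^ 2)) atTop (𝓝 0) := by
        have := ENNReal.tendsto_ofReal (hpow.pow 2)
        simpa using this
      have h2 := ENNReal.Tendsto.const_mul (a := ENNReal.ofReal (C ^ 2))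
        (ENNReal.Tendsto.mul_const (b := ENNReal.ofReal (T - t)) h1
          (Or.inr ENNReal.ofReal_ne_top)) (Or.inr ENNReal.ofReal_ne_top)
      simpa using h2
    · filter_upwards [hnear] with ω hω n hn
      refine (hS.pathEnergy_sub_le le_rfl _ _).trans (mul_le_mul_right ?_ _)
      exact pathEnergy_const_le fun r hr => hω n hn n le_rfl r hr
  · refine tendsto_measure_zero_of_ae_le_union (A := fun _ => ∅) (U := U) ?_ (by simp) hUlim
    have hlim : Tendsto (fun n : ℕ => 2 * (1 / 2 : ℝ) ^ n +
        C * (2 * (1 / 2) ^ n) * (T - t)) atTop (𝓝 0) := by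
      have := hpow.add ((hpow.const_mul C).mul_const ((T : ℝ) - t))
      simpa using this
    filter_upwards [hlim.eventually (eventually_lt_nhds hε)] with n hn
    filter_upwards [hnear, hWW] with ω hω hωW h
    by_contra hcon
    have hUn : ω ∉ U n := fun h => hcon (Or.inr h)
    obtain ⟨s, hs, h⟩ := h
    have h1 := hω n hUn (n + 1) n.le_succ s hs
    have h2 := abs_setIntegral_Icc_sub_le (M := C * (2 * (1 / 2) ^ n)) hs (by positivity)
      (hZ.integrableOn htT hB ω) ((hX n).integrableOn htT hB ω) fun r hr =>
        (hB.lipschitz r hr _ _).trans (mul_le_mul_of_nonneg_left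
          (by rw [abs_sub_comm]; exact hω n hUn n le_rfl r hr) hC)
    -- By the recursion, the elementary integral is `X (n + 1)` minus its drift, so its distance to
    -- `Y` is controlled by the convergence of the iterates alone.
    have h3 : (G n).integral W s ω - Y s ω = (X (n + 1) s ω - Z s ω) +
        (∫ r in Set.Icc t s, B r (Z r ω) ∂timeMeasure -
          ∫ r in Set.Icc t s, B r (X n r ω) ∂timeMeasure) := by
      rw [hXG, StepFamily.integral_congr _ hωW, SimpleProcess.toStepFamily_integral]
      simp only [hY]; ring
    rw [h3] at h
    linarith [h.trans (abs_add_le _ _)]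

end StrongSolution

/-! ### The feedback coefficients and the theorem -/

section Feedback

/-- Off the finite exceptional set the function is continuous, and changing a measurable function at
countably many points preserves measurability. -/
theorem PiecewiseContinuousOn.measurable_indicator {f : ℝ≥0 → ℝ} {t T : ℝ≥0}
    (hf : PiecewiseContinuousOn f t T) : Measurable ((Set.Icc t T).indicator f) := by
  classical
  obtain ⟨⟨D, hD⟩, -, -⟩ := hf
  have hm : MeasurableSet (Set.Icc t T \ (D : Set ℝ≥0)) :=
    measurableSet_Icc.diff D.finite_toSet.measurableSet
  have hc : ContinuousOn f (Set.Icc t T \ (D : Set ℝ≥0)) := fun s hs =>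
    (hD s hs.1 hs.2).mono Set.sdiff_subset
  have h1 : Measurable ((Set.Icc t T \ (D : Set ℝ≥0)).indicator f) := by
    rw [← Set.piecewise_eq_indicator]
    exact hc.measurable_piecewise continuousOn_const hm
  refine h1.measurable_of_countable_ne (D.finite_toSet.countable.mono fun s hs => ?_)
  by_contra hsD
  refine hs ?_
  by_cases hsI : s ∈ Set.Icc t T
  · rw [Set.indicator_of_mem hsI,
      Set.indicator_of_mem (s := Set.Icc t T \ (D : Set ℝ≥0)) ⟨hsI, hsD⟩]
  · rw [Set.indicator_of_notMem hsI,
      Set.indicator_of_notMem (s := Set.Icc t T \ (D : Set ℝ≥0)) fun h => hsI h.1]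

/-- The feedback coefficient, set to zero outside `[t, T]`, is a Lipschitz coefficient. -/
theorem isLipschitzCoeff_feedbackCoeff {E : Type*} [NormedAddCommGroup E] [MeasurableSpace E]
    [BorelSpace E] [SecondCountableTopology E] {t T : ℝ≥0} {L : ℝ} {f : ℝ → ℝ → E → ℝ}
    (hfc : Continuous fun p : ℝ × ℝ × E => f p.1 p.2.1 p.2.2) {β ρ : ℝ≥0 → ℝ}
    (hβ : PiecewiseContinuousOn β t T) (hρ : PiecewiseContinuousOn ρ t T)
    (hf : LinearGrowthLipschitz f (β '' Set.Icc t T) L) {ustar : ℝ → ℝ≥0 → ℝ → E}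
    (hum : Measurable fun p : ℝ × ℝ≥0 × ℝ => ustar p.1 p.2.1 p.2.2)
    (huL : ∀ s ∈ Set.Icc t T, ∀ y z, ‖ustar (ρ s) s y - ustar (ρ s) s z‖ ≤ L * |y - z|)
    (hu0 : ∫⁻ s in Set.Icc t T, ENNReal.ofReal (‖ustar (ρ s) s 0‖ ^ 2) ∂timeMeasure < ∞) :
    IsLipschitzCoeff t T (|L| * (1 + |L|)) fun s y =>
      (Set.Icc t T).indicator (fun s => feedbackCoeff f ustar β ρ s y) s := by
  -- Nothing is known about `β` and `ρ` outside `[t, T]`; cutting them off there gives functions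
  -- measurable on the whole axis.
  set β' := (Set.Icc t T).indicator β with hβ'
  set ρ' := (Set.Icc t T).indicator ρ with hρ'
  have hum' : Measurable fun p : ℝ≥0 × ℝ => ustar (ρ' p.1) p.1 p.2 :=
    hum.comp ((hρ.measurable_indicator.comp measurable_fst).prodMk
      (measurable_fst.prodMk measurable_snd))
  refine ⟨?_, fun r hr y z => ?_, ?_⟩
  · have h : (fun p : ℝ≥0 × ℝ =>
        (Set.Icc t T).indicator (fun s => feedbackCoeff f ustar β ρ s p.2) p.1) =
        (Prod.fst ⁻¹' Set.Icc t T).indicator fun p : ℝ≥0 × ℝ =>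
          f (β' p.1) p.2 (ustar (ρ' p.1) p.1 p.2) := by
      ext p
      by_cases hp : p.1 ∈ Set.Icc t T
      · rw [Set.indicator_of_mem hp, Set.indicator_of_mem (by exact hp), hβ', hρ',
          Set.indicator_of_mem hp, Set.indicator_of_mem hp]
        rfl
      · rw [Set.indicator_of_notMem hp, Set.indicator_of_notMem (by exact hp)]
    rw [h]
    refine Measurable.indicator ?_ (measurable_fst measurableSet_Icc)
    exact hfc.measurable.comp ((hβ.measurable_indicator.comp measurable_fst).prodMk
      (measurable_snd.prodMk hum'))
  · simp only [Set.indicator_of_mem hr, feedbackCoeff]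
    -- The feedback enters through the control variable, so its Lipschitz constant multiplies that
    -- of `f`. Absolute values appear because no sign is imposed on `L`.
    calc _ ≤ L * (|y - z| + ‖ustar (ρ r) r y - ustar (ρ r) r z‖) :=
          hf.lipschitz _ ⟨r, hr, rfl⟩ _ _ _ _
      _ ≤ |L| * (|y - z| + |L| * |y - z|) := by
          gcongr
          · exact le_abs_self L
          · exact (huL r hr y z).trans (mul_le_mul_of_nonneg_right (le_abs_self L) (abs_nonneg _))
      _ = _ := by ring
  -- At `y = 0` linear growth bounds the coefficient by `|K| (1 + ‖u*(ρ_r, r, 0)‖)`, which has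
  -- finite energy by the square integrability of the feedback at zero.
  · obtain ⟨K, hK⟩ := hf.growth
    refine (pathEnergy_le_of_abs_le (C := |K|) (g := fun r => 1 + ‖ustar (ρ r) r 0‖)
      fun r hr => ?_).trans_lt ?_
    · rw [Set.indicator_of_mem hr, feedbackCoeff, abs_of_nonneg (a := 1 + ‖_‖) (by positivity)]
      calc _ ≤ K * (1 + |0| + ‖ustar (ρ r) r 0‖) := hK _ ⟨r, hr, rfl⟩ _ _
        _ ≤ _ := by
          rw [abs_zero, add_zero]
          exact mul_le_mul_of_nonneg_right (le_abs_self K) (by positivity)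
    · refine ENNReal.mul_lt_top ENNReal.ofReal_lt_top ((pathEnergy_le_add (g := fun _ => 1)
        (k := fun r => ‖ustar (ρ r) r 0‖) aemeasurable_const fun _ _ => rfl).trans_lt ?_)
      refine ENNReal.add_lt_top.2 ⟨ENNReal.mul_lt_top (by simp) ?_,
        ENNReal.mul_lt_top (by simp) hu0⟩
      exact pathEnergy_lt_top_of_continuousOn continuousOn_const

/-- Being a strong solution depends only on the coefficients on `[t, T]`. -/
theorem IsStrongSolution.congr {Ω : Type*} {mΩ : MeasurableSpace Ω} {F : Filtration ℝ≥0 mΩ}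
    {P : Measure Ω} {W : ℝ≥0 → Ω → ℝ} {t T : ℝ≥0} {x : ℝ} {B S B' S' : ℝ≥0 → ℝ → ℝ}
    {X : ℝ≥0 → Ω → ℝ} (hX : IsStrongSolution F P W t T x B S X)
    (hB : ∀ s ∈ Set.Icc t T, ∀ y, B s y = B' s y) (hS : ∀ s ∈ Set.Icc t T, ∀ y, S s y = S' s y) :
    IsStrongSolution F P W t T x B' S' X := by
  obtain ⟨Y, ⟨hp, hsq, ha, hc, G, hG, hGY⟩, heq⟩ := hX.equation
  refine ⟨hX.adapted, hX.continuous, hX.initial, ?_, Y, ⟨?_, ?_, ha, hc, G, fun ε hε => ?_, hGY⟩, ?_⟩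
  · filter_upwards [hX.drift_integrable] with ω hω
    exact hω.congr_fun (fun s hs => hB s hs _) measurableSet_Icc
  · convert hp using 3 with s ω
    exact congrFun (Set.indicator_congr fun r hr => (hS r hr (X r ω)).symm) s
  · filter_upwards [hsq] with ω hω
    exact (setLIntegral_congr_fun measurableSet_Icc fun s hs => by
      simp only [hS s hs]).symm.trans_lt hω
  · refine (hG ε hε).congr fun k => ?_
    congr 1
    ext ω
    simp only [Set.mem_ofPred_eq]
    rw [setLIntegral_congr_fun measurableSet_Icc fun s hs => by rw [hS s hs]]
  · filter_upwards [heq] with ω hω s hs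
    rw [hω s hs, setIntegral_congr_fun measurableSet_Icc fun r hr =>
      hB r ⟨hr.1, hr.2.trans hs.2⟩ (X r ω)]

end Feedback

theorem theorem1 {Ω : Type*} {mΩ : MeasurableSpace Ω} (P : Measure Ω) [IsProbabilityMeasure P]
    (W : ℝ≥0 → Ω → ℝ) (hWm : ∀ s, Measurable (W s)) (hW : IsBrownianReal W P)
    (t T : ℝ≥0) (htT : t ≤ T) (x L : ℝ) (m : ℕ)
    (b σ : ℝ → ℝ → EuclideanSpace ℝ (Fin m) → ℝ)
    (hbc : Continuous fun p : ℝ × ℝ × EuclideanSpace ℝ (Fin m) => b p.1 p.2.1 p.2.2)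
    (hσc : Continuous fun p : ℝ × ℝ × EuclideanSpace ℝ (Fin m) => σ p.1 p.2.1 p.2.2)
    (β ρ : ℝ≥0 → ℝ) (hβ : PiecewiseContinuousOn β t T) (hρ : PiecewiseContinuousOn ρ t T)
    (hb : LinearGrowthLipschitz b (β '' Set.Icc t T) L)
    (hσ : LinearGrowthLipschitz σ (β '' Set.Icc t T) L)
    (ustar : ℝ → ℝ≥0 → ℝ → EuclideanSpace ℝ (Fin m))
    (hum : Measurable fun p : ℝ × ℝ≥0 × ℝ => ustar p.1 p.2.1 p.2.2)
    (huL : ∀ s ∈ Set.Icc t T, ∀ y z, ‖ustar (ρ s) s y - ustar (ρ s) s z‖ ≤ L * |y - z|)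
    (hu0 : ∫⁻ s in Set.Icc t T, ENNReal.ofReal (‖ustar (ρ s) s 0‖ ^ 2) ∂timeMeasure < ∞) :
    (∃ X : ℝ≥0 → Ω → ℝ,
      IsStrongSolution (brownianFiltration P W hWm) P W t T x
        (feedbackCoeff b ustar β ρ) (feedbackCoeff σ ustar β ρ) X) ∧
    (∀ X X' : ℝ≥0 → Ω → ℝ,
      IsStrongSolution (brownianFiltration P W hWm) P W t T x
        (feedbackCoeff b ustar β ρ) (feedbackCoeff σ ustar β ρ) X →
      IsStrongSolution (brownianFiltration P W hWm) P W t T x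
        (feedbackCoeff b ustar β ρ) (feedbackCoeff σ ustar β ρ) X' →
      ∀ᵐ ω ∂P, ∀ s ∈ Set.Icc t T, X s ω = X' s ω) := by
  have hBF := hW.isBrownianFor hWm
  have hbL := isLipschitzCoeff_feedbackCoeff hbc hβ hρ hb hum huL hu0
  have hσL := isLipschitzCoeff_feedbackCoeff hσc hβ hρ hσ hum huL hu0
  have hext : ∀ f : ℝ → ℝ → EuclideanSpace ℝ (Fin m) → ℝ, ∀ s ∈ Set.Icc t T, ∀ y,
      (Set.Icc t T).indicator (fun s => feedbackCoeff f ustar β ρ s y) s =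
        feedbackCoeff f ustar β ρ s y := fun f s hs y => Set.indicator_of_mem hs _
  refine ⟨?_, fun X X' hX hX' => ?_⟩
  · obtain ⟨X, hX⟩ := exists_isStrongSolution hBF htT (by positivity) hbL hσL x
    exact ⟨X, hX.congr (hext b) (hext σ)⟩
  · exact (hX.congr (fun s hs y => (hext b s hs y).symm) fun s hs y =>
      (hext σ s hs y).symm).ae_eq hBF htT hbL.measurable hσL.measurable hbL.lipschitz
        hσL.lipschitz (hX'.congr (fun s hs y => (hext b s hs y).symm) fun s hs y =>
          (hext σ s hs y).symm)
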